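/- Let $I\subset\mathbb{R}$ be a non-empty open interval (finite, semi-infinite or infinite) and let $\Gamma=(\Gamma^1,\Gamma^2):I\to\mathbb{R}^2$ be a unit-speed curve of class $C^1$. Put $T:=\dot\Gamma$ and $N:=(-\dot\Gamma^2,\dot\Gamma^1)$. Assume: (i) $\Gamma\in W^{2,\infty}_{\mathrm{loc}}(I;\mathbb{R}^2)$ and the signed curvature $\kappa$, defined by $\dot T=\kappa N$, belongs to $L^\infty(I)$. (ii) For all sufficiently small $\varepsilon>0$ the map $\mathcal{L}(s,t):=\Gamma(s)+\varepsilon\,t\,N(s)$ is injective on $\Omega_0:=I\times(-1,1)$. (iii) $\delta:(0,\infty)\to(0,\infty)$ is a continuous function with $\delta(\varepsilon)\to0$, $\varepsilon/\delta(\varepsilon)\to0$ and $\sigma_\kappa(\delta(\varepsilon))\to0$ as $\varepsilon\to0^+$, where $\kappa$ is extended by zero to $\mathbb{R}$ and $$\sigma_f(d):=\sup_{n\in\mathbb{Z}}\Big(\sup_{|\eta|\le d/2}\int_n^{n+1}|f(s)-f(s+\eta)|^2\,ds\Big)^{1/2}.$$ Let $\Omega_\varepsilon:=\mathcal{L}(\Omega_0)$,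 let $-\Delta_D^{\Omega}$ denote the Dirichlet Laplacian in $L^2(\Omega)$, i.e. the self-adjoint operator associated with the form $\|\nabla\psi\|^2$, $\psi\in W^{1,2}_0(\Omega)$, and let $H_{\mathrm{eff}}:=-\Delta_D^I-\kappa^2/4$ in $L^2(I)$. Let $E_1=\pi^2/4$ and $\mathcal{J}_1(t)=\cos(\pi t/2)$, and let $\kappa^\varepsilon(s):=\delta(\varepsilon)^{-1}\int_{s-\delta(\varepsilon)/2}^{s+\delta(\varepsilon)/2}\kappa(\xi)\,d\xi$. With $h(s,t):=1-\varepsilon\kappa(s)t$, let $U:L^2(\Omega_\varepsilon)\to L^2(\Omega_0)$, $U\psi:=\sqrt{\varepsilon h}\,(\psi\circ\mathcal{L})$. Then $E_1$ is the lowest eigenvalue of $-\Delta_D^{(-1,1)}$ and $\mathcal{J}_1$ is a corresponding eigenfunction, positive and normalised to one in $L^2((-1,1))$; the resolvent $(H_{\mathrm{eff}}-i)^{-1}$ exists as a bounded operator; and there exist positive constants $\varepsilon_0$ and $C$ such that for all $0<\varepsilon\le\varepsilon_0$ the map $U$ is a well-defined unitary operator, the resolvent $(-\Delta_D^{\Omega_\varepsilon}-\varepsilon^{-2}E_1-i)^{-1}$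 exists as a bounded operator, and $$\Big\|U\big(-\Delta_D^{\Omega_\varepsilon}-\varepsilon^{-2}E_1-i\big)^{-1}U^{-1}-(H_{\mathrm{eff}}-i)^{-1}\oplus0^\bot\Big\|_{\mathcal{B}(L^2(\Omega_0))}\le C\Big(\varepsilon+\varepsilon\,\|\dot\kappa^\varepsilon\|_{L^\infty(I)}+\sigma_\kappa(\delta(\varepsilon))\Big).$$ Here $(H_{\mathrm{eff}}-i)^{-1}$ acts on the closed subspace $\{\varphi\otimes\mathcal{J}_1 : \varphi\in L^2(I)\}$ of $L^2(\Omega_0)$ through the identification $\varphi\otimes\mathcal{J}_1\leftrightarrow\varphi$, and $0^\bot$ is the zero operator on its orthogonal complement. -/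

import Mathlib

open MeasureTheory Set Filter Topology
open scoped ENNReal ContDiff

noncomputable section

namespace Waveguide

/-! ### The Dirichlet Laplacian of an open set -/

section DirichletLaplacian

/-- The Hilbert space `L²(Ω)` of complex functions, with respect to Lebesgue measure. -/
abbrev L2 {E : Type} [MeasureSpace E] (Ω : Set E) : Type :=
  Lp ℂ 2 (volume.restrict Ω)

variable {E : Type} [NormedAddCommGroup E] [NormedSpace ℝ E] [MeasureSpace E]
variable {ι : Type} [Fintype ι]

/-- The space `C_c^∞(Ω)` of test functions on `Ω`. -/
def testFunctions (Ω : Set E) : Submodule ℂ (E → ℂ) where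
  carrier := {φ | ContDiff ℝ ∞ φ ∧ HasCompactSupport φ ∧ tsupport φ ⊆ Ω}
  zero_mem' := by
    refine ⟨contDiff_const, HasCompactSupport.zero, ?_⟩
    have h : tsupport (0 : E → ℂ) = ∅ := tsupport_eq_empty_iff.2 rfl
    rw [h]
    exact empty_subset _
  add_mem' := by
    rintro φ χ ⟨h1, h2, h3⟩ ⟨k1, k2, k3⟩
    exact ⟨h1.add k1, h2.add k2, (tsupport_add φ χ).trans (union_subset h3 k3)⟩
  smul_mem' := by
    rintro c φ ⟨h1, h2, h3⟩
    refine ⟨contDiff_const.smul h1, h2.smul_left, ?_⟩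
    exact (closure_mono (Function.support_const_smul_subset c φ)).trans h3

/-- The pairs `(φ, ∇φ)` with `φ ∈ C_c^∞(Ω)`, as elements of `L²(Ω) × L²(Ω)^ι`. Here `e` is the family
of coordinate directions, so that `∇φ = (∂_{e i} φ)_i`. -/
def testGraph (e : ι → E) (Ω : Set E) : Submodule ℂ (L2 Ω × (ι → L2 Ω)) where
  carrier := {p | ∃ φ ∈ testFunctions Ω, p.1 =ᵐ[volume.restrict Ω] φ ∧
    ∀ i, p.2 i =ᵐ[volume.restrict Ω] fun x => fderiv ℝ φ x (e i)}
  zero_mem' := by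
    refine ⟨0, zero_mem _, Lp.coeFn_zero _ _ _, fun i => ?_⟩
    refine (Lp.coeFn_zero _ _ _).trans (Eventually.of_forall fun x => ?_)
    simp
  add_mem' := by
    rintro p q ⟨φ, hφ, h1, h2⟩ ⟨χ, hχ, k1, k2⟩
    refine ⟨φ + χ, add_mem hφ hχ, (Lp.coeFn_add _ _).trans (h1.add k1), fun i => ?_⟩
    refine (Lp.coeFn_add _ _).trans (((h2 i).add (k2 i)).trans (Eventually.of_forall fun x => ?_))
    have d1 : DifferentiableAt ℝ φ x := hφ.1.differentiable (by simp) x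
    have d2 : DifferentiableAt ℝ χ x := hχ.1.differentiable (by simp) x
    simp [fderiv_add d1 d2]
  smul_mem' := by
    rintro c p ⟨φ, hφ, h1, h2⟩
    refine ⟨c • φ, (testFunctions Ω).smul_mem c hφ,
      (Lp.coeFn_smul _ _).trans (h1.const_smul c), fun i => ?_⟩
    refine (Lp.coeFn_smul _ _).trans (((h2 i).const_smul c).trans (Eventually.of_forall fun x => ?_))
    have d1 : DifferentiableAt ℝ φ x := hφ.1.differentiable (by simp) x
    simp [fderiv_const_smul d1 c]

/-- The Sobolev space `W₀^{1,2}(Ω)`, the closure of `C_c^∞(Ω)` in the `W^{1,2}`-norm: a function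
`ψ ∈ L²(Ω)` belongs to it, with weak gradient `g`, iff `(ψ, g) ∈ sobolevZero e Ω`. -/
def sobolevZero (e : ι → E) (Ω : Set E) : Submodule ℂ (L2 Ω × (ι → L2 Ω)) :=
  (testGraph e Ω).topologicalClosure

/-- The graph of the operator associated with the closed form `Q(φ, ψ) = ∑ i, (∂ᵢφ, ∂ᵢψ)`,
`Dom Q = W₀^{1,2}(Ω)`: the pairs `(ψ, f)` with `ψ ∈ Dom Q` and `Q(φ, ψ) = (φ, f)` for all
`φ ∈ Dom Q`. -/
def dirichletGraph (e : ι → E) (Ω : Set E) : Submodule ℂ (L2 Ω × L2 Ω) where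
  carrier := {p | ∃ g, (p.1, g) ∈ sobolevZero e Ω ∧
    ∀ φ k, (φ, k) ∈ sobolevZero e Ω → ∑ i, inner ℂ (k i) (g i) = inner ℂ φ p.2}
  zero_mem' := ⟨0, zero_mem _, fun φ k _ => by simp⟩
  add_mem' := by
    rintro p q ⟨g, hg, h⟩ ⟨g', hg', h'⟩
    refine ⟨g + g', add_mem hg hg', fun φ k hk => ?_⟩
    simp [inner_add_right, Finset.sum_add_distrib, h φ k hk, h' φ k hk]
  smul_mem' := by
    rintro c p ⟨g, hg, h⟩
    refine ⟨c • g, (sobolevZero e Ω).smul_mem c hg, fun φ k hk => ?_⟩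
    simp [inner_smul_right, ← Finset.mul_sum, h φ k hk]

/-- The Dirichlet Laplacian `-Δ_D^Ω` in `L²(Ω)`. -/
def dirichletLaplacian (e : ι → E) (Ω : Set E) : L2 Ω →ₗ.[ℂ] L2 Ω :=
  (dirichletGraph e Ω).toLinearPMap

/-- For open `Ω` the graph above is single-valued, so it is the graph of `-Δ_D^Ω`. -/
theorem dirichletLaplacian_graph [FiniteDimensional ℝ E] [BorelSpace E]
    [IsLocallyFiniteMeasure (volume : Measure E)] (e : ι → E) {Ω : Set E} (hΩ : IsOpen Ω) :
    (dirichletLaplacian e Ω).graph = dirichletGraph e Ω := by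
  refine Submodule.toLinearPMap_graph_eq _ ?_
  rintro ⟨ψ, f⟩ ⟨g, hg, h⟩ hψ
  obtain rfl : ψ = 0 := hψ
  have hg0 : g = 0 := by
    have h1 := h 0 g hg
    simp only [inner_zero_left, inner_self_eq_norm_sq_to_K] at h1
    have h2 : ∑ i, ‖g i‖ ^ 2 = 0 := by
      apply Complex.ofReal_injective
      simpa using h1
    rw [Finset.sum_eq_zero_iff_of_nonneg (fun i _ => by positivity)] at h2
    funext i
    simpa using h2 i (Finset.mem_univ i)
  subst hg0
  have key : ∀ᵐ x ∂volume, x ∈ Ω → (f : E → ℂ) x = 0 := by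
    refine hΩ.ae_eq_zero_of_integral_contDiff_smul_eq_zero ?_ ?_
    · refine locallyIntegrableOn_of_locallyIntegrable_restrict ?_
      exact (Lp.memLp f).locallyIntegrable (by norm_num)
    · intro u hu hc hs
      have hmem : (fun x => (u x : ℂ)) ∈ testFunctions Ω := by
        refine ⟨Complex.ofRealCLM.contDiff.comp hu, hc.comp_left Complex.ofReal_zero, ?_⟩
        exact (closure_mono (Function.support_comp_subset Complex.ofReal_zero u)).trans hs
      have hL : MemLp (fun x => (u x : ℂ)) 2 (volume.restrict Ω) :=
        (hmem.1.continuous.memLp_of_hasCompactSupport hmem.2.1).restrict Ω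
      have hD : ∀ i, MemLp (fun x => fderiv ℝ (fun x => (u x : ℂ)) x (e i)) 2
          (volume.restrict Ω) := fun i =>
        (((hmem.1.continuous_fderiv (by simp)).clm_apply
          continuous_const).memLp_of_hasCompactSupport
            (hmem.2.1.fderiv_apply (𝕜 := ℝ) (e i))).restrict Ω
      have h3 := h (hL.toLp _) (fun i => (hD i).toLp _)
        (Submodule.le_topologicalClosure _ ⟨_, hmem, hL.coeFn_toLp, fun i => (hD i).coeFn_toLp⟩)
      simp only [Pi.zero_apply, inner_zero_right, Finset.sum_const_zero, L2.inner_def] at h3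
      have h4 : ∫ x in Ω, u x • (f : E → ℂ) x = 0 := by
        rw [h3]
        refine integral_congr_ae ?_
        filter_upwards [hL.coeFn_toLp] with x hx
        rw [hx]
        simp [mul_comm]
      rw [← h4, setIntegral_eq_integral_of_forall_compl_eq_zero]
      intro x hx
      rw [image_eq_zero_of_notMem_tsupport (fun hx' => hx (hs hx')), zero_smul]
  have : f =ᵐ[volume.restrict Ω] 0 := (ae_restrict_iff' hΩ.measurableSet).2 key
  exact (Lp.eq_zero_iff_ae_eq_zero).2 this

/-- The (maximal) operator of multiplication by a real function `V` in `L²(Ω)`. -/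
def mulOperator (Ω : Set E) (V : E → ℝ) : L2 Ω →ₗ.[ℂ] L2 Ω where
  domain :=
    { carrier := {ψ | MemLp (fun x => (V x : ℂ) * (ψ : E → ℂ) x) 2 (volume.restrict Ω)}
      zero_mem' := by
        refine (memLp_congr_ae ?_).2 (MemLp.zero (ε := ℂ))
        filter_upwards [Lp.coeFn_zero ℂ 2 (volume.restrict Ω)] with x hx
        rw [hx]
        simp
      add_mem' := by
        intro ψ χ h k
        refine (memLp_congr_ae ?_).2 (MemLp.add h k)
        filter_upwards [Lp.coeFn_add ψ χ] with x hx
        rw [hx]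
        simp [mul_add]
      smul_mem' := by
        intro c ψ h
        refine (memLp_congr_ae ?_).2 (MemLp.const_smul h c)
        filter_upwards [Lp.coeFn_smul c ψ] with x hx
        rw [hx]
        simp [mul_left_comm] }
  toFun :=
    { toFun := fun ψ => MemLp.toLp _ ψ.2
      map_add' := by
        intro ψ χ
        rw [← MemLp.toLp_add]
        refine MemLp.toLp_congr _ _ ?_
        filter_upwards [Lp.coeFn_add ψ.1 χ.1] with x hx
        rw [Submodule.coe_add, hx]
        simp [mul_add]
      map_smul' := by
        intro c ψ
        rw [RingHom.id_apply, ← MemLp.toLp_const_smul]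
        refine MemLp.toLp_congr _ _ ?_
        filter_upwards [Lp.coeFn_smul c ψ.1] with x hx
        rw [Submodule.coe_smul, hx]
        simp [mul_left_comm] }

end DirichletLaplacian

/-- `R = (A - z)⁻¹` as a bounded, everywhere defined operator. -/
def IsResolvent {H : Type} [NormedAddCommGroup H] [NormedSpace ℂ H]
    (A : H →ₗ.[ℂ] H) (z : ℂ) (R : H →L[ℂ] H) : Prop :=
  ∀ f ψ : H, R f = ψ ↔ ∃ hψ : ψ ∈ A.domain, A ⟨ψ, hψ⟩ - z • ψ = f

/-! ### The ground state of the cross-section -/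

/-- The coordinate direction of the line. -/
def axisLine : Fin 1 → ℝ := fun _ => 1

/-- The coordinate directions of the plane. -/
def axisPlane : Fin 2 → ℝ × ℝ := ![(1, 0), (0, 1)]

/-- The cross-section `(-1, 1)`. -/
def crossSection : Set ℝ := Ioo (-1) 1

/-- The lowest eigenvalue of `-Δ_D^{(-1,1)}`. -/
def E₁ : ℝ := Real.pi ^ 2 / 4

/-- The eigenfunction of `-Δ_D^{(-1,1)}` for the eigenvalue `E₁` which is positive and normalised
to one in `L²((-1,1))`. -/
def J₁ (t : ℝ) : ℝ := Real.cos (Real.pi * t / 2)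

/-- `E` is the lowest eigenvalue of `-Δ_D^{(-1,1)}`, and `J` is an eigenfunction for it, positive
on `(-1,1)` and normalised to one in `L²((-1,1))`. -/
def IsGroundState (E : ℝ) (J : ℝ → ℝ) : Prop :=
  IsLeast {lam : ℝ | ∃ u : (dirichletLaplacian axisLine crossSection).domain, u ≠ 0 ∧
    dirichletLaplacian axisLine crossSection u = (lam : ℂ) • (u : L2 crossSection)} E ∧
  (∀ t ∈ crossSection, 0 < J t) ∧
  ∃ u : (dirichletLaplacian axisLine crossSection).domain,
    (u : L2 crossSection) =ᵐ[volume.restrict crossSection] (fun t => (J t : ℂ)) ∧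
    ‖(u : L2 crossSection)‖ = 1 ∧
    dirichletLaplacian axisLine crossSection u = (E : ℂ) • (u : L2 crossSection)

/-! ### The strip -/

/-- The straight strip `Ω₀ = I × (-1, 1)`. -/
def straightStrip (I : Set ℝ) : Set (ℝ × ℝ) := I ×ˢ crossSection

theorem restrict_straightStrip (I : Set ℝ) :
    (volume : Measure (ℝ × ℝ)).restrict (straightStrip I) =
      (volume.restrict I).prod (volume.restrict crossSection) :=
  (Measure.prod_restrict I crossSection).symm

theorem lintegral_J₁_sq : ∫⁻ t in crossSection, ‖(J₁ t : ℂ)‖ₑ ^ (2 : ℝ) = 1 := by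
  have h1 : ∀ t, ‖(J₁ t : ℂ)‖ₑ ^ (2 : ℝ) = ENNReal.ofReal (J₁ t ^ 2) := by
    intro t
    rw [← ofReal_norm, ENNReal.ofReal_rpow_of_nonneg (norm_nonneg _) (by norm_num)]
    simp
  have hc : Continuous fun t => J₁ t ^ 2 := by
    unfold J₁
    fun_prop
  simp_rw [h1, crossSection]
  rw [← ofReal_integral_eq_lintegral_ofReal
    ((hc.integrableOn_Icc (a := -1) (b := 1)).mono_set Ioo_subset_Icc_self)
    (Eventually.of_forall fun t => sq_nonneg _)]
  have h2 : ∫ t in Ioo (-1 : ℝ) 1, J₁ t ^ 2 = 1 := by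
    rw [← integral_Ioc_eq_integral_Ioo,
      ← intervalIntegral.integral_of_le (by norm_num)]
    have h3 : ∀ t, J₁ t ^ 2 = (fun x => Real.cos x ^ 2) (Real.pi / 2 * t) := by
      intro t
      simp only [J₁]
      ring_nf
    simp_rw [h3]
    rw [intervalIntegral.integral_comp_mul_left (fun x => Real.cos x ^ 2) (by positivity),
      integral_cos_sq]
    simp [field]
  rw [h2, ENNReal.ofReal_one]

theorem eLpNorm_tensor {I : Set ℝ} (φ : L2 I) :
    eLpNorm (fun p : ℝ × ℝ => (φ : ℝ → ℂ) p.1 * (J₁ p.2 : ℂ)) 2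
      (volume.restrict (straightStrip I)) = eLpNorm φ 2 (volume.restrict I) := by
  have hJ : Measurable fun t => (J₁ t : ℂ) := by
    unfold J₁
    fun_prop
  rw [eLpNorm_eq_lintegral_rpow_enorm_toReal (by norm_num) (by norm_num),
    eLpNorm_eq_lintegral_rpow_enorm_toReal (by norm_num) (by norm_num), restrict_straightStrip]
  simp only [enorm_mul, ENNReal.mul_rpow_of_nonneg _ _ ENNReal.toReal_nonneg]
  rw [lintegral_prod_mul ((Lp.aestronglyMeasurable φ).enorm.pow_const _)
    (hJ.enorm.pow_const _).aemeasurable]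
  rw [show (2 : ℝ≥0∞).toReal = (2 : ℝ) by norm_num, lintegral_J₁_sq, mul_one]

theorem memLp_tensor {I : Set ℝ} (φ : L2 I) :
    MemLp (fun p : ℝ × ℝ => (φ : ℝ → ℂ) p.1 * (J₁ p.2 : ℂ)) 2
      (volume.restrict (straightStrip I)) := by
  refine ⟨?_, by rw [eLpNorm_tensor]; exact Lp.eLpNorm_lt_top φ⟩
  have hJ : Measurable fun t => (J₁ t : ℂ) := by
    unfold J₁
    fun_prop
  rw [restrict_straightStrip]
  exact (Lp.aestronglyMeasurable φ).comp_fst.mul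
    (hJ.comp measurable_snd).aestronglyMeasurable

/-- The isometric embedding `φ ↦ φ ⊗ J₁` of `L²(I)` into `L²(Ω₀)`. -/
def tensorJ₁ (I : Set ℝ) : L2 I →ₗᵢ[ℂ] L2 (straightStrip I) where
  toFun φ := (memLp_tensor φ).toLp _
  map_add' := by
    intro φ χ
    rw [← MemLp.toLp_add]
    refine MemLp.toLp_congr _ _ ?_
    rw [restrict_straightStrip]
    filter_upwards [Measure.quasiMeasurePreserving_fst.ae (Lp.coeFn_add φ χ)] with p hp
    rw [hp]
    simp [add_mul]
  map_smul' := by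
    intro c φ
    rw [RingHom.id_apply, ← MemLp.toLp_const_smul]
    refine MemLp.toLp_congr _ _ ?_
    rw [restrict_straightStrip]
    filter_upwards [Measure.quasiMeasurePreserving_fst.ae (Lp.coeFn_smul c φ)] with p hp
    rw [hp]
    simp [mul_assoc]
  norm_map' := by
    intro φ
    change ‖(memLp_tensor φ).toLp _‖ = _
    rw [Lp.norm_toLp, eLpNorm_tensor]
    rfl

/-- The operator `R ⊕ 0^⊥` on `L²(Ω₀)`: it sends `φ ⊗ J₁` to `(R φ) ⊗ J₁` and vanishes on the
orthogonal complement of `{φ ⊗ J₁ | φ ∈ L²(I)}`. -/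
def extendByZero {I : Set ℝ} (R : L2 I →L[ℂ] L2 I) :
    L2 (straightStrip I) →L[ℂ] L2 (straightStrip I) :=
  (tensorJ₁ I).toContinuousLinearMap ∘L R ∘L
    ContinuousLinearMap.adjoint (tensorJ₁ I).toContinuousLinearMap

/-- A function is in `L^∞_loc(I)`. -/
def MemLinftyLoc (I : Set ℝ) (f : ℝ → ℝ) : Prop :=
  ∀ K ⊆ I, IsCompact K → MemLp f ∞ (volume.restrict K)

/-- `g` is the weak derivative of `f` on `I` (for locally integrable `f` and `g`). -/
def HasWeakDeriv (I : Set ℝ) (f g : ℝ → ℝ) : Prop :=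
  ∀ φ : ℝ → ℝ, ContDiff ℝ ∞ φ → HasCompactSupport φ → tsupport φ ⊆ I →
    ∫ s in I, f s * deriv φ s = -∫ s in I, g s * φ s

/-- The local Sobolev space `W^{2,∞}_loc(I)`. -/
def MemW2InftyLoc (I : Set ℝ) (f : ℝ → ℝ) : Prop :=
  ∃ f' f'' : ℝ → ℝ, HasWeakDeriv I f f' ∧ HasWeakDeriv I f' f'' ∧
    MemLinftyLoc I f ∧ MemLinftyLoc I f' ∧ MemLinftyLoc I f''

/-- The unit tangent `T = Γ̇` of a unit-speed plane curve. -/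
def tangent (Γ : ℝ → ℝ × ℝ) (s : ℝ) : ℝ × ℝ :=
  (deriv (fun r => (Γ r).1) s, deriv (fun r => (Γ r).2) s)

/-- The unit normal `N = (-Γ̇², Γ̇¹)`, such that `(T, N)` is positively oriented. -/
def normal (Γ : ℝ → ℝ × ℝ) (s : ℝ) : ℝ × ℝ := (-(tangent Γ s).2, (tangent Γ s).1)

/-- The signed curvature `κ = Ṫ · N`, that is `Ṫ = κ N`, on `I`, extended by zero to the line.
For a curve in `W^{2,∞}_loc` the tangent is locally Lipschitz, so that `Ṫ` exists almost
everywhere. -/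
def curvature (I : Set ℝ) (Γ : ℝ → ℝ × ℝ) : ℝ → ℝ :=
  I.indicator fun s =>
    deriv (fun r => (tangent Γ r).1) s * (normal Γ s).1 +
      deriv (fun r => (tangent Γ r).2) s * (normal Γ s).2

/-- The map `ℒ(s, t) = Γ(s) + ε t N(s)`. -/
def stripMap (Γ : ℝ → ℝ × ℝ) (ε : ℝ) (p : ℝ × ℝ) : ℝ × ℝ :=
  Γ p.1 + (ε * p.2) • normal Γ p.1

/-- The curved strip `Ω_ε = ℒ(Ω₀)`. -/
def curvedStrip (I : Set ℝ) (Γ : ℝ → ℝ × ℝ) (ε : ℝ) : Set (ℝ × ℝ) :=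
  stripMap Γ ε '' straightStrip I

/-- The function `h(s, t) = 1 - ε κ(s) t`; the Jacobian of `ℒ` is `ε h`. -/
def jacobian (I : Set ℝ) (Γ : ℝ → ℝ × ℝ) (ε : ℝ) (p : ℝ × ℝ) : ℝ :=
  1 - ε * curvature I Γ p.1 * p.2

/-- `U` is the unitary transform `ψ ↦ √(ε h) (ψ ∘ ℒ)` from `L²(Ω_ε)` onto `L²(Ω₀)`. -/
def IsStripTransform (I : Set ℝ) (Γ : ℝ → ℝ × ℝ) (ε : ℝ)
    (U : L2 (curvedStrip I Γ ε) ≃ₗᵢ[ℂ] L2 (straightStrip I)) : Prop :=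
  ∀ ψ : L2 (curvedStrip I Γ ε), U ψ =ᵐ[volume.restrict (straightStrip I)] fun p =>
    (√(ε * jacobian I Γ ε p) : ℂ) * (ψ : ℝ × ℝ → ℂ) (stripMap Γ ε p)

/-- The effective Hamiltonian `-Δ_D^I - κ²/4` in `L²(I)`. -/
def effectiveHamiltonian (I : Set ℝ) (Γ : ℝ → ℝ × ℝ) : L2 I →ₗ.[ℂ] L2 I :=
  dirichletLaplacian axisLine I + mulOperator I fun s => -(curvature I Γ s ^ 2 / 4)

/-! ### Mollification and modulus of continuity -/

/-- The modulus `σ_f(d) = sup_n (sup_{|η| ≤ d/2} ∫_n^{n+1} |f(s) - f(s+η)|² ds)^{1/2}`. -/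
def modulus (f : ℝ → ℝ) (d : ℝ) : ℝ :=
  ⨆ n : ℤ, √(⨆ η : Icc (-(d / 2)) (d / 2), ∫ s in (n : ℝ)..(n + 1), |f s - f (s + η)| ^ 2)

/-- The Steklov approximation `s ↦ d⁻¹ ∫_{s-d/2}^{s+d/2} f`. -/
def steklov (f : ℝ → ℝ) (d : ℝ) (s : ℝ) : ℝ :=
  1 / d * ∫ ξ in (s - d / 2)..(s + d / 2), f ξ

/-- The norm of `L^∞(I)`. -/
def supNorm (I : Set ℝ) (f : ℝ → ℝ) : ℝ :=
  (eLpNorm f ∞ (volume.restrict I)).toReal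

end Waveguide

end

open Waveguide

open MeasureTheory Set Filter Topology
open scoped ENNReal ContDiff

noncomputable section

namespace Waveguide

/-! ### Sobolev functions from Lipschitz functions -/

section Sobolev

/-! Everything is done with quadratic forms. Put u = √ε (ψ ∘ ℒ), so that Uψ = √h u. The resolvent
equation for ψ becomes b(χ, u) = ⟨χ, √h f⟩ for all χ ∈ W₀^{1,2}(Ω₀), where b(χ, u) = ⟨∂ₛχ, h⁻¹ ∂ₛu⟩
+ ε⁻² ⟨∂ₜχ, h ∂ₜu⟩ − (ε⁻² E₁ + i) ⟨χ, h u⟩ (`exists_weak_solution`). Leaving the weight h in the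
form, instead of moving √h into the unknown, keeps derivatives of κ out of it; κ is only bounded.

Let A be the adjoint of φ ↦ φ ⊗ J₁ and θ = (H_eff − i)⁻¹ A f. Since Uψ should be close to θ J₁, the
function u should be close to h^{-1/2} θ J₁ ≈ (1 + ε κ t / 2) J₁ θ. As κ cannot be differentiated,
it is replaced by its Steklov mean k, and the trial function is Φ = (1 + ε k t / 2) J₁ θ. One
integration by parts in t (`transverse_form_trial`) turns the terms of b(χ, Φ) with the factor ε⁻²
into −ε⁻¹ ⟨χ, J₁′ (k − κ) θ⟩ + ⟨χ, (3/2 t J₁′ + 1/2 J₁) k κ θ⟩. The profile J₁′ is orthogonal to J₁,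
so the first term sees only the part of χ orthogonal to the ground state. The second profile has
J₁-component −1/4, and this is where the potential −κ²/4 comes from. The longitudinal derivative of
the profile costs ε ‖k̇‖, and k − κ is a multiplier of size σ_κ from W₀^{1,2} to L²
(`norm_mulL_steklov_sub_sq_le`). Altogether Φ solves the equation up to C η ‖f‖ N(χ), where η is the
bracket on the right-hand side of the theorem and N(χ) = ‖χ‖ + ‖∂ₛχ‖ + ε⁻¹ ‖χ − Pχ‖, P being the
projection onto the tensors φ ⊗ J₁ (`norm_residual_le`).

Conversely N(d)² ≤ C |b(d, d)| (`coercivity`). The imaginary part of b(d, d) controls ‖d‖, and the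
real part controls the rest by the transverse spectral gap. The weight h is linear in t and perturbs
the gap estimate only at order ε² (`transverse_form_ge`), which the factor ε⁻² can bear; an error of
order ε would be fatal. Taking d = u − Φ as its own test function gives N(d) ≤ C η ‖f‖, and this is
the theorem.

The remaining work is regularity. The normal is only Lipschitz, so ℒ is locally bi-Lipschitz and
differentiable almost everywhere, and form domains are carried through it by approximation with
Lipschitz functions (`InSobolevZero.of_lipschitz_tsupport`, `inSobolevZero_comp`). Resolvents exist
because the imaginary part of the spectral parameter keeps the numerical range away from zero
(`exists_formResolvent`). -/

theorem tendsto_eLpNorm_sub_of_dominated {α : Type*} [MeasurableSpace α] {μ : Measure α}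
    {F : ℕ → α → ℂ} {f : α → ℂ} {B : α → ℝ} (hF : ∀ n, AEStronglyMeasurable (F n) μ)
    (hf : AEStronglyMeasurable f μ) (hB : MemLp B 2 μ) (hFB : ∀ n, ∀ᵐ x ∂μ, ‖F n x‖ ≤ B x)
    (hlim : ∀ᵐ x ∂μ, Tendsto (fun n => F n x) atTop (𝓝 (f x))) :
    Tendsto (fun n => eLpNorm (F n - f) 2 μ) atTop (𝓝 0) := by
  have hfB : ∀ᵐ x ∂μ, ‖f x‖ ≤ B x := by
    filter_upwards [hlim, ae_all_iff.2 hFB] with x h1 h2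
    exact le_of_tendsto h1.norm (Eventually.of_forall h2)
  have hB2 : MemLp (fun x => 2 * B x) 2 μ := hB.const_mul 2
  have key : Tendsto (fun n => ∫⁻ x, ‖(F n - f) x‖ₑ ^ (2 : ℝ) ∂μ) atTop
      (𝓝 (∫⁻ _, 0 ∂μ)) := by
    refine tendsto_lintegral_of_dominated_convergence' (fun x => ‖2 * B x‖ₑ ^ (2 : ℝ)) ?_ ?_ ?_ ?_
    · exact fun n => ((hF n).sub hf).enorm.pow_const _
    · intro n
      filter_upwards [hFB n, hfB] with x h1 h2
      gcongr
      rw [enorm_le_iff_norm_le, Pi.sub_apply]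
      refine (norm_sub_le _ _).trans (le_trans ?_ (le_abs_self _))
      linarith
    · have := lintegral_rpow_enorm_lt_top_of_eLpNorm_lt_top (p := 2) (by norm_num) (by norm_num) hB2.2
      simpa using this.ne
    · filter_upwards [hlim] with x hx
      have h1 : Tendsto (fun n => ‖(F n - f) x‖ₑ) atTop (𝓝 0) := by
        have : Tendsto (fun n => F n x - f x) atTop (𝓝 0) := by
          simpa using hx.sub_const (f x)
        simpa using this.enorm
      have := h1.ennrpow_const (2 : ℝ)
      simpa using this
  have h2 := key.ennrpow_const (1 / 2 : ℝ)
  simp only [lintegral_zero] at h2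
  rw [ENNReal.zero_rpow_of_pos (by norm_num)] at h2
  refine h2.congr fun n => ?_
  rw [eLpNorm_eq_lintegral_rpow_enorm_toReal (by norm_num) (by norm_num)]
  simp

/-- A locally Lipschitz function with compact support is Lipschitz. -/
theorem exists_lipschitzWith_of_locallyLipschitz {F : Type*} [NormedAddCommGroup F]
    [NormedSpace ℝ F] [FiniteDimensional ℝ F] {f : F → ℂ} (hf : LocallyLipschitz f)
    (hc : HasCompactSupport f) : ∃ C, LipschitzWith C f := by
  have : ProperSpace F := FiniteDimensional.proper ℝ F
  obtain ⟨M, hM⟩ := hf.continuous.bounded_above_of_compact_support hc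
  have hM0 : 0 ≤ M := (norm_nonneg _).trans (hM 0)
  obtain ⟨C, hC⟩ := LocallyLipschitzOn.exists_lipschitzOnWith_of_compact
    (hc.isCompact.cthickening (r := 1)) hf.locallyLipschitzOn
  have main : ∀ x y, x ∈ tsupport f → dist (f x) (f y) ≤ (C + M.toNNReal) * dist x y := by
    intro x y hx
    by_cases hy : y ∈ Metric.cthickening 1 (tsupport f)
    · refine (hC.dist_le_mul x (Metric.self_subset_cthickening _ hx) y hy).trans ?_
      gcongr
      simp
    · have h1 : 1 ≤ dist x y := by
        by_contra! hlt
        exact hy (Metric.mem_cthickening_of_dist_le y x _ _ hx (by rw [dist_comm]; exact hlt.le))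
      have h2 : f y = 0 := image_eq_zero_of_notMem_tsupport fun h =>
        hy (Metric.self_subset_cthickening _ h)
      rw [h2, dist_zero_right]
      refine (hM x).trans ?_
      rw [Real.coe_toNNReal _ hM0]
      nlinarith [C.2]
  refine ⟨C + M.toNNReal, LipschitzWith.of_dist_le_mul fun x y => ?_⟩
  push_cast
  by_cases hx : x ∈ tsupport f
  · exact main x y hx
  by_cases hy : y ∈ tsupport f
  · rw [dist_comm, dist_comm x]
    exact main y x hy
  · rw [image_eq_zero_of_notMem_tsupport hx, image_eq_zero_of_notMem_tsupport hy, dist_self]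
    positivity

variable {E : Type} [NormedAddCommGroup E] [NormedSpace ℝ E] [MeasureSpace E]
variable {ι : Type} [Fintype ι]

/-- The function `f` belongs to `W₀^{1,2}(Ω)` and has the weak gradient `g`. -/
def InSobolevZero (e : ι → E) (Ω : Set E) (f : E → ℂ) (g : ι → E → ℂ) : Prop :=
  ∃ p ∈ sobolevZero e Ω, p.1 =ᵐ[volume.restrict Ω] f ∧ ∀ i, p.2 i =ᵐ[volume.restrict Ω] g i

/-- `sobolevZero` is closed in the product of L² spaces. One square-integrable bound for the
functions and their gradients therefore lets pointwise limits pass to the graph. -/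
theorem InSobolevZero.of_tendsto {e : ι → E} {Ω : Set E} {F : ℕ → E → ℂ} {G : ℕ → ι → E → ℂ}
    {f : E → ℂ} {g : ι → E → ℂ} {B : E → ℝ} (h : ∀ n, InSobolevZero e Ω (F n) (G n))
    (hB : MemLp B 2 (volume.restrict Ω))
    (hFB : ∀ n, ∀ᵐ x ∂volume.restrict Ω, ‖F n x‖ ≤ B x)
    (hGB : ∀ n i, ∀ᵐ x ∂volume.restrict Ω, ‖G n i x‖ ≤ B x)
    (hf : ∀ᵐ x ∂volume.restrict Ω, Tendsto (fun n => F n x) atTop (𝓝 (f x)))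
    (hg : ∀ i, ∀ᵐ x ∂volume.restrict Ω, Tendsto (fun n => G n i x) atTop (𝓝 (g i x))) :
    InSobolevZero e Ω f g := by
  choose p hp hp1 hp2 using h
  have main : ∀ {F : ℕ → E → ℂ} {f : E → ℂ} (P : ℕ → L2 Ω),
      (∀ n, P n =ᵐ[volume.restrict Ω] F n) →
      (∀ n, ∀ᵐ x ∂volume.restrict Ω, ‖F n x‖ ≤ B x) →
      (∀ᵐ x ∂volume.restrict Ω, Tendsto (fun n => F n x) atTop (𝓝 (f x))) →
      ∃ Q : L2 Ω, Q =ᵐ[volume.restrict Ω] f ∧ Tendsto P atTop (𝓝 Q) := by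
    intro F f P hP hFB hlim
    have hFm : ∀ n, AEStronglyMeasurable (F n) (volume.restrict Ω) := fun n =>
      (Lp.aestronglyMeasurable (P n)).congr (hP n)
    have hfm : AEStronglyMeasurable f (volume.restrict Ω) :=
      aestronglyMeasurable_of_tendsto_ae atTop hFm hlim
    have hfB : ∀ᵐ x ∂volume.restrict Ω, ‖f x‖ ≤ B x := by
      filter_upwards [hlim, ae_all_iff.2 hFB] with x h1 h2
      exact le_of_tendsto h1.norm (Eventually.of_forall h2)
    have hfL : MemLp f 2 (volume.restrict Ω) :=
      hB.mono hfm (hfB.mono fun x hx => hx.trans (le_abs_self _))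
    refine ⟨hfL.toLp f, hfL.coeFn_toLp, ?_⟩
    rw [Lp.tendsto_Lp_iff_tendsto_eLpNorm']
    refine (tendsto_eLpNorm_sub_of_dominated hFm hfm hB hFB hlim).congr fun n => ?_
    exact eLpNorm_congr_ae (((hP n).symm).sub hfL.coeFn_toLp.symm)
  obtain ⟨Q, hQ, hQl⟩ := main (fun n => (p n).1) hp1 hFB hf
  choose R hR hRl using fun i => main (fun n => (p n).2 i) (fun n => hp2 n i)
    (fun n => hGB n i) (hg i)
  refine ⟨(Q, R), ?_, hQ, hR⟩
  refine (Submodule.isClosed_topologicalClosure (testGraph e Ω)).mem_of_tendsto (f := p)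
    (b := atTop) ?_ (Eventually.of_forall hp)
  exact hQl.prodMk_nhds (tendsto_pi_nhds.2 hRl)

variable [FiniteDimensional ℝ E] [BorelSpace E] [(volume : Measure E).IsAddHaarMeasure]

theorem InSobolevZero.of_testFunction {e : ι → E} {Ω : Set E} {φ : E → ℂ}
    (hφ : φ ∈ testFunctions Ω) : InSobolevZero e Ω φ fun i x => fderiv ℝ φ x (e i) := by
  have hL : MemLp φ 2 (volume.restrict Ω) :=
    (hφ.1.continuous.memLp_of_hasCompactSupport hφ.2.1).restrict Ω
  have hD : ∀ i, MemLp (fun x => fderiv ℝ φ x (e i)) 2 (volume.restrict Ω) := fun i =>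
    (((hφ.1.continuous_fderiv (by simp)).clm_apply
      continuous_const).memLp_of_hasCompactSupport (hφ.2.1.fderiv_apply (𝕜 := ℝ) (e i))).restrict Ω
  exact ⟨(hL.toLp _, fun i => (hD i).toLp _), Submodule.le_topologicalClosure _
    ⟨φ, hφ, hL.coeFn_toLp, fun i => (hD i).coeFn_toLp⟩, hL.coeFn_toLp, fun i => (hD i).coeFn_toLp⟩

open Convolution in
theorem norm_normed_convolution_le (φ : ContDiffBump (0 : E)) {g : E → ℂ} {C : ℝ}
    (hg : ∀ x, ‖g x‖ ≤ C) (x : E) :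
    ‖(φ.normed volume ⋆[ContinuousLinearMap.lsmul ℝ ℝ, volume] g) x‖ ≤ C := by
  rw [convolution_def]
  refine (norm_integral_le_of_norm_le (g := fun t => φ.normed volume t * C) ?_ ?_).trans ?_
  · exact (φ.integrable_normed).mul_const C
  · refine Eventually.of_forall fun t => ?_
    simp only [ContinuousLinearMap.lsmul_apply, norm_smul, Real.norm_eq_abs,
      abs_of_nonneg (φ.nonneg_normed t)]
    gcongr
    · exact φ.nonneg_normed t
    · exact hg _
  · rw [integral_mul_const, φ.integral_normed, one_mul]

open Convolution in
-- The derivative falls on `f`, not on the kernel: by Rademacher `f` is differentiable at x − t for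
-- almost every t, and its difference quotients are bounded by the Lipschitz constant. Gradients of
-- mollifications thus inherit the bound of ∇f.
theorem hasFDerivAt_normed_convolution (φ : ContDiffBump (0 : E)) {f : E → ℂ} {C : NNReal}
    (hf : LipschitzWith C f) (x : E) :
    HasFDerivAt (φ.normed volume ⋆[ContinuousLinearMap.lsmul ℝ ℝ, volume] f)
      (∫ t, φ.normed volume t • fderiv ℝ f (x - t)) x := by
  have hd : ∀ᵐ y ∂(volume : Measure E), DifferentiableAt ℝ f y := hf.ae_differentiableAt
  have hq : Measure.QuasiMeasurePreserving (fun t => x - t) (volume : Measure E) volume :=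
    (Measure.measurePreserving_sub_left volume x).quasiMeasurePreserving
  have := (hasFDerivAt_integral_of_dominated_loc_of_lip' (𝕜 := ℝ) (μ := (volume : Measure E))
    (F := fun y t => φ.normed volume t • f (y - t)) (x₀ := x)
    (F' := fun t => φ.normed volume t • fderiv ℝ f (x - t)) (s := univ)
    (bound := fun t => φ.normed volume t * C) univ_mem ?_ ?_ ?_ ?_ ?_ ?_).2
  · exact this
  · intro y _
    exact (φ.continuous_normed.smul (hf.continuous.comp (by fun_prop))).aestronglyMeasurable
  · exact (φ.continuous_normed.smul (hf.continuous.comp (by fun_prop))).integrable_of_hasCompactSupport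
      (φ.hasCompactSupport_normed.smul_right)
  · exact (φ.continuous_normed.measurable.smul
      ((measurable_fderiv ℝ f).comp (by fun_prop))).aestronglyMeasurable
  · refine Eventually.of_forall fun t y _ => ?_
    rw [← smul_sub, norm_smul, Real.norm_eq_abs, abs_of_nonneg (φ.nonneg_normed t), mul_assoc]
    gcongr
    · exact φ.nonneg_normed t
    · simpa using hf.norm_sub_le (y - t) (x - t)
  · exact (φ.integrable_normed).mul_const _
  · filter_upwards [hq.ae hd] with t ht
    have h1 : HasFDerivAt (fun y => f (y - t)) (fderiv ℝ f (x - t)) x := by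
      have h2 := (ht.hasFDerivAt).comp x ((hasFDerivAt_id x).sub_const t)
      rwa [ContinuousLinearMap.comp_id] at h2
    exact h1.fun_const_smul _

open Convolution in
-- Mollification at radii tending to zero. The gradients are mollified gradients, uniformly bounded,
-- supported in one compact set, and convergent at Lebesgue points.
theorem InSobolevZero.of_lipschitz_tsupport {e : ι → E} {Ω : Set E} (hΩ : IsOpen Ω) {f : E → ℂ}
    {C : NNReal} (hf : LipschitzWith C f) (hc : HasCompactSupport f) (hs : tsupport f ⊆ Ω) :
    InSobolevZero e Ω f fun i x => fderiv ℝ f x (e i) := by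
  obtain ⟨r, hr, hrΩ⟩ := hc.isCompact.exists_cthickening_subset_open hΩ hs
  have hK : IsCompact (Metric.cthickening r (tsupport f)) := hc.isCompact.cthickening
  set K := Metric.cthickening r (tsupport f)
  obtain ⟨M, hM⟩ := hf.continuous.bounded_above_of_compact_support hc
  let φ : ℕ → ContDiffBump (0 : E) := fun n =>
    ⟨r / (2 * (n + 1)), r / (n + 1), by positivity, by
      apply div_lt_div_of_pos_left hr (by positivity); linarith [Nat.cast_nonneg (α := ℝ) n]⟩
  have hrout : ∀ n, (φ n).rOut = r / (n + 1) := fun n => rfl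
  have hroutle : ∀ n, (φ n).rOut ≤ r := fun n => by
    rw [hrout]; exact div_le_self hr.le (by linarith [Nat.cast_nonneg (α := ℝ) n])
  have hrlim : Tendsto (fun n => (φ n).rOut) atTop (𝓝 0) := by
    simp only [hrout]
    exact tendsto_const_div_atTop_nhds_zero_nat r |>.comp (tendsto_add_atTop_nat 1) |>.congr
      fun n => by simp
  -- Lebesgue differentiation along the bumps needs comparable inner and outer radii; here the ratio
  -- is exactly 2.
  have hratio : ∀ᶠ n in atTop, (φ n).rOut ≤ 2 * (φ n).rIn := Eventually.of_forall fun n => by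
    change r / (n + 1) ≤ 2 * (r / (2 * (n + 1)))
    apply le_of_eq
    field_simp
  let F : ℕ → E → ℂ := fun n => (φ n).normed volume ⋆[ContinuousLinearMap.lsmul ℝ ℝ, volume] f
  have hFd : ∀ n x, HasFDerivAt (F n) (∫ t, (φ n).normed volume t • fderiv ℝ f (x - t)) x :=
    fun n x => hasFDerivAt_normed_convolution (φ n) hf x
  have hFde : ∀ n i x, fderiv ℝ (F n) x (e i) =
      ((φ n).normed volume ⋆[ContinuousLinearMap.lsmul ℝ ℝ, volume]
        fun y => fderiv ℝ f y (e i)) x := by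
    intro n i x
    rw [(hFd n x).fderiv, ContinuousLinearMap.integral_apply, convolution_def]
    · rfl
    · refine ((φ n).integrable_normed.mul_const (C : ℝ)).mono' ?_ ?_
      · exact ((φ n).continuous_normed.measurable.smul
          ((measurable_fderiv ℝ f).comp (by fun_prop))).aestronglyMeasurable
      · refine Eventually.of_forall fun t => ?_
        rw [norm_smul, Real.norm_eq_abs, abs_of_nonneg ((φ n).nonneg_normed t)]
        gcongr
        · exact (φ n).nonneg_normed t
        · exact norm_fderiv_le_of_lipschitz ℝ hf
  have hdfb : ∀ i x, ‖fderiv ℝ f x (e i)‖ ≤ C * ‖e i‖ := fun i x =>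
    ((fderiv ℝ f x).le_opNorm _).trans (by gcongr; exact norm_fderiv_le_of_lipschitz ℝ hf)
  have hsupp : ∀ n, Function.support (F n) ⊆ K := by
    intro n x hx
    obtain ⟨a, ha, b, hb, rfl⟩ := support_convolution_subset (ContinuousLinearMap.lsmul ℝ ℝ) hx
    rw [(φ n).support_normed_eq] at ha
    refine Metric.mem_cthickening_of_dist_le _ b _ _ (subset_tsupport _ hb) ?_
    have : ‖a‖ < (φ n).rOut := by simpa using ha
    rw [dist_eq_norm]
    simp only [add_sub_cancel_right]
    exact this.le.trans (hroutle n)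
  have htsupp : ∀ n, tsupport (F n) ⊆ K := fun n =>
    closure_minimal (hsupp n) Metric.isClosed_cthickening
  have hFtest : ∀ n, F n ∈ testFunctions Ω := by
    intro n
    refine ⟨?_, ?_, (htsupp n).trans hrΩ⟩
    · exact ((φ n).hasCompactSupport_normed).contDiff_convolution_left _
        (φ n).contDiff_normed hf.continuous.locallyIntegrable
    · exact hK.of_isClosed_subset (isClosed_tsupport _) (htsupp n)
  have hzero : ∀ n x, x ∉ K → fderiv ℝ (F n) x = 0 := fun n x hx =>
    image_eq_zero_of_notMem_tsupport fun h => hx (htsupp n (tsupport_fderiv_subset ℝ h))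
  refine InSobolevZero.of_tendsto (B := K.indicator fun _ => M + ∑ i, C * ‖e i‖)
    (fun n => InSobolevZero.of_testFunction (hFtest n)) ?_ ?_ ?_ ?_ ?_
  · exact (memLp_indicator_const 2 hK.isClosed.measurableSet _
      (Or.inr hK.measure_lt_top.ne)).restrict Ω
  · refine fun n => Eventually.of_forall fun x => ?_
    by_cases hx : x ∈ K
    · rw [indicator_of_mem hx]
      have := norm_normed_convolution_le (φ n) hM x
      have h2 : 0 ≤ ∑ i, C * ‖e i‖ := by positivity
      change ‖(_ : ℂ)‖ ≤ _
      linarith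
    · rw [indicator_of_notMem hx, Function.notMem_support.1 fun h => hx (hsupp n h)]
      simp
  · refine fun n i => Eventually.of_forall fun x => ?_
    by_cases hx : x ∈ K
    · rw [indicator_of_mem hx, hFde]
      have := norm_normed_convolution_le (φ n) (hdfb i) x
      have h2 : C * ‖e i‖ ≤ ∑ i, C * ‖e i‖ :=
        Finset.single_le_sum (f := fun i => (C : ℝ) * ‖e i‖) (fun i _ => by positivity)
          (Finset.mem_univ i)
      have h3 : 0 ≤ M := (norm_nonneg _).trans (hM 0)
      linarith
    · rw [indicator_of_notMem hx, hzero n x hx]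
      simp
  · refine Eventually.of_forall fun x => ?_
    exact ContDiffBump.convolution_tendsto_right_of_continuous hrlim hf.continuous x
  · intro i
    simp only [hFde]
    refine ae_restrict_of_ae ?_
    refine ContDiffBump.ae_convolution_tendsto_right_of_locallyIntegrable hrlim hratio ?_
    have hb : MemLp (fun y => fderiv ℝ f y (e i)) ∞ (volume : Measure E) :=
      memLp_top_of_bound (measurable_fderiv_apply_const ℝ f (e i)).aestronglyMeasurable _
        (Eventually.of_forall (hdfb i))
    exact hb.locallyIntegrable le_top

/-- Here the support may touch the boundary. As `f` vanishes off Ω, |f| ≤ C d with d the distance to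
the complement. A cut-off of slope 1/r that varies only for r < d < 2r then keeps the product
Lipschitz with constant 3C, uniformly in r. -/
theorem InSobolevZero.of_lipschitz {e : ι → E} {Ω : Set E} (hΩ : IsOpen Ω) {f : E → ℂ}
    {C : NNReal} (hf : LipschitzWith C f) (hc : HasCompactSupport f) (hs : ∀ x, x ∉ Ω → f x = 0) :
    InSobolevZero e Ω f fun i x => fderiv ℝ f x (e i) := by
  rcases eq_empty_or_nonempty Ωᶜ with hne | hne
  · exact InSobolevZero.of_lipschitz_tsupport hΩ hf hc (by simp [compl_empty_iff.1 hne])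
  have : ProperSpace E := FiniteDimensional.proper ℝ E
  let d : E → ℝ := fun x => Metric.infDist x Ωᶜ
  have hd : LipschitzWith 1 d := Metric.lipschitz_infDist_pt _
  have hd0 : ∀ x, 0 ≤ d x := fun x => Metric.infDist_nonneg
  have hfd : ∀ x, ‖f x‖ ≤ C * d x := by
    intro x
    obtain ⟨z, hz, hxz⟩ := hΩ.isClosed_compl.exists_infDist_eq_dist hne x
    have := hf.dist_le_mul x z
    rw [hs z hz, dist_zero_right] at this
    simpa only [d, hxz] using this
  have hdpos : ∀ x ∈ Ω, 0 < d x := fun x hx =>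
    (hΩ.isClosed_compl.notMem_iff_infDist_pos hne).1 (by simpa using hx)
  let r : ℕ → ℝ := fun n => 1 / ((n : ℝ) + 1)
  have hr : ∀ n, 0 < r n := fun n => by positivity
  have hrlim : Tendsto r atTop (𝓝 0) := tendsto_one_div_add_atTop_nhds_zero_nat
  let c : ℕ → E → ℝ := fun n x => min 1 (max 0 (d x / r n - 1))
  have hc0 : ∀ n x, 0 ≤ c n x := fun n x => le_min zero_le_one (le_max_left _ _)
  have hc1 : ∀ n x, c n x ≤ 1 := fun n x => min_le_left _ _
  have hcl : ∀ n x y, |c n x - c n y| ≤ dist x y / r n := by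
    intro n x y
    have h1 : |d x - d y| ≤ dist x y := by simpa [Real.dist_eq] using hd.dist_le_mul x y
    have h2 : |c n x - c n y| ≤ |(d x / r n - 1) - (d y / r n - 1)| := by
      have a1 := abs_min_sub_min_le_max 1 (max 0 (d x / r n - 1)) 1 (max 0 (d y / r n - 1))
      have a2 := abs_max_sub_max_le_max 0 (d x / r n - 1) 0 (d y / r n - 1)
      simp only [sub_self, abs_zero] at a1 a2
      exact (a1.trans_eq (max_eq_right (abs_nonneg _))).trans
        (a2.trans_eq (max_eq_right (abs_nonneg _)))
    have h3 : (d x / r n - 1) - (d y / r n - 1) = (d x - d y) / r n := by ring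
    rw [h3, abs_div, abs_of_pos (hr n)] at h2
    exact h2.trans (by gcongr)
  have hone : ∀ n x, 2 * r n ≤ d x → c n x = 1 := by
    intro n x hx
    have : 2 ≤ d x / r n := (le_div_iff₀ (hr n)).2 hx
    exact min_eq_left (le_max_of_le_right (by linarith))
  have hzero : ∀ n x, d x ≤ r n → c n x = 0 := by
    intro n x hx
    have : d x / r n ≤ 1 := (div_le_one (hr n)).2 hx
    simp only [c]
    rw [max_eq_left (by linarith), min_eq_right zero_le_one]
  let F : ℕ → E → ℂ := fun n x => (c n x : ℂ) * f x
  have hnorm : ∀ n x, ‖F n x‖ ≤ ‖f x‖ := by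
    intro n x
    simp only [F, norm_mul, Complex.norm_real, Real.norm_eq_abs, abs_of_nonneg (hc0 n x)]
    exact mul_le_of_le_one_left (norm_nonneg _) (hc1 n x)
  -- The difference of the cut-offs is multiplied by `f` at the point nearer to the complement:
  -- either both cut-offs equal 1, or |f y| ≤ 2 C r, which cancels the slope 1/r.
  have hlip' : ∀ n x y, d y ≤ d x → ‖F n x - F n y‖ ≤ 3 * C * dist x y := by
    intro n x y hxy
    have e1 : F n x - F n y = (c n x : ℂ) * (f x - f y) + ((c n x - c n y : ℝ) : ℂ) * f y := by
      simp only [F]; push_cast; ring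
    have e2 : ‖F n x - F n y‖ ≤ ‖f x - f y‖ + |c n x - c n y| * ‖f y‖ := by
      rw [e1]
      refine (norm_add_le _ _).trans ?_
      simp only [norm_mul, Complex.norm_real, Real.norm_eq_abs, abs_of_nonneg (hc0 n x)]
      gcongr
      exact mul_le_of_le_one_left (norm_nonneg _) (hc1 n x)
    have e3 : ‖f x - f y‖ ≤ C * dist x y := by simpa [dist_eq_norm] using hf.dist_le_mul x y
    have e4 : |c n x - c n y| * ‖f y‖ ≤ 2 * C * dist x y := by
      rcases le_or_gt (2 * r n) (d y) with h | h
      · rw [hone n x (h.trans hxy), hone n y h, sub_self, abs_zero, zero_mul]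
        positivity
      · calc |c n x - c n y| * ‖f y‖ ≤ (dist x y / r n) * (C * (2 * r n)) := by
              gcongr
              · exact hcl n x y
              · exact (hfd y).trans (by gcongr)
          _ = 2 * C * dist x y := by field_simp [(hr n).ne']
    linarith
  have hlip : ∀ n, LipschitzWith (3 * C) (F n) := by
    intro n
    refine LipschitzWith.of_dist_le_mul fun x y => ?_
    rw [dist_eq_norm]
    push_cast
    rcases le_total (d y) (d x) with h | h
    · exact hlip' n x y h
    · rw [norm_sub_rev, dist_comm]
      exact hlip' n y x h
  have hsF : ∀ n, Function.support (F n) ⊆ Function.support f := fun n =>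
    Function.support_mul_subset_right _ _
  have htF : ∀ n, tsupport (F n) ⊆ tsupport f := fun n => closure_mono (hsF n)
  have hFc : ∀ n, HasCompactSupport (F n) := fun n =>
    hc.isCompact.of_isClosed_subset (isClosed_tsupport _) (htF n)
  have hFΩ : ∀ n, tsupport (F n) ⊆ Ω := by
    intro n
    have h1 : tsupport (F n) ⊆ {x | r n ≤ d x} := by
      refine closure_minimal (fun x hx => ?_) (isClosed_le continuous_const hd.continuous)
      by_contra hlt
      simp only [mem_ofPred_eq, not_le] at hlt
      exact hx (by simp [F, hzero n x hlt.le])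
    intro x hx
    by_contra hxΩ
    have h2 : d x = 0 := Metric.infDist_zero_of_mem hxΩ
    have h3 : r n ≤ d x := h1 hx
    linarith [hr n]
  have hev : ∀ x ∈ Ω, ∀ᶠ n in atTop, F n =ᶠ[𝓝 x] f := by
    intro x hx
    have h1 : ∀ᶠ n in atTop, r n < d x / 4 :=
      hrlim.eventually (gt_mem_nhds (by have := hdpos x hx; positivity))
    filter_upwards [h1] with n hn
    have h2 : ∀ᶠ y in 𝓝 x, d x / 2 < d y :=
      hd.continuous.continuousAt.eventually (lt_mem_nhds (half_lt_self (hdpos x hx)))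
    filter_upwards [h2] with y hy
    simp only [F]
    rw [hone n y (by linarith), Complex.ofReal_one, one_mul]
  obtain ⟨M, hM⟩ := hf.continuous.bounded_above_of_compact_support hc
  refine InSobolevZero.of_tendsto (B := (tsupport f).indicator fun _ => M + ∑ i, 3 * C * ‖e i‖)
    (fun n => InSobolevZero.of_lipschitz_tsupport hΩ (hlip n) (hFc n) (hFΩ n)) ?_ ?_ ?_ ?_ ?_
  · exact (memLp_indicator_const 2 (isClosed_tsupport f).measurableSet _
      (Or.inr hc.isCompact.measure_lt_top.ne)).restrict Ω
  · refine fun n => Eventually.of_forall fun x => ?_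
    by_cases hx : x ∈ tsupport f
    · rw [indicator_of_mem hx]
      have h2 : 0 ≤ ∑ i, 3 * C * ‖e i‖ := by positivity
      linarith [hnorm n x, hM x]
    · rw [indicator_of_notMem hx, image_eq_zero_of_notMem_tsupport fun h => hx (htF n h)]
      simp
  · refine fun n i => Eventually.of_forall fun x => ?_
    by_cases hx : x ∈ tsupport f
    · rw [indicator_of_mem hx]
      have h1 : ‖fderiv ℝ (F n) x (e i)‖ ≤ 3 * C * ‖e i‖ :=
        ((fderiv ℝ (F n) x).le_opNorm _).trans
          (by gcongr; exact norm_fderiv_le_of_lipschitz ℝ (hlip n))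
      have h2 : 3 * C * ‖e i‖ ≤ ∑ i, 3 * C * ‖e i‖ :=
        Finset.single_le_sum (f := fun i => 3 * (C : ℝ) * ‖e i‖) (fun i _ => by positivity)
          (Finset.mem_univ i)
      have h3 : 0 ≤ M := (norm_nonneg _).trans (hM 0)
      linarith
    · rw [indicator_of_notMem hx, image_eq_zero_of_notMem_tsupport
        (f := fderiv ℝ (F n)) fun h => hx (htF n (tsupport_fderiv_subset ℝ h))]
      simp
  · filter_upwards [ae_restrict_mem hΩ.measurableSet] with x hx
    refine tendsto_const_nhds.congr' ?_
    filter_upwards [hev x hx] with n hn using hn.eq_of_nhds.symm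
  · intro i
    filter_upwards [ae_restrict_mem hΩ.measurableSet] with x hx
    refine tendsto_const_nhds.congr' ?_
    filter_upwards [hev x hx] with n hn
    rw [hn.fderiv_eq]

end Sobolev

/-! ### Existence of resolvents -/

section Resolvent

/-- A bounded operator on a Hilbert space whose numerical range stays away from zero is
invertible. -/
theorem bijective_of_norm_inner_ge {H : Type*} [NormedAddCommGroup H] [InnerProductSpace ℂ H]
    [CompleteSpace H] (B : H →L[ℂ] H) {c : ℝ} (hc : 0 < c)
    (hB : ∀ x, c * ‖x‖ ^ 2 ≤ ‖inner ℂ x (B x)‖) : B.ker = ⊥ ∧ B.range = ⊤ := by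
  have hb : ∀ x, c * ‖x‖ ≤ ‖B x‖ := by
    intro x
    rcases (norm_nonneg x).eq_or_lt with h | h
    · rw [← h]; simp
    · have h1 := (hB x).trans (norm_inner_le_norm x (B x))
      have h2 : ‖x‖ * (c * ‖x‖) ≤ ‖x‖ * ‖B x‖ := by linarith [pow_two ‖x‖]
      exact le_of_mul_le_mul_left h2 h
  have ha : AntilipschitzWith (Real.toNNReal c⁻¹) B := by
    refine B.antilipschitz_of_bound fun x => ?_
    rw [Real.coe_toNNReal _ (by positivity), inv_mul_eq_div, le_div_iff₀ hc]
    linarith [hb x]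
  refine ⟨LinearMap.ker_eq_bot.2 ha.injective, ?_⟩
  have hcl : IsClosed (B.range : Set H) := ha.isClosed_range B.uniformContinuous
  have := hcl.completeSpace_coe
  -- The range is closed by the lower bound, and a vector w orthogonal to it has ⟨w, Bw⟩ = 0, hence
  -- w = 0.
  rw [← B.range.orthogonal_orthogonal, Submodule.eq_top_iff']
  intro v w hw
  have h1 : inner ℂ w (B w) = 0 := by
    rw [← inner_conj_symm, hw (B w) ⟨w, rfl⟩, map_zero]
  have h2 := hB w
  rw [h1, norm_zero] at h2
  have h3 : ‖w‖ ^ 2 ≤ 0 := by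
    by_contra! h
    have := mul_pos hc h
    linarith
  have h4 : w = 0 := by
    have : ‖w‖ ^ 2 = 0 := le_antisymm h3 (by positivity)
    simpa using this
  rw [h4, inner_zero_left]

variable {X : Type*} [NormedAddCommGroup X] [InnerProductSpace ℂ X] [CompleteSpace X]

/-- `a` and `b` stand for ψ ↦ ψ and ψ ↦ ∇ψ on the form domain. At the spectral parameter lam + i the
imaginary part of the form is −‖a x‖², which bounds the function. The real part then bounds the
gradient whatever the sign of `V` or `lam`. -/
theorem exists_formResolvent_aux {H Y : Type*} [NormedAddCommGroup H] [InnerProductSpace ℂ H]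
    [CompleteSpace H] [NormedAddCommGroup Y] [InnerProductSpace ℂ Y] [CompleteSpace Y]
    (a : H →L[ℂ] X) (b : H →L[ℂ] Y) (hab : ∀ x, ‖x‖ ^ 2 = ‖a x‖ ^ 2 + ‖b x‖ ^ 2)
    (V : X →L[ℂ] X) (hV : ∀ x, (inner ℂ x (V x)).im = 0) (lam : ℝ) :
    ∃ S : X →L[ℂ] H, ∀ f x, S f = x ↔ ∀ y, inner ℂ (b y) (b x) + inner ℂ (a y) (V (a x)) -
      (lam + Complex.I) * inner ℂ (a y) (a x) = inner ℂ (a y) f := by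
  let B : H →L[ℂ] H := ContinuousLinearMap.adjoint b ∘L b +
    ContinuousLinearMap.adjoint a ∘L (V - (lam + Complex.I : ℂ) • ContinuousLinearMap.id ℂ X) ∘L a
  have hBi : ∀ y x, inner ℂ y (B x) = inner ℂ (b y) (b x) + inner ℂ (a y) (V (a x)) -
      (lam + Complex.I) * inner ℂ (a y) (a x) := by
    intro y x
    simp only [B, _root_.add_apply, ContinuousLinearMap.comp_apply, inner_add_right,
      ContinuousLinearMap.adjoint_inner_right, _root_.sub_apply, inner_sub_right,
      _root_.smul_apply, inner_smul_right, ContinuousLinearMap.id_apply]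
    ring
  have hBx : ∀ x, (2 + ‖V‖ + |lam|)⁻¹ * ‖x‖ ^ 2 ≤ ‖inner ℂ x (B x)‖ := by
    intro x
    have hVr : |(inner ℂ (a x) (V (a x))).re| ≤ ‖V‖ * ‖a x‖ ^ 2 := by
      refine (Complex.abs_re_le_norm _).trans ((norm_inner_le_norm _ _).trans ?_)
      have := V.le_opNorm (a x)
      nlinarith [norm_nonneg (a x)]
    have e1 : (inner ℂ x (B x)).re =
        ‖b x‖ ^ 2 + (inner ℂ (a x) (V (a x))).re - lam * ‖a x‖ ^ 2 := by
      rw [hBi, inner_self_eq_norm_sq_to_K, inner_self_eq_norm_sq_to_K]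
      simp [← Complex.ofReal_pow]
    have e2 : (inner ℂ x (B x)).im = -‖a x‖ ^ 2 := by
      rw [hBi, inner_self_eq_norm_sq_to_K, inner_self_eq_norm_sq_to_K]
      simp [← Complex.ofReal_pow, hV]
    have h1 : ‖a x‖ ^ 2 ≤ ‖inner ℂ x (B x)‖ := by
      have := Complex.abs_im_le_norm (inner ℂ x (B x))
      rwa [e2, abs_neg, abs_of_nonneg (by positivity)] at this
    have h2 : ‖b x‖ ^ 2 ≤ ‖inner ℂ x (B x)‖ + (‖V‖ + |lam|) * ‖a x‖ ^ 2 := by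
      have h3 := (le_abs_self _).trans (Complex.abs_re_le_norm (inner ℂ x (B x)))
      have h4 : lam * ‖a x‖ ^ 2 ≤ |lam| * ‖a x‖ ^ 2 := by gcongr; exact le_abs_self _
      have h5 := neg_le_of_abs_le hVr
      linarith
    rw [inv_mul_le_iff₀ (by positivity), hab]
    have h6 : (‖V‖ + |lam|) * ‖a x‖ ^ 2 ≤ (‖V‖ + |lam|) * ‖inner ℂ x (B x)‖ := by gcongr
    linarith
  obtain ⟨hk, hr⟩ := bijective_of_norm_inner_ge B (by positivity) hBx
  let e := ContinuousLinearEquiv.ofBijective B hk hr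
  refine ⟨(e.symm : H →L[ℂ] H) ∘L ContinuousLinearMap.adjoint a, fun f x => ?_⟩
  have h1 : ((e.symm : H →L[ℂ] H) ∘L ContinuousLinearMap.adjoint a) f = x ↔
      B x = ContinuousLinearMap.adjoint a f := by
    change e.symm (ContinuousLinearMap.adjoint a f) = x ↔ e x = ContinuousLinearMap.adjoint a f
    rw [ContinuousLinearEquiv.symm_apply_eq]
    exact eq_comm
  rw [h1]
  constructor
  · intro h y
    rw [← hBi, h, ContinuousLinearMap.adjoint_inner_right]
  · intro h
    refine ext_inner_left ℂ fun y => ?_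
    rw [hBi, h, ContinuousLinearMap.adjoint_inner_right]

theorem exists_formResolvent_submodule {Z Y : Type*} [NormedAddCommGroup Z] [InnerProductSpace ℂ Z]
    [CompleteSpace Z] [NormedAddCommGroup Y] [InnerProductSpace ℂ Y] [CompleteSpace Y]
    (a : Z →L[ℂ] X) (b : Z →L[ℂ] Y) (hab : ∀ x, ‖x‖ ^ 2 = ‖a x‖ ^ 2 + ‖b x‖ ^ 2)
    (S : Submodule ℂ Z) (hS : IsClosed (S : Set Z))
    (V : X →L[ℂ] X) (hV : ∀ x, (inner ℂ x (V x)).im = 0) (lam : ℝ) :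
    ∃ T : X →L[ℂ] Z, ∀ f x, T f = x ↔ x ∈ S ∧ ∀ y ∈ S, inner ℂ (b y) (b x) +
      inner ℂ (a y) (V (a x)) - (lam + Complex.I) * inner ℂ (a y) (a x) = inner ℂ (a y) f := by
  have : CompleteSpace S := hS.completeSpace_coe
  obtain ⟨T, hT⟩ := exists_formResolvent_aux (a ∘L S.subtypeL) (b ∘L S.subtypeL)
    (fun x => hab x.1) V hV lam
  refine ⟨S.subtypeL ∘L T, fun f x => ?_⟩
  constructor
  · rintro rfl
    exact ⟨(T f).2, fun y hy => (hT f (T f)).1 rfl ⟨y, hy⟩⟩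
  · rintro ⟨hx, h⟩
    have : T f = ⟨x, hx⟩ := (hT f _).2 fun y => h y.1 y.2
    change ((T f : S) : Z) = x
    rw [this]

/-- For a closed subspace `S` of `X × X^ι`, the form domain with its gradients, and a bounded
symmetric `V`, the operator of the form `∑ i, (kᵢ, gᵢ) + (φ, V ψ)` has a bounded resolvent at
`lam + i`. -/
theorem exists_formResolvent {ι : Type*} [Fintype ι] (S : Submodule ℂ (X × (ι → X)))
    (hS : IsClosed (S : Set (X × (ι → X)))) (V : X →L[ℂ] X)
    (hV : ∀ x, (inner ℂ x (V x)).im = 0) (lam : ℝ) :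
    ∃ R : X →L[ℂ] X, ∀ f ψ, R f = ψ ↔ ∃ g, (ψ, g) ∈ S ∧ ∀ φ k, (φ, k) ∈ S →
      ∑ i, inner ℂ (k i) (g i) + inner ℂ φ (V ψ) - (lam + Complex.I) * inner ℂ φ ψ =
        inner ℂ φ f := by
  -- The product X × (ι → X) carries the sup norm; `WithLp 2` gives the same topology a Hilbert
  -- structure.
  let a := WithLp.fstL 2 ℂ X (PiLp 2 fun _ : ι => X)
  let b := WithLp.sndL 2 ℂ X (PiLp 2 fun _ : ι => X)
  let L : WithLp 2 (X × PiLp 2 fun _ : ι => X) →L[ℂ] X × (ι → X) :=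
    a.prod ((PiLp.continuousLinearEquiv 2 ℂ (fun _ : ι => X)).toContinuousLinearMap ∘L b)
  obtain ⟨T, hT⟩ := exists_formResolvent_submodule a b WithLp.prod_norm_sq_eq_of_L2
    (S.comap L.toLinearMap) (hS.preimage L.continuous) V hV lam
  have hTf : ∀ f, _ := fun f => (hT f (T f)).1 rfl
  refine ⟨a ∘L T, fun f ψ => ?_⟩
  constructor
  · rintro rfl
    refine ⟨fun i => (b (T f)) i, (hTf f).1, fun φ k hk => ?_⟩
    have := (hTf f).2 (WithLp.toLp 2 (φ, WithLp.toLp 2 k)) hk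
    rw [PiLp.inner_apply] at this
    exact this
  · rintro ⟨g, hg, h⟩
    have : T f = WithLp.toLp 2 (ψ, WithLp.toLp 2 g) := by
      rw [hT]
      refine ⟨hg, fun y hy => ?_⟩
      rw [PiLp.inner_apply]
      exact h (a y) (fun i => b y i) hy
    change a (T f) = ψ
    rw [this]
    rfl

end Resolvent

/-! ### Multiplication operators -/

section Mul

variable {E : Type} [MeasureSpace E]

theorem memLp_mul_of_ae_bound {Ω : Set E} {b : E → ℂ} {C : ℝ}
    (hb : AEStronglyMeasurable b (volume.restrict Ω)) (hC : ∀ᵐ x ∂volume.restrict Ω, ‖b x‖ ≤ C)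
    (ψ : L2 Ω) : MemLp (fun x => b x * ψ x) 2 (volume.restrict Ω) := by
  refine (Lp.memLp ψ).of_le_mul (c := C) (hb.mul (Lp.aestronglyMeasurable ψ)) ?_
  filter_upwards [hC] with x hx
  rw [norm_mul]
  gcongr

open Classical in
/-- Multiplication by an essentially bounded function. -/
def mulL (Ω : Set E) (b : E → ℂ) : L2 Ω →L[ℂ] L2 Ω :=
  if h : AEStronglyMeasurable b (volume.restrict Ω) ∧
      ∃ C : ℝ, 0 ≤ C ∧ ∀ᵐ x ∂volume.restrict Ω, ‖b x‖ ≤ C then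
    LinearMap.mkContinuous
      { toFun := fun ψ => (memLp_mul_of_ae_bound h.1 h.2.choose_spec.2 ψ).toLp _
        map_add' := by
          intro ψ χ
          rw [← MemLp.toLp_add]
          refine MemLp.toLp_congr _ _ ?_
          filter_upwards [Lp.coeFn_add ψ χ] with x hx
          rw [hx]
          simp [mul_add]
        map_smul' := by
          intro c ψ
          rw [RingHom.id_apply, ← MemLp.toLp_const_smul]
          refine MemLp.toLp_congr _ _ ?_
          filter_upwards [Lp.coeFn_smul c ψ] with x hx
          rw [hx]
          simp [mul_left_comm] } h.2.choose (by
      intro ψ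
      refine Lp.norm_le_mul_norm_of_ae_le_mul ?_
      have h2 := (memLp_mul_of_ae_bound h.1 h.2.choose_spec.2 ψ).coeFn_toLp
      filter_upwards [h2, h.2.choose_spec.2] with x hx hx2
      simp only [LinearMap.coe_mk, AddHom.coe_mk]
      rw [hx, norm_mul]
      gcongr)
  else 0

/-- The function `b` is essentially bounded by `C` on `Ω`. -/
def EssBdd (Ω : Set E) (b : E → ℂ) (C : ℝ) : Prop :=
  AEStronglyMeasurable b (volume.restrict Ω) ∧ 0 ≤ C ∧ ∀ᵐ x ∂volume.restrict Ω, ‖b x‖ ≤ C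

variable {Ω : Set E} {b b' : E → ℂ} {C C' : ℝ}

theorem mulL_ae (hb : EssBdd Ω b C) (ψ : L2 Ω) :
    mulL Ω b ψ =ᵐ[volume.restrict Ω] fun x => b x * ψ x := by
  have h : AEStronglyMeasurable b (volume.restrict Ω) ∧
      ∃ C : ℝ, 0 ≤ C ∧ ∀ᵐ x ∂volume.restrict Ω, ‖b x‖ ≤ C := ⟨hb.1, C, hb.2.1, hb.2.2⟩
  rw [mulL, dif_pos h]
  exact (memLp_mul_of_ae_bound h.1 h.2.choose_spec.2 ψ).coeFn_toLp

theorem norm_mulL_le (hb : EssBdd Ω b C) (ψ : L2 Ω) : ‖mulL Ω b ψ‖ ≤ C * ‖ψ‖ := by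
  refine Lp.norm_le_mul_norm_of_ae_le_mul ?_
  filter_upwards [mulL_ae hb ψ, hb.2.2] with x h1 h2
  rw [h1, norm_mul]
  gcongr

theorem EssBdd.mul (hb : EssBdd Ω b C) (hb' : EssBdd Ω b' C') :
    EssBdd Ω (fun x => b x * b' x) (C * C') := by
  refine ⟨hb.1.mul hb'.1, mul_nonneg hb.2.1 hb'.2.1, ?_⟩
  filter_upwards [hb.2.2, hb'.2.2] with x h1 h2
  rw [norm_mul]
  exact mul_le_mul h1 h2 (norm_nonneg _) hb.2.1

theorem EssBdd.add (hb : EssBdd Ω b C) (hb' : EssBdd Ω b' C') :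
    EssBdd Ω (fun x => b x + b' x) (C + C') := by
  refine ⟨hb.1.add hb'.1, add_nonneg hb.2.1 hb'.2.1, ?_⟩
  filter_upwards [hb.2.2, hb'.2.2] with x h1 h2
  exact (norm_add_le _ _).trans (add_le_add h1 h2)

theorem EssBdd.sub (hb : EssBdd Ω b C) (hb' : EssBdd Ω b' C') :
    EssBdd Ω (fun x => b x - b' x) (C + C') := by
  refine ⟨hb.1.sub hb'.1, add_nonneg hb.2.1 hb'.2.1, ?_⟩
  filter_upwards [hb.2.2, hb'.2.2] with x h1 h2
  exact (norm_sub_le _ _).trans (add_le_add h1 h2)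

theorem EssBdd.const (c : ℂ) : EssBdd Ω (fun _ => c) ‖c‖ :=
  ⟨aestronglyMeasurable_const, norm_nonneg _, Eventually.of_forall fun _ => le_rfl⟩

theorem inner_mulL_real {b : E → ℝ} (hb : EssBdd Ω (fun x => (b x : ℂ)) C) (ψ χ : L2 Ω) :
    inner ℂ (mulL Ω (fun x => (b x : ℂ)) ψ) χ = inner ℂ ψ (mulL Ω (fun x => (b x : ℂ)) χ) := by
  rw [L2.inner_def, L2.inner_def]
  refine integral_congr_ae ?_
  filter_upwards [mulL_ae hb ψ, mulL_ae hb χ] with x h1 h2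
  rw [h1, h2]
  simp only [RCLike.inner_apply, map_mul, Complex.conj_ofReal]
  ring

theorem inner_mulL_self_im {b : E → ℝ} (hb : EssBdd Ω (fun x => (b x : ℂ)) C) (ψ : L2 Ω) :
    (inner ℂ ψ (mulL Ω (fun x => (b x : ℂ)) ψ)).im = 0 := by
  have h := inner_conj_symm (𝕜 := ℂ) ψ (mulL Ω (fun x => (b x : ℂ)) ψ)
  rw [inner_mulL_real hb] at h
  exact Complex.conj_eq_iff_im.1 h

end Mul

/-! ### Resolvents of the Dirichlet Laplacian and of Schrödinger operators -/

section DirichletResolvent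

variable {E : Type} [NormedAddCommGroup E] [NormedSpace ℝ E] [MeasureSpace E]
  [FiniteDimensional ℝ E] [BorelSpace E] [IsLocallyFiniteMeasure (volume : Measure E)]
  {ι : Type} [Fintype ι]

theorem mem_dirichletLaplacian_iff (e : ι → E) {Ω : Set E} (hΩ : IsOpen Ω) (ψ f : L2 Ω) :
    (∃ h : ψ ∈ (dirichletLaplacian e Ω).domain, dirichletLaplacian e Ω ⟨ψ, h⟩ = f) ↔
      ∃ g, (ψ, g) ∈ sobolevZero e Ω ∧ ∀ φ k, (φ, k) ∈ sobolevZero e Ω →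
        ∑ i, inner ℂ (k i) (g i) = inner ℂ φ f := by
  have h1 : (ψ, f) ∈ (dirichletLaplacian e Ω).graph ↔ (ψ, f) ∈ dirichletGraph e Ω := by
    rw [dirichletLaplacian_graph e hΩ]
  rw [LinearPMap.mem_graph_iff] at h1
  constructor
  · rintro ⟨h, rfl⟩
    exact h1.1 ⟨⟨ψ, h⟩, rfl, rfl⟩
  · intro h
    obtain ⟨⟨y, hy⟩, rfl, rfl⟩ := h1.2 h
    exact ⟨hy, rfl⟩

/-- The variational identity is recorded together with the resolvent because the estimates below
work with forms only. -/
theorem exists_dirichletResolvent (e : ι → E) {Ω : Set E} (hΩ : IsOpen Ω) (lam : ℝ) :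
    ∃ R : L2 Ω →L[ℂ] L2 Ω, IsResolvent (dirichletLaplacian e Ω) (lam + Complex.I) R ∧
      ∀ f, ∃ g, (R f, g) ∈ sobolevZero e Ω ∧ ∀ φ k, (φ, k) ∈ sobolevZero e Ω →
        ∑ i, inner ℂ (k i) (g i) - (lam + Complex.I) * inner ℂ φ (R f) = inner ℂ φ f := by
  obtain ⟨R, hR⟩ := exists_formResolvent (sobolevZero e Ω)
    (Submodule.isClosed_topologicalClosure _) 0 (by simp) lam
  simp only [_root_.zero_apply, inner_zero_right, add_zero] at hR
  refine ⟨R, fun f ψ => ?_, fun f => (hR f (R f)).1 rfl⟩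
  rw [hR]
  have h1 := mem_dirichletLaplacian_iff e hΩ ψ (f + (lam + Complex.I) • ψ)
  have h2 : (∃ h : ψ ∈ (dirichletLaplacian e Ω).domain,
      dirichletLaplacian e Ω ⟨ψ, h⟩ - (lam + Complex.I) • ψ = f) ↔
      ∃ h : ψ ∈ (dirichletLaplacian e Ω).domain,
        dirichletLaplacian e Ω ⟨ψ, h⟩ = f + (lam + Complex.I) • ψ := by
    simp only [sub_eq_iff_eq_add]
  rw [h2, h1]
  simp only [inner_add_right, inner_smul_right, sub_eq_iff_eq_add]

/-- For bounded `V` the maximal multiplication operator is defined everywhere, so the operator sum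
has the domain of the Laplacian and corresponds to a bounded perturbation of its form. -/
theorem exists_schroedingerResolvent (e : ι → E) {Ω : Set E} (hΩ : IsOpen Ω) {V : E → ℝ} {C : ℝ}
    (hV : EssBdd Ω (fun x => (V x : ℂ)) C) :
    ∃ R : L2 Ω →L[ℂ] L2 Ω,
      IsResolvent (dirichletLaplacian e Ω + mulOperator Ω V) Complex.I R ∧
      ∀ f, ∃ g, (R f, g) ∈ sobolevZero e Ω ∧ ∀ φ k, (φ, k) ∈ sobolevZero e Ω →
        ∑ i, inner ℂ (k i) (g i) + inner ℂ φ (mulL Ω (fun x => (V x : ℂ)) (R f)) -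
          Complex.I * inner ℂ φ (R f) = inner ℂ φ f := by
  obtain ⟨R, hR⟩ := exists_formResolvent (sobolevZero e Ω)
    (Submodule.isClosed_topologicalClosure _) (mulL Ω fun x => (V x : ℂ))
    (inner_mulL_self_im hV) 0
  simp only [Complex.ofReal_zero, zero_add] at hR
  refine ⟨R, fun f ψ => ?_, fun f => (hR f (R f)).1 rfl⟩
  rw [hR]
  have hdom : ∀ ψ : L2 Ω, ψ ∈ (mulOperator Ω V).domain := fun ψ =>
    memLp_mul_of_ae_bound hV.1 hV.2.2 ψ
  have hval : ∀ (ψ : L2 Ω) (h : ψ ∈ (mulOperator Ω V).domain),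
      mulOperator Ω V ⟨ψ, h⟩ = mulL Ω (fun x => (V x : ℂ)) ψ := by
    intro ψ h
    refine Lp.ext ?_
    exact (MemLp.coeFn_toLp (p := 2) (memLp_mul_of_ae_bound hV.1 hV.2.2 ψ)).trans
      (mulL_ae hV ψ).symm
  have h1 := mem_dirichletLaplacian_iff e hΩ ψ
    (f + Complex.I • ψ - mulL Ω (fun x => (V x : ℂ)) ψ)
  have h2 : (∃ h : ψ ∈ (dirichletLaplacian e Ω + mulOperator Ω V).domain,
      (dirichletLaplacian e Ω + mulOperator Ω V) ⟨ψ, h⟩ - Complex.I • ψ = f) ↔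
      ∃ h : ψ ∈ (dirichletLaplacian e Ω).domain,
        dirichletLaplacian e Ω ⟨ψ, h⟩ = f + Complex.I • ψ - mulL Ω (fun x => (V x : ℂ)) ψ := by
    constructor
    · rintro ⟨h, h'⟩
      refine ⟨h.1, ?_⟩
      rw [LinearPMap.add_apply, hval] at h'
      rw [← h']
      abel
    · rintro ⟨h, h'⟩
      refine ⟨⟨h, hdom ψ⟩, ?_⟩
      rw [LinearPMap.add_apply, hval]
      change dirichletLaplacian e Ω ⟨ψ, h⟩ + _ - _ = _
      rw [h']
      abel
  rw [h2, h1]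
  refine exists_congr fun g => and_congr_right fun _ => forall_congr' fun φ =>
    forall_congr' fun k => forall_congr' fun _ => ?_
  rw [inner_sub_right, inner_add_right, inner_smul_right]
  constructor <;> intro h <;> linear_combination h

end DirichletResolvent

/-! ### Algebra of multiplication operators -/

section MulAlgebra

variable {E : Type} [MeasureSpace E] {Ω : Set E} {b b' : E → ℂ} {C C' : ℝ}

theorem mulL_mulL (hb : EssBdd Ω b C) (hb' : EssBdd Ω b' C') (ψ : L2 Ω) :
    mulL Ω b (mulL Ω b' ψ) = mulL Ω (fun x => b x * b' x) ψ := by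
  refine Lp.ext ?_
  filter_upwards [mulL_ae hb (mulL Ω b' ψ), mulL_ae hb' ψ, mulL_ae (hb.mul hb') ψ] with x h1 h2 h3
  rw [h1, h2, h3, mul_assoc]

theorem mulL_add (hb : EssBdd Ω b C) (hb' : EssBdd Ω b' C') (ψ : L2 Ω) :
    mulL Ω (fun x => b x + b' x) ψ = mulL Ω b ψ + mulL Ω b' ψ := by
  refine Lp.ext ?_
  filter_upwards [mulL_ae hb ψ, mulL_ae hb' ψ, mulL_ae (hb.add hb') ψ,
    Lp.coeFn_add (mulL Ω b ψ) (mulL Ω b' ψ)] with x h1 h2 h3 h4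
  rw [h3, h4, Pi.add_apply, h1, h2, add_mul]

theorem mulL_sub (hb : EssBdd Ω b C) (hb' : EssBdd Ω b' C') (ψ : L2 Ω) :
    mulL Ω (fun x => b x - b' x) ψ = mulL Ω b ψ - mulL Ω b' ψ := by
  refine Lp.ext ?_
  filter_upwards [mulL_ae hb ψ, mulL_ae hb' ψ, mulL_ae (hb.sub hb') ψ,
    Lp.coeFn_sub (mulL Ω b ψ) (mulL Ω b' ψ)] with x h1 h2 h3 h4
  rw [h3, h4, Pi.sub_apply, h1, h2, sub_mul]

theorem mulL_const (c : ℂ) (ψ : L2 Ω) : mulL Ω (fun _ => c) ψ = c • ψ := by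
  refine Lp.ext ?_
  filter_upwards [mulL_ae (EssBdd.const c) ψ, Lp.coeFn_smul c ψ] with x h1 h2
  rw [h1, h2, Pi.smul_apply, smul_eq_mul]

theorem mulL_one (ψ : L2 Ω) : mulL Ω (fun _ => 1) ψ = ψ := by
  rw [mulL_const, one_smul]

theorem EssBdd.congr (hb : EssBdd Ω b C) (h : b =ᵐ[volume.restrict Ω] b') : EssBdd Ω b' C :=
  ⟨hb.1.congr h, hb.2.1, by filter_upwards [hb.2.2, h] with x h1 h2; rwa [← h2]⟩

theorem mulL_congr (hb : EssBdd Ω b C) (h : b =ᵐ[volume.restrict Ω] b') (ψ : L2 Ω) :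
    mulL Ω b ψ = mulL Ω b' ψ := by
  refine Lp.ext ?_
  filter_upwards [mulL_ae hb ψ, mulL_ae (hb.congr h) ψ, h] with x h1 h2 h3
  rw [h1, h2, h3]

end MulAlgebra

/-! ### Functions of the longitudinal variable -/

section Lift

variable {I : Set ℝ}

theorem ae_strip_of_ae_fst {P : ℝ → Prop} (h : ∀ᵐ s ∂volume.restrict I, P s) :
    ∀ᵐ p ∂volume.restrict (straightStrip I), P p.1 := by
  rw [restrict_straightStrip]
  exact Measure.quasiMeasurePreserving_fst.ae h

theorem volume_crossSection : volume crossSection = 2 := by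
  rw [crossSection, Real.volume_Ioo]
  norm_num

theorem eLpNorm_fst (φ : L2 I) :
    eLpNorm (fun p : ℝ × ℝ => (φ : ℝ → ℂ) p.1) 2 (volume.restrict (straightStrip I)) =
      2 ^ (1 / 2 : ℝ) * eLpNorm φ 2 (volume.restrict I) := by
  rw [eLpNorm_eq_lintegral_rpow_enorm_toReal (by norm_num) (by norm_num),
    eLpNorm_eq_lintegral_rpow_enorm_toReal (by norm_num) (by norm_num), restrict_straightStrip]
  have := lintegral_prod_mul (μ := volume.restrict I) (ν := volume.restrict crossSection)
    (f := fun s => ‖(φ : ℝ → ℂ) s‖ₑ ^ (2 : ℝ≥0∞).toReal) (g := fun _ => 1)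
    ((Lp.aestronglyMeasurable φ).enorm.pow_const _) aemeasurable_const
  simp only [mul_one] at this
  rw [this]
  simp only [lintegral_const, Measure.restrict_apply_univ, one_mul, volume_crossSection]
  rw [ENNReal.mul_rpow_of_nonneg _ _ (by norm_num), mul_comm]
  norm_num

theorem memLp_fst (φ : L2 I) :
    MemLp (fun p : ℝ × ℝ => (φ : ℝ → ℂ) p.1) 2 (volume.restrict (straightStrip I)) := by
  refine ⟨?_, ?_⟩
  · rw [restrict_straightStrip]
    exact (Lp.aestronglyMeasurable φ).comp_fst
  · rw [eLpNorm_fst]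
    exact ENNReal.mul_lt_top (ENNReal.rpow_lt_top_of_nonneg (by norm_num) (by norm_num))
      (Lp.eLpNorm_lt_top φ)

/-- The function `(s, t) ↦ φ(s)` on the strip. -/
def lift (I : Set ℝ) : L2 I →L[ℂ] L2 (straightStrip I) :=
  LinearMap.mkContinuous
    { toFun := fun φ => (memLp_fst φ).toLp _
      map_add' := by
        intro φ χ
        rw [← MemLp.toLp_add]
        refine MemLp.toLp_congr _ _ ?_
        filter_upwards [ae_strip_of_ae_fst (Lp.coeFn_add φ χ)] with p hp
        rw [hp]
        rfl
      map_smul' := by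
        intro c φ
        rw [RingHom.id_apply, ← MemLp.toLp_const_smul]
        refine MemLp.toLp_congr _ _ ?_
        filter_upwards [ae_strip_of_ae_fst (Lp.coeFn_smul c φ)] with p hp
        rw [hp]
        rfl } 2 (by
    intro φ
    change ‖(memLp_fst φ).toLp _‖ ≤ _
    rw [Lp.norm_toLp, eLpNorm_fst, ENNReal.toReal_mul, ← ENNReal.toReal_rpow]
    change (2 : ℝ) ^ (1 / 2 : ℝ) * ‖φ‖ ≤ _
    gcongr
    calc (2 : ℝ) ^ (1 / 2 : ℝ) ≤ 2 ^ (1 : ℝ) := by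
          apply Real.rpow_le_rpow_of_exponent_le <;> norm_num
      _ = 2 := by norm_num)

theorem lift_ae (φ : L2 I) :
    lift I φ =ᵐ[volume.restrict (straightStrip I)] fun p => (φ : ℝ → ℂ) p.1 :=
  (memLp_fst φ).coeFn_toLp

/-- The cross-section has length 2, so the exact factor is √2; the cruder 2 suffices. -/
theorem norm_lift_le (φ : L2 I) : ‖lift I φ‖ ≤ 2 * ‖φ‖ := by
  have h2 : ‖lift I‖ ≤ 2 := LinearMap.mkContinuous_norm_le _ (by norm_num) _
  exact ((lift I).le_opNorm φ).trans (by gcongr)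

theorem EssBdd.fst {b : ℝ → ℂ} {C : ℝ} (hb : EssBdd I b C) :
    EssBdd (straightStrip I) (fun p => b p.1) C := by
  refine ⟨?_, hb.2.1, ae_strip_of_ae_fst hb.2.2⟩
  rw [restrict_straightStrip]
  exact hb.1.comp_fst

theorem ae_strip_mem (hI : MeasurableSet I) :
    ∀ᵐ p ∂volume.restrict (straightStrip I), p ∈ straightStrip I :=
  ae_restrict_mem (hI.prod measurableSet_Ioo)

theorem ae_strip_snd : ∀ᵐ p ∂volume.restrict (straightStrip I), p.2 ∈ crossSection := by
  rw [restrict_straightStrip]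
  exact Measure.quasiMeasurePreserving_snd.ae (ae_restrict_mem measurableSet_Ioo)

theorem essBdd_snd {G : ℝ → ℝ} (hG : Measurable G) {C : ℝ} (hC : 0 ≤ C)
    (h : ∀ t ∈ crossSection, |G t| ≤ C) :
    EssBdd (straightStrip I) (fun p => (G p.2 : ℂ)) C := by
  refine ⟨?_, hC, ?_⟩
  · exact (Complex.measurable_ofReal.comp (hG.comp measurable_snd)).aestronglyMeasurable
  · filter_upwards [ae_strip_snd] with p hp
    simpa using h p.2 hp

theorem J₁_continuous : Continuous J₁ := by
  unfold J₁
  fun_prop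

theorem abs_J₁_le (t : ℝ) : |J₁ t| ≤ 1 := Real.abs_cos_le_one _

theorem essBdd_J₁ : EssBdd (straightStrip I) (fun p => (J₁ p.2 : ℂ)) 1 :=
  essBdd_snd J₁_continuous.measurable zero_le_one fun t _ => abs_J₁_le t

theorem tensorJ₁_eq (φ : L2 I) :
    tensorJ₁ I φ = mulL (straightStrip I) (fun p => (J₁ p.2 : ℂ)) (lift I φ) := by
  refine Lp.ext ?_
  have h0 : tensorJ₁ I φ =ᵐ[volume.restrict (straightStrip I)]
    fun p : ℝ × ℝ => (φ : ℝ → ℂ) p.1 * (J₁ p.2 : ℂ) := (memLp_tensor φ).coeFn_toLp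
  filter_upwards [h0, mulL_ae essBdd_J₁ (lift I φ), lift_ae φ] with p h1 h2 h3
  rw [h1, h2, h3, mul_comm]

/-- Fubini. This is how the transverse integrals of J₁ and J₁′ turn into coefficients of the
one-dimensional problem. -/
theorem inner_mulL_snd_lift {G H : ℝ → ℝ} (hG : Measurable G) (hH : Measurable H) {C D : ℝ}
    (hC : 0 ≤ C) (hD : 0 ≤ D) (hGC : ∀ t ∈ crossSection, |G t| ≤ C)
    (hHD : ∀ t ∈ crossSection, |H t| ≤ D) (p θ : L2 I) :
    inner ℂ (mulL (straightStrip I) (fun p => (G p.2 : ℂ)) (lift I p))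
      (mulL (straightStrip I) (fun p => (H p.2 : ℂ)) (lift I θ)) =
      ((∫ t in (-1 : ℝ)..1, G t * H t : ℝ) : ℂ) * inner ℂ p θ := by
  rw [L2.inner_def, L2.inner_def]
  have h1 : ∫ x, inner ℂ ((mulL (straightStrip I) (fun p => (G p.2 : ℂ)) (lift I p)) x)
      ((mulL (straightStrip I) (fun p => (H p.2 : ℂ)) (lift I θ)) x)
        ∂volume.restrict (straightStrip I) =
      ∫ x : ℝ × ℝ, inner ℂ ((p : ℝ → ℂ) x.1) ((θ : ℝ → ℂ) x.1) * ((G x.2 * H x.2 : ℝ) : ℂ)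
        ∂volume.restrict (straightStrip I) := by
    refine integral_congr_ae ?_
    filter_upwards [mulL_ae (essBdd_snd hG hC hGC) (lift I p), lift_ae p,
      mulL_ae (essBdd_snd hH hD hHD) (lift I θ), lift_ae θ] with x h1 h2 h3 h4
    rw [h1, h2, h3, h4]
    simp only [RCLike.inner_apply, map_mul, Complex.conj_ofReal]
    push_cast
    ring
  rw [h1, restrict_straightStrip, integral_prod_mul (fun s => inner ℂ ((p : ℝ → ℂ) s) ((θ : ℝ → ℂ) s))
    (fun t => ((G t * H t : ℝ) : ℂ)), mul_comm,
    intervalIntegral.integral_of_le (by norm_num), integral_Ioc_eq_integral_Ioo]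
  congr 1
  exact integral_ofReal

end Lift

/-! ### Density of test functions -/

section Induction

variable {E : Type} [NormedAddCommGroup E] [NormedSpace ℝ E] [MeasureSpace E]
variable {ι : Type}

/-- A closed condition on pairs (function, gradient) need only be checked on test functions. Most
identities and inequalities on W₀^{1,2} below are obtained in this way. -/
theorem sobolevZero_induction {e : ι → E} {Ω : Set E} {P : L2 Ω × (ι → L2 Ω) → Prop}
    (hP : IsClosed {p | P p})
    (h : ∀ φ ∈ testFunctions Ω, ∀ p : L2 Ω × (ι → L2 Ω), p.1 =ᵐ[volume.restrict Ω] φ →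
      (∀ i, p.2 i =ᵐ[volume.restrict Ω] fun x => fderiv ℝ φ x (e i)) → P p)
    {p : L2 Ω × (ι → L2 Ω)} (hp : p ∈ sobolevZero e Ω) : P p := by
  have : (testGraph e Ω : Set (L2 Ω × (ι → L2 Ω))) ⊆ {p | P p} := by
    rintro p ⟨φ, hφ, h1, h2⟩
    exact h φ hφ p h1 h2
  exact closure_minimal this hP hp

theorem InSobolevZero.mem {e : ι → E} {Ω : Set E} {f : E → ℂ} {g : ι → E → ℂ}
    (h : InSobolevZero e Ω f g) {ψ : L2 Ω} {k : ι → L2 Ω} (hψ : ψ =ᵐ[volume.restrict Ω] f)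
    (hk : ∀ i, k i =ᵐ[volume.restrict Ω] g i) : (ψ, k) ∈ sobolevZero e Ω := by
  obtain ⟨p, hp, h1, h2⟩ := h
  have e1 : p.1 = ψ := Lp.ext (h1.trans hψ.symm)
  have e2 : p.2 = k := funext fun i => Lp.ext ((h2 i).trans (hk i).symm)
  rw [← e1, ← e2]
  exact hp

end Induction

/-! ### The cross-section -/

section CrossSection

/-- The derivative of `J₁`. -/
def dJ₁ (t : ℝ) : ℝ := -(Real.pi / 2) * Real.sin (Real.pi * t / 2)

theorem hasDerivAt_J₁ (t : ℝ) : HasDerivAt J₁ (dJ₁ t) t := by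
  have h1 : HasDerivAt (fun t : ℝ => Real.pi * t / 2) (Real.pi / 2) t := by
    simpa using ((hasDerivAt_id t).const_mul Real.pi).div_const 2
  have h2 := h1.cos
  refine h2.congr_deriv ?_
  simp only [dJ₁]
  ring

theorem hasDerivAt_dJ₁ (t : ℝ) : HasDerivAt dJ₁ (-E₁ * J₁ t) t := by
  have h1 : HasDerivAt (fun t : ℝ => Real.pi * t / 2) (Real.pi / 2) t := by
    simpa using ((hasDerivAt_id t).const_mul Real.pi).div_const 2
  have h2 := h1.sin.const_mul (-(Real.pi / 2))
  refine h2.congr_deriv ?_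
  simp only [E₁, J₁]
  ring

theorem dJ₁_continuous : Continuous dJ₁ := by
  unfold dJ₁
  fun_prop

theorem J₁_one : J₁ 1 = 0 := by simp [J₁]

theorem J₁_neg_one : J₁ (-1) = 0 := by
  have : Real.pi * -1 / 2 = -(Real.pi / 2) := by ring
  rw [J₁, this, Real.cos_neg, Real.cos_pi_div_two]

theorem J₁_zero : J₁ 0 = 1 := by simp [J₁]

theorem E₁_gt : 9 / 4 < E₁ := by
  have := Real.pi_gt_three
  unfold E₁
  nlinarith

theorem E₁_lt : E₁ < 5 / 2 := by
  have := Real.pi_lt_d2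
  have h0 := Real.pi_pos
  unfold E₁
  nlinarith

theorem dJ₁_sq_le (t : ℝ) : dJ₁ t ^ 2 ≤ E₁ := by
  have h := Real.sin_sq_le_one (Real.pi * t / 2)
  simp only [dJ₁, E₁, mul_pow]
  nlinarith [sq_nonneg Real.pi]

theorem abs_dJ₁_le (t : ℝ) : |dJ₁ t| ≤ 2 := by
  have h := dJ₁_sq_le t
  have h2 := E₁_lt
  exact abs_le_of_sq_le_sq (by linarith) (by norm_num)

theorem integral_J₁_sq : ∫ t in (-1 : ℝ)..1, J₁ t ^ 2 = 1 := by
  have h3 : ∀ t, J₁ t ^ 2 = (fun x => Real.cos x ^ 2) (Real.pi / 2 * t) := by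
    intro t
    simp only [J₁]
    ring_nf
  simp_rw [h3]
  rw [intervalIntegral.integral_comp_mul_left (fun x => Real.cos x ^ 2) (by positivity),
    integral_cos_sq]
  simp [field]

/-- The integrand is the derivative of J₁²/2. This orthogonality is what makes the error term with
the factor ε⁻¹ harmless. -/
theorem integral_J₁_mul_dJ₁ : ∫ t in (-1 : ℝ)..1, J₁ t * dJ₁ t = 0 := by
  rw [intervalIntegral.integral_eq_sub_of_hasDerivAt (f := fun t => J₁ t ^ 2 / 2)]
  · simp [J₁_one, J₁_neg_one]
  · intro t _
    have := ((hasDerivAt_J₁ t).pow 2).div_const 2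
    refine this.congr_deriv ?_
    simp
    ring
  · exact (J₁_continuous.mul dJ₁_continuous).intervalIntegrable _ _

/-- Differentiate t J₁²/2 and use the normalisation of J₁. The value −1/2 feeds into the coefficient
−1/4 of κ². -/
theorem integral_mul_J₁_mul_dJ₁ : ∫ t in (-1 : ℝ)..1, J₁ t * (t * dJ₁ t) = -1 / 2 := by
  have h1 : ∫ t in (-1 : ℝ)..1, (J₁ t ^ 2 / 2 + J₁ t * (t * dJ₁ t)) = 0 := by
    rw [intervalIntegral.integral_eq_sub_of_hasDerivAt (f := fun t => t * (J₁ t ^ 2 / 2))]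
    · simp [J₁_one, J₁_neg_one]
    · intro t _
      have := (hasDerivAt_id t).mul (((hasDerivAt_J₁ t).pow 2).div_const 2)
      refine this.congr_deriv ?_
      simp
      ring
    · exact (((J₁_continuous.pow 2).div_const 2).add (J₁_continuous.mul
        (continuous_id.mul dJ₁_continuous))).intervalIntegrable _ _
  rw [intervalIntegral.integral_add, intervalIntegral.integral_div, integral_J₁_sq] at h1
  · linarith
  · exact ((J₁_continuous.pow 2).div_const 2).intervalIntegrable _ _
  · exact (J₁_continuous.mul (continuous_id.mul dJ₁_continuous)).intervalIntegrable _ _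

/-- A Dirichlet inequality on an interval of unit length, with a constant that is not sharp. -/
theorem integral_deriv_sq_ge {v dv : ℝ → ℝ} (hv : ∀ t, HasDerivAt v (dv t) t)
    (hdv : Continuous dv) {a : ℝ} (h0 : v a = 0) (h1 : v (a + 1) = 0) :
    9 / 4 * E₁ * ∫ t in a..(a + 1), v t ^ 2 ≤ ∫ t in a..(a + 1), dv t ^ 2 := by
  have hvc : Continuous v := continuous_iff_continuousAt.2 fun t => (hv t).continuousAt
  -- The sharp value π would put poles of the tangent at the endpoints. With 3π/4 the argument stays
  -- within ±3π/8, and β² = 9/4 E₁ still leaves a gap above E₁.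
  set β : ℝ := 3 * Real.pi / 4 with hβ
  let x : ℝ → ℝ := fun t => β * (t - (a + 1 / 2))
  have hx : ∀ t, HasDerivAt x β t := fun t => by
    exact (((hasDerivAt_id t).sub_const (a + 1 / 2)).const_mul β).congr_deriv (mul_one β)
  have hcos : ∀ t ∈ uIcc a (a + 1), Real.cos (x t) ≠ 0 := by
    intro t ht
    rw [uIcc_of_le (by linarith)] at ht
    refine (Real.cos_pos_of_mem_Ioo ⟨?_, ?_⟩).ne' <;>
    · simp only [x, hβ]
      nlinarith [Real.pi_pos, ht.1, ht.2]
  -- Completing the square: y = β tan x solves the Riccati equation y′ = β² + y², so v′² − β² v² is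
  -- a square minus the derivative of y v².
  have hW : ∀ t ∈ uIcc a (a + 1), HasDerivAt (fun t => β * Real.tan (x t) * v t ^ 2)
      ((dv t + β * Real.tan (x t) * v t) ^ 2 - (dv t ^ 2 - 9 / 4 * E₁ * v t ^ 2)) t := by
    intro t ht
    have h2 := ((((Real.hasDerivAt_tan (hcos t ht)).comp t (hx t)).const_mul β).mul
      ((hv t).pow 2))
    refine h2.congr_deriv ?_
    have h3 : 1 / Real.cos (x t) ^ 2 = 1 + Real.tan (x t) ^ 2 := by
      rw [Real.tan_eq_sin_div_cos]
      have := hcos t ht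
      field_simp
      linarith [Real.sin_sq_add_cos_sq (x t)]
    have h4 : 9 / 4 * E₁ = β ^ 2 := by rw [hβ, E₁]; ring
    rw [h3, h4]
    simp
    ring
  have hxc : Continuous x := by fun_prop
  have htc : ContinuousOn (fun t => Real.tan (x t)) (uIcc a (a + 1)) := fun t ht =>
    (((Real.continuousAt_tan.2 (hcos t ht)).comp hxc.continuousAt)).continuousWithinAt
  have c1 : IntervalIntegrable (fun t => (dv t + β * Real.tan (x t) * v t) ^ 2) volume a (a + 1) :=
    ContinuousOn.intervalIntegrable
      ((hdv.continuousOn.add ((continuousOn_const.mul htc).mul hvc.continuousOn)).pow 2)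
  have c2 : IntervalIntegrable (fun t => dv t ^ 2) volume a (a + 1) :=
    (hdv.pow 2).intervalIntegrable _ _
  have c3 : IntervalIntegrable (fun t => 9 / 4 * E₁ * v t ^ 2) volume a (a + 1) :=
    (continuous_const.mul (hvc.pow 2)).intervalIntegrable _ _
  have h5 := intervalIntegral.integral_eq_sub_of_hasDerivAt hW (c1.sub (c2.sub c3))
  rw [intervalIntegral.integral_sub c1 (c2.sub c3), intervalIntegral.integral_sub c2 c3,
    intervalIntegral.integral_const_mul, h0, h1] at h5
  have h6 : 0 ≤ ∫ t in a..(a + 1), (dv t + β * Real.tan (x t) * v t) ^ 2 :=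
    intervalIntegral.integral_nonneg (by linarith) fun t _ => sq_nonneg _
  simp at h5
  linarith

/-- The transverse form, with a linear weight, is bounded below. -/
theorem weighted_form_ge_real {u du : ℝ → ℝ} (hu : ∀ t, HasDerivAt u (du t) t)
    (hdu : Continuous du) (h0 : u (-1) = 0) (h1 : u 1 = 0) {ρ : ℝ} (hρ : |ρ| ≤ 1 / 10) :
    1 / 2 * (∫ t in (-1 : ℝ)..1, (u t - u 0 * J₁ t) ^ 2) -
      10 * ρ ^ 2 * (∫ t in (-1 : ℝ)..1, u t ^ 2) ≤
      ∫ t in (-1 : ℝ)..1, (1 - ρ * t) * (du t ^ 2 - E₁ * u t ^ 2) := by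
  have huc : Continuous u := continuous_iff_continuousAt.2 fun t => (hu t).continuousAt
  have hJc := J₁_continuous
  have hdJc := dJ₁_continuous
  set c := u 0 with hc
  -- Subtracting u(0) J₁ rather than the L² projection makes `v` vanish at −1, 0 and 1, so the
  -- Dirichlet inequality applies on both halves, whose lowest eigenvalue is 4 E₁.
  let v : ℝ → ℝ := fun t => u t - c * J₁ t
  let dv : ℝ → ℝ := fun t => du t - c * dJ₁ t
  have hv : ∀ t, HasDerivAt v (dv t) t := fun t => (hu t).sub ((hasDerivAt_J₁ t).const_mul c)
  have hvc : Continuous v := by fun_prop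
  have hdvc : Continuous dv := by fun_prop
  have hv0 : v 0 = 0 := by simp [v, J₁_zero, hc]
  have hv1 : v 1 = 0 := by simp [v, J₁_one, h1]
  have hvm : v (-1) = 0 := by simp [v, J₁_neg_one, h0]
  have h_int : ∀ {f : ℝ → ℝ} (a b : ℝ), Continuous f → IntervalIntegrable f volume a b :=
    fun a b hf => hf.intervalIntegrable a b
  have hwirt : 9 / 4 * E₁ * ∫ t in (-1 : ℝ)..1, v t ^ 2 ≤ ∫ t in (-1 : ℝ)..1, dv t ^ 2 := by
    have k1 := integral_deriv_sq_ge hv hdvc (a := -1) hvm (by norm_num [hv0])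
    have k2 := integral_deriv_sq_ge hv hdvc (a := 0) hv0 (by norm_num [hv1])
    norm_num at k1 k2
    rw [← intervalIntegral.integral_add_adjacent_intervals (b := 0)
      (f := fun t => v t ^ 2) (h_int _ _ (hvc.pow 2)) (h_int _ _ (hvc.pow 2)),
      ← intervalIntegral.integral_add_adjacent_intervals (b := 0)
      (f := fun t => dv t ^ 2) (h_int _ _ (hdvc.pow 2)) (h_int _ _ (hdvc.pow 2))]
    linarith
  -- The terms containing c form a total derivative plus 2cρ J₁′ v. In particular the weighted form
  -- of J₁ itself integrates to zero for every linear weight, so there is no loss of first order in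
  -- ρ.
  have hW : ∀ t, HasDerivAt (fun t => (1 - ρ * t) * (2 * c * (dJ₁ t * v t) + c ^ 2 * (J₁ t * dJ₁ t))
      + ρ * c ^ 2 * (J₁ t ^ 2 / 2))
      ((1 - ρ * t) * (du t ^ 2 - E₁ * u t ^ 2) - (1 - ρ * t) * (dv t ^ 2 - E₁ * v t ^ 2) -
        2 * c * ρ * (dJ₁ t * v t)) t := by
    intro t
    have k1 : HasDerivAt (fun t => 1 - ρ * t) (-ρ) t := by
      simpa using ((hasDerivAt_id t).const_mul ρ).const_sub 1
    have k2 := (k1.mul ((((hasDerivAt_dJ₁ t).mul (hv t)).const_mul (2 * c)).add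
      (((hasDerivAt_J₁ t).mul (hasDerivAt_dJ₁ t)).const_mul (c ^ 2)))).add
      ((((hasDerivAt_J₁ t).pow 2).div_const 2).const_mul (ρ * c ^ 2))
    refine k2.congr_deriv ?_
    simp [v, dv]
    ring
  have hW' := intervalIntegral.integral_eq_sub_of_hasDerivAt (a := -1) (b := 1)
    (fun t _ => hW t) (h_int _ _ (by fun_prop))
  simp only [J₁_one, J₁_neg_one, hv1, hvm] at hW'
  rw [intervalIntegral.integral_sub (h_int _ _ (by fun_prop)) (h_int _ _ (by fun_prop)),
    intervalIntegral.integral_sub (h_int _ _ (by fun_prop)) (h_int _ _ (by fun_prop))] at hW'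
  have b1 : ∫ t in (-1 : ℝ)..1, (9 / 10 * dv t ^ 2 - 11 / 10 * E₁ * v t ^ 2) ≤
      ∫ t in (-1 : ℝ)..1, (1 - ρ * t) * (dv t ^ 2 - E₁ * v t ^ 2) := by
    refine intervalIntegral.integral_mono_on (by norm_num) (h_int _ _ (by fun_prop))
      (h_int _ _ (by fun_prop)) fun t ht => ?_
    have k : |ρ * t| ≤ 1 / 10 := by
      rw [abs_mul]
      have := abs_le.2 ht
      nlinarith [abs_nonneg ρ, abs_nonneg t]
    have k1 := abs_le.1 k
    have hE := E₁_gt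
    have k2 : 0 ≤ E₁ * v t ^ 2 := by positivity
    nlinarith [sq_nonneg (dv t)]
  have b2 : -∫ t in (-1 : ℝ)..1, (v t ^ 2 + c ^ 2 * ρ ^ 2 * E₁) ≤
      ∫ t in (-1 : ℝ)..1, 2 * c * ρ * (dJ₁ t * v t) := by
    rw [← intervalIntegral.integral_neg]
    refine intervalIntegral.integral_mono_on (by norm_num) (h_int _ _ (by fun_prop))
      (h_int _ _ (by fun_prop)) fun t ht => ?_
    have k := dJ₁_sq_le t
    have k2 : (c * ρ) ^ 2 * dJ₁ t ^ 2 ≤ (c * ρ) ^ 2 * E₁ := by gcongr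
    nlinarith [sq_nonneg (v t + c * ρ * dJ₁ t)]
  -- As J₁ is normalised, c² = ∫ (u − v)²; this bounds the centre value by L² norms.
  have b3 : ∫ t in (-1 : ℝ)..1, c ^ 2 * J₁ t ^ 2 ≤
      ∫ t in (-1 : ℝ)..1, (2 * u t ^ 2 + 2 * v t ^ 2) := by
    refine intervalIntegral.integral_mono_on (by norm_num) (h_int _ _ (by fun_prop))
      (h_int _ _ (by fun_prop)) fun t ht => ?_
    simp only [v]
    nlinarith [sq_nonneg (u t + (u t - c * J₁ t))]
  rw [intervalIntegral.integral_sub (h_int _ _ (by fun_prop)) (h_int _ _ (by fun_prop)),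
    intervalIntegral.integral_const_mul, intervalIntegral.integral_const_mul] at b1
  rw [intervalIntegral.integral_add (h_int _ _ (by fun_prop)) (h_int _ _ (by fun_prop)),
    intervalIntegral.integral_const] at b2
  rw [intervalIntegral.integral_const_mul, integral_J₁_sq,
    intervalIntegral.integral_add (h_int _ _ (by fun_prop)) (h_int _ _ (by fun_prop)),
    intervalIntegral.integral_const_mul, intervalIntegral.integral_const_mul] at b3
  have hv2 : 0 ≤ ∫ t in (-1 : ℝ)..1, v t ^ 2 :=
    intervalIntegral.integral_nonneg (by norm_num) fun t _ => sq_nonneg _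
  have hu2 : 0 ≤ ∫ t in (-1 : ℝ)..1, u t ^ 2 :=
    intervalIntegral.integral_nonneg (by norm_num) fun t _ => sq_nonneg _
  have hE := E₁_gt
  have hE' := E₁_lt
  have hρ2 : ρ ^ 2 ≤ 1 / 100 := by
    have := sq_le_sq' (by linarith [abs_nonneg ρ]) hρ
    rw [sq_abs] at this
    linarith
  change 1 / 2 * (∫ t in (-1 : ℝ)..1, v t ^ 2) - _ ≤ _
  set A := ∫ t in (-1 : ℝ)..1, v t ^ 2
  set B := ∫ t in (-1 : ℝ)..1, u t ^ 2
  rw [smul_eq_mul] at b2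
  -- Doubled by the length of the interval, this bound is 10 ρ² (A + B): the B-part is the error in
  -- the statement, and the A-part is absorbed since ρ² ≤ 1/100.
  have f1 : c ^ 2 * ρ ^ 2 * E₁ ≤ (2 * B + 2 * A) * ρ ^ 2 * (5 / 2) := by
    have : 0 ≤ ρ ^ 2 := sq_nonneg ρ
    gcongr
    linarith
  have f2 : A * ρ ^ 2 ≤ A * (1 / 100) := by gcongr
  have f3 : 9 / 4 * A ≤ E₁ * A := by gcongr
  nlinarith

theorem weighted_form_ge {u du : ℝ → ℂ} (hu : ∀ t, HasDerivAt u (du t) t)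
    (hdu : Continuous du) (h0 : u (-1) = 0) (h1 : u 1 = 0) {ρ : ℝ} (hρ : |ρ| ≤ 1 / 10) :
    1 / 2 * (∫ t in (-1 : ℝ)..1, ‖u t - u 0 * J₁ t‖ ^ 2) -
      10 * ρ ^ 2 * (∫ t in (-1 : ℝ)..1, ‖u t‖ ^ 2) ≤
      ∫ t in (-1 : ℝ)..1, (1 - ρ * t) * (‖du t‖ ^ 2 - E₁ * ‖u t‖ ^ 2) := by
  have huc : Continuous u := continuous_iff_continuousAt.2 fun t => (hu t).continuousAt
  have hJc := J₁_continuous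
  have h_int : ∀ {f : ℝ → ℝ} (a b : ℝ), Continuous f → IntervalIntegrable f volume a b :=
    fun a b hf => hf.intervalIntegrable a b
  have hre : ∀ t, HasDerivAt (fun t => (u t).re) (du t).re t := fun t =>
    Complex.reCLM.hasFDerivAt.comp_hasDerivAt t (hu t)
  have him : ∀ t, HasDerivAt (fun t => (u t).im) (du t).im t := fun t =>
    Complex.imCLM.hasFDerivAt.comp_hasDerivAt t (hu t)
  have k1 := weighted_form_ge_real hre (by fun_prop) (by simp [h0]) (by simp [h1]) hρ
  have k2 := weighted_form_ge_real him (by fun_prop) (by simp [h0]) (by simp [h1]) hρ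
  have n : ∀ z : ℂ, ‖z‖ ^ 2 = z.re ^ 2 + z.im ^ 2 := fun z => by
    rw [Complex.sq_norm, Complex.normSq_apply]; ring
  have e1 : ∀ t, ‖u t - u 0 * J₁ t‖ ^ 2 =
      ((u t).re - (u 0).re * J₁ t) ^ 2 + ((u t).im - (u 0).im * J₁ t) ^ 2 := fun t => by
    rw [n]; simp
  have e3 : ∀ t, (1 - ρ * t) * (‖du t‖ ^ 2 - E₁ * ‖u t‖ ^ 2) =
      (1 - ρ * t) * ((du t).re ^ 2 - E₁ * (u t).re ^ 2) +
      (1 - ρ * t) * ((du t).im ^ 2 - E₁ * (u t).im ^ 2) := fun t => by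
    rw [n, n]; ring
  simp only [e1, e3]
  simp only [n]
  rw [intervalIntegral.integral_add (h_int _ _ (by fun_prop)) (h_int _ _ (by fun_prop)),
    intervalIntegral.integral_add (h_int _ _ (by fun_prop)) (h_int _ _ (by fun_prop)),
    intervalIntegral.integral_add (h_int _ _ (by fun_prop)) (h_int _ _ (by fun_prop))]
  linarith

end CrossSection

/-! ### The ground state of the cross-section -/

section GroundState

theorem norm_sq_eq_integral {E : Type} [MeasureSpace E] {Ω : Set E} {ψ : L2 Ω} {f : E → ℂ}
    (h : ψ =ᵐ[volume.restrict Ω] f) : ‖ψ‖ ^ 2 = ∫ x in Ω, ‖f x‖ ^ 2 := by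
  have h1 : inner ℂ ψ ψ = ((‖ψ‖ ^ 2 : ℝ) : ℂ) := by
    rw [inner_self_eq_norm_sq_to_K]
    simp
  rw [L2.inner_def] at h1
  have h2 : ∫ x in Ω, inner ℂ (ψ x) (ψ x) = ∫ x in Ω, ((‖f x‖ ^ 2 : ℝ) : ℂ) := by
    refine integral_congr_ae ?_
    filter_upwards [h] with x hx
    rw [hx, inner_self_eq_norm_sq_to_K]
    simp
  rw [h2] at h1
  have h3 : ∫ x in Ω, ((‖f x‖ ^ 2 : ℝ) : ℂ) = ((∫ x in Ω, ‖f x‖ ^ 2 : ℝ) : ℂ) := integral_ofReal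
  rw [h3] at h1
  exact_mod_cast h1.symm

theorem integral_crossSection {F : Type*} [NormedAddCommGroup F] [NormedSpace ℝ F] (f : ℝ → F) :
    ∫ t in crossSection, f t = ∫ t in (-1 : ℝ)..1, f t := by
  rw [intervalIntegral.integral_of_le (by norm_num), integral_Ioc_eq_integral_Ioo, crossSection]

theorem crossSection_isOpen : IsOpen crossSection := isOpen_Ioo

/-- The restriction of `G` to `[-1, 1]`, extended by its boundary values. -/
def clampExt (G : ℝ → ℝ) (t : ℝ) : ℝ := G (max (-1) (min 1 t))

theorem clampExt_of_mem {G : ℝ → ℝ} {t : ℝ} (ht : t ∈ crossSection) : clampExt G t = G t := by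
  rw [clampExt, min_eq_right ht.2.le, max_eq_right ht.1.le]

theorem clampExt_of_notMem {G : ℝ → ℝ} (h0 : G (-1) = 0) (h1 : G 1 = 0) {t : ℝ}
    (ht : t ∉ crossSection) : clampExt G t = 0 := by
  rw [clampExt]
  by_cases h : t ≤ -1
  · rw [min_eq_right (by linarith), max_eq_left h, h0]
  · have : 1 ≤ t := by
      by_contra! h2
      exact ht ⟨by linarith, h2⟩
    rw [min_eq_left this, max_eq_right (by norm_num), h1]

theorem clampExt_hasDerivAt {G dG : ℝ → ℝ} (hG : ∀ t, HasDerivAt G (dG t) t) {t : ℝ}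
    (ht : t ∈ crossSection) : HasDerivAt (clampExt G) (dG t) t := by
  refine (hG t).congr_of_eventuallyEq ?_
  filter_upwards [crossSection_isOpen.mem_nhds ht] with s hs
  exact clampExt_of_mem hs

theorem clampExt_lipschitz {G dG : ℝ → ℝ} (hG : ∀ t, HasDerivAt G (dG t) t)
    (hdG : Continuous dG) : ∃ C, LipschitzWith C (clampExt G) := by
  obtain ⟨C, hC⟩ := (isCompact_Icc (a := (-1 : ℝ)) (b := 1)).exists_bound_of_continuousOn
    hdG.continuousOn
  have h1 : LipschitzOnWith (Real.toNNReal C) G (Icc (-1) 1) := by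
    refine (convex_Icc (-1 : ℝ) 1).lipschitzOnWith_of_nnnorm_hasDerivWithin_le (f' := dG)
      (fun t _ => (hG t).hasDerivWithinAt) fun t ht => ?_
    rw [← NNReal.coe_le_coe, coe_nnnorm]
    exact (hC t ht).trans (Real.le_coe_toNNReal C)
  have h2 : LipschitzWith 1 fun t : ℝ => max (-1 : ℝ) (min 1 t) :=
    (LipschitzWith.id.const_min 1).const_max (-1)
  refine ⟨Real.toNNReal C * 1, lipschitzOnWith_univ.1 ?_⟩
  refine h1.comp (h2.lipschitzOnWith (s := univ)) fun t _ => ⟨le_max_left _ _, ?_⟩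
  exact max_le (by norm_num) (min_le_left _ _)

theorem hasCompactSupport_clampExt {G : ℝ → ℝ} (h0 : G (-1) = 0) (h1 : G 1 = 0) :
    HasCompactSupport (clampExt G) := by
  refine HasCompactSupport.intro (isCompact_Icc (a := (-1 : ℝ)) (b := 1)) fun t ht => ?_
  exact clampExt_of_notMem h0 h1 fun h => ht (Ioo_subset_Icc_self h)

theorem fderiv_axisLine (φ : ℝ → ℂ) (t : ℝ) (i : Fin 1) :
    fderiv ℝ φ t (axisLine i) = deriv φ t := by
  rw [axisLine, fderiv_apply_one_eq_deriv]

theorem testFunctions_hasDerivAt {Ω : Set ℝ} {φ : ℝ → ℂ} (hφ : φ ∈ testFunctions Ω) (t : ℝ) :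
    HasDerivAt φ (deriv φ t) t :=
  (hφ.1.differentiable (by simp) t).hasDerivAt

theorem testFunctions_deriv_continuous {Ω : Set ℝ} {φ : ℝ → ℂ} (hφ : φ ∈ testFunctions Ω) :
    Continuous (deriv φ) :=
  hφ.1.continuous_deriv (by simp)

theorem testFunctions_eq_zero {E : Type} [NormedAddCommGroup E] [NormedSpace ℝ E] {Ω : Set E}
    {φ : E → ℂ} (hφ : φ ∈ testFunctions Ω) {x : E} (hx : x ∉ Ω) : φ x = 0 :=
  image_eq_zero_of_notMem_tsupport fun h => hx (hφ.2.2 h)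

/-- The case ρ = 0 of `weighted_form_ge`, with the non-negative gap term dropped. -/
theorem sobolevZero_crossSection_ge {p : L2 crossSection × (Fin 1 → L2 crossSection)}
    (hp : p ∈ sobolevZero axisLine crossSection) : E₁ * ‖p.1‖ ^ 2 ≤ ‖p.2 0‖ ^ 2 := by
  refine sobolevZero_induction (P := fun p => E₁ * ‖p.1‖ ^ 2 ≤ ‖p.2 0‖ ^ 2) ?_ ?_ hp
  · exact isClosed_le (by fun_prop) (by fun_prop)
  · intro φ hφ p h1 h2
    have hc : Continuous φ := hφ.1.continuous
    have hdc := testFunctions_deriv_continuous hφ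
    have h3 := weighted_form_ge (testFunctions_hasDerivAt hφ) hdc
      (testFunctions_eq_zero hφ (by simp [crossSection]))
      (testFunctions_eq_zero hφ (by simp [crossSection])) (ρ := 0) (by norm_num)
    simp only [zero_mul, sub_zero, one_mul, ne_eq, OfNat.ofNat_ne_zero, not_false_eq_true, zero_pow,
      mul_zero] at h3
    have c1 : Continuous fun t => ‖deriv φ t‖ ^ 2 := by fun_prop
    have c2 : Continuous fun t => E₁ * ‖φ t‖ ^ 2 := by fun_prop
    rw [intervalIntegral.integral_sub (c1.intervalIntegrable _ _) (c2.intervalIntegrable _ _),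
      intervalIntegral.integral_const_mul] at h3
    have h4 : 0 ≤ ∫ t in (-1 : ℝ)..1, ‖φ t - φ 0 * J₁ t‖ ^ 2 :=
      intervalIntegral.integral_nonneg (by norm_num) fun t _ => by positivity
    rw [norm_sq_eq_integral h1, norm_sq_eq_integral (h2 0), integral_crossSection,
      integral_crossSection]
    simp only [fderiv_axisLine]
    linarith

/-- J₁ extended by zero is Lipschitz, hence in W₀^{1,2}, and integration by parts gives the
eigenvalue equation. Minimality is `sobolevZero_crossSection_ge` applied to an eigenfunction tested
against itself. -/
theorem isGroundState_J₁ : IsGroundState E₁ J₁ := by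
  have hpos : ∀ t ∈ crossSection, 0 < J₁ t := by
    intro t ht
    refine Real.cos_pos_of_mem_Ioo ⟨?_, ?_⟩
    · nlinarith [Real.pi_pos, ht.1]
    · nlinarith [Real.pi_pos, ht.2]
  obtain ⟨C, hC⟩ := clampExt_lipschitz hasDerivAt_J₁ dJ₁_continuous
  have hlip : LipschitzWith (1 * C) fun t => (clampExt J₁ t : ℂ) :=
    (Complex.isometry_ofReal.lipschitz).comp hC
  have hcs : HasCompactSupport fun t => (clampExt J₁ t : ℂ) :=
    (hasCompactSupport_clampExt J₁_neg_one J₁_one).comp_left Complex.ofReal_zero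
  obtain ⟨⟨u, g⟩, hmem, hu, hg⟩ := InSobolevZero.of_lipschitz (e := axisLine) crossSection_isOpen
    hlip hcs fun t ht => by simp [clampExt_of_notMem J₁_neg_one J₁_one ht]
  have hmemc := ae_restrict_mem (μ := volume) (s := crossSection) crossSection_isOpen.measurableSet
  have hu' : u =ᵐ[volume.restrict crossSection] fun t => (J₁ t : ℂ) := by
    filter_upwards [hu, hmemc] with t h1 h2
    rw [h1, clampExt_of_mem h2]
  have hg' : g 0 =ᵐ[volume.restrict crossSection] fun t => (dJ₁ t : ℂ) := by
    filter_upwards [hg 0, hmemc] with t h1 h2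
    rw [h1, fderiv_axisLine]
    exact (clampExt_hasDerivAt hasDerivAt_J₁ h2).ofReal_comp.deriv
  have hnorm : ‖u‖ = 1 := by
    have : ‖u‖ ^ 2 = 1 := by
      rw [norm_sq_eq_integral hu', integral_crossSection]
      simpa using integral_J₁_sq
    nlinarith [norm_nonneg u]
  have hweak : ∀ φ k, (φ, k) ∈ sobolevZero axisLine crossSection →
      ∑ i, inner ℂ (k i) (g i) = inner ℂ φ ((E₁ : ℂ) • u) := by
    intro φ k hk
    refine sobolevZero_induction
      (P := fun p => ∑ i, inner ℂ (p.2 i) (g i) = inner ℂ p.1 ((E₁ : ℂ) • u)) ?_ ?_ hk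
    · exact isClosed_eq (by fun_prop) (by fun_prop)
    · intro φ hφ p h1 h2
      simp only [Finset.univ_unique, Fin.default_eq_zero, Fin.isValue, Finset.sum_singleton,
        inner_smul_right]
      have hc : Continuous φ := hφ.1.continuous
      have hdc := testFunctions_deriv_continuous hφ
      have i1 : inner ℂ (p.2 0) (g 0) =
          ∫ t in (-1 : ℝ)..1, starRingEnd ℂ (deriv φ t) * dJ₁ t := by
        rw [L2.inner_def, ← integral_crossSection]
        refine integral_congr_ae ?_
        filter_upwards [h2 0, hg'] with t h3 h4
        rw [h3, h4, fderiv_axisLine, RCLike.inner_apply, mul_comm]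
      have i2 : inner ℂ p.1 u = ∫ t in (-1 : ℝ)..1, starRingEnd ℂ (φ t) * J₁ t := by
        rw [L2.inner_def, ← integral_crossSection]
        refine integral_congr_ae ?_
        filter_upwards [h1, hu'] with t h3 h4
        rw [h3, h4, RCLike.inner_apply, mul_comm]
      have hder : ∀ t ∈ uIcc (-1 : ℝ) 1, HasDerivAt (fun t => starRingEnd ℂ (φ t) * (dJ₁ t : ℂ))
          (starRingEnd ℂ (deriv φ t) * dJ₁ t - E₁ * (starRingEnd ℂ (φ t) * J₁ t)) t := by
        intro t _
        have k1 : HasDerivAt (fun t => starRingEnd ℂ (φ t)) (starRingEnd ℂ (deriv φ t)) t :=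
          Complex.conjCLE.hasFDerivAt.comp_hasDerivAt t (testFunctions_hasDerivAt hφ t)
        refine (k1.mul (hasDerivAt_dJ₁ t).ofReal_comp).congr_deriv ?_
        push_cast
        ring
      have hJc := J₁_continuous
      have hdJc := dJ₁_continuous
      have c1 : Continuous fun t => starRingEnd ℂ (deriv φ t) * (dJ₁ t : ℂ) :=
        (Complex.continuous_conj.comp hdc).mul (Complex.continuous_ofReal.comp hdJc)
      have c2 : Continuous fun t => (E₁ : ℂ) * (starRingEnd ℂ (φ t) * (J₁ t : ℂ)) :=
        continuous_const.mul ((Complex.continuous_conj.comp hc).mul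
          (Complex.continuous_ofReal.comp hJc))
      have h5 := intervalIntegral.integral_eq_sub_of_hasDerivAt hder
        ((c1.sub c2).intervalIntegrable _ _)
      rw [intervalIntegral.integral_sub (c1.intervalIntegrable _ _) (c2.intervalIntegrable _ _),
        intervalIntegral.integral_const_mul,
        testFunctions_eq_zero hφ (x := 1) (by simp [crossSection]),
        testFunctions_eq_zero hφ (x := -1) (by simp [crossSection])] at h5
      rw [i1, i2]
      simp only [map_zero, zero_mul, sub_zero] at h5
      linear_combination h5
  obtain ⟨hdom, heq⟩ := (mem_dirichletLaplacian_iff axisLine crossSection_isOpen u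
    ((E₁ : ℂ) • u)).2 ⟨g, hmem, hweak⟩
  have hu0 : (⟨u, hdom⟩ : (dirichletLaplacian axisLine crossSection).domain) ≠ 0 := by
    intro h
    have : u = 0 := congrArg Subtype.val h
    rw [this, norm_zero] at hnorm
    norm_num at hnorm
  refine ⟨⟨⟨⟨u, hdom⟩, hu0, heq⟩, ?_⟩, hpos, ⟨u, hdom⟩, hu', hnorm, heq⟩
  rintro lam ⟨⟨w, hw⟩, hw0, hweq⟩
  obtain ⟨k, hk, hkw⟩ := (mem_dirichletLaplacian_iff axisLine crossSection_isOpen w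
    ((lam : ℂ) • w)).1 ⟨hw, hweq⟩
  have h1 := hkw w k hk
  have h2 := sobolevZero_crossSection_ge hk
  simp only [Finset.univ_unique, Fin.default_eq_zero, Fin.isValue, Finset.sum_singleton,
    inner_smul_right, inner_self_eq_norm_sq_to_K] at h1
  have h3 : ‖k 0‖ ^ 2 = lam * ‖w‖ ^ 2 := by
    apply Complex.ofReal_injective
    simpa using h1
  have h4 : 0 < ‖w‖ ^ 2 := by
    have : w ≠ 0 := fun h => hw0 (Subtype.ext h)
    positivity
  simp only [h3] at h2
  exact le_of_mul_le_mul_right h2 h4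

end GroundState

/-! ### Sobolev functions on the straight strip -/

section Strip

variable {I : Set ℝ}

theorem straightStrip_isOpen (hI : IsOpen I) : IsOpen (straightStrip I) :=
  hI.prod isOpen_Ioo

theorem integral_strip_eq {f : ℝ × ℝ → ℂ} (hf : IntegrableOn f (straightStrip I)) :
    ∫ p in straightStrip I, f p = ∫ s in I, ∫ t in (-1 : ℝ)..1, f (s, t) := by
  rw [IntegrableOn, restrict_straightStrip] at hf
  rw [restrict_straightStrip, integral_prod f hf]
  simp only [integral_crossSection]

theorem hasDerivAt_fst_of_differentiableAt {f : ℝ × ℝ → ℂ} {x : ℝ × ℝ}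
    (h : DifferentiableAt ℝ f x) :
    HasDerivAt (fun s => f (s, x.2)) (fderiv ℝ f x (1, 0)) x.1 := by
  have h1 : HasFDerivAt f (fderiv ℝ f x) (x.1, x.2) := h.hasFDerivAt
  exact h1.comp_hasDerivAt x.1 ((hasDerivAt_id x.1).prodMk (hasDerivAt_const x.1 x.2))

theorem hasDerivAt_snd_of_differentiableAt {f : ℝ × ℝ → ℂ} {x : ℝ × ℝ}
    (h : DifferentiableAt ℝ f x) :
    HasDerivAt (fun t => f (x.1, t)) (fderiv ℝ f x (0, 1)) x.2 := by
  have h1 : HasFDerivAt f (fderiv ℝ f x) (x.1, x.2) := h.hasFDerivAt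
  exact h1.comp_hasDerivAt x.2 ((hasDerivAt_const x.2 x.1).prodMk (hasDerivAt_id x.2))

theorem testFunctions_hasDerivAt_fst {Ω : Set (ℝ × ℝ)} {φ : ℝ × ℝ → ℂ} (hφ : φ ∈ testFunctions Ω)
    (s t : ℝ) : HasDerivAt (fun s => φ (s, t)) (fderiv ℝ φ (s, t) (1, 0)) s :=
  hasDerivAt_fst_of_differentiableAt (hφ.1.differentiable (by simp) (s, t))

theorem testFunctions_hasDerivAt_snd {Ω : Set (ℝ × ℝ)} {φ : ℝ × ℝ → ℂ} (hφ : φ ∈ testFunctions Ω)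
    (s t : ℝ) : HasDerivAt (fun t => φ (s, t)) (fderiv ℝ φ (s, t) (0, 1)) t :=
  hasDerivAt_snd_of_differentiableAt (hφ.1.differentiable (by simp) (s, t))

theorem testFunctions_fderiv_continuous {Ω : Set (ℝ × ℝ)} {φ : ℝ × ℝ → ℂ}
    (hφ : φ ∈ testFunctions Ω) (v : ℝ × ℝ) : Continuous fun p => fderiv ℝ φ p v :=
  (hφ.1.continuous_fderiv (by simp)).clm_apply continuous_const

theorem hasCompactSupport_transverse_integral {F : ℝ × ℝ → ℂ} (hc : HasCompactSupport F) :
    tsupport (fun s => ∫ t in (-1 : ℝ)..1, (J₁ t : ℂ) * F (s, t)) ⊆ Prod.fst '' tsupport F ∧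
    HasCompactSupport fun s => ∫ t in (-1 : ℝ)..1, (J₁ t : ℂ) * F (s, t) := by
  have hK : IsCompact (Prod.fst '' tsupport F) := hc.isCompact.image continuous_fst
  have h : Function.support (fun s => ∫ t in (-1 : ℝ)..1, (J₁ t : ℂ) * F (s, t)) ⊆
      Prod.fst '' tsupport F := by
    intro s hs
    by_contra hcon
    refine hs ?_
    have : ∀ t, F (s, t) = 0 := fun t => image_eq_zero_of_notMem_tsupport fun h =>
      hcon ⟨(s, t), h, rfl⟩
    simp [this]
  have h2 := closure_minimal h hK.isClosed
  exact ⟨h2, hK.of_isClosed_subset (isClosed_tsupport _) h2⟩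

theorem continuous_transverse_integral {F : ℝ × ℝ → ℂ} (hF : Continuous F) :
    Continuous fun s => ∫ t in (-1 : ℝ)..1, (J₁ t : ℂ) * F (s, t) := by
  have hJ := J₁_continuous
  refine intervalIntegral.continuous_parametric_intervalIntegral_of_continuous' ?_ _ _
  exact (Complex.continuous_ofReal.comp (hJ.comp continuous_snd)).mul hF

/-- By Fubini the adjoint of φ ↦ φ ⊗ J₁ is the transverse average against J₁; continuity and compact
support make it a concrete L² function. -/
theorem adjoint_tensorJ₁_ae {F : ℝ × ℝ → ℂ} (hF : Continuous F) (hc : HasCompactSupport F)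
    {χ : L2 (straightStrip I)} (hχ : χ =ᵐ[volume.restrict (straightStrip I)] F) :
    ContinuousLinearMap.adjoint (tensorJ₁ I).toContinuousLinearMap χ =ᵐ[volume.restrict I]
      fun s => ∫ t in (-1 : ℝ)..1, (J₁ t : ℂ) * F (s, t) := by
  set p : ℝ → ℂ := fun s => ∫ t in (-1 : ℝ)..1, (J₁ t : ℂ) * F (s, t) with hp
  have hpL : MemLp p 2 (volume.restrict I) :=
    ((continuous_transverse_integral hF).memLp_of_hasCompactSupport
      (hasCompactSupport_transverse_integral hc).2).restrict I
  suffices h : ContinuousLinearMap.adjoint (tensorJ₁ I).toContinuousLinearMap χ = hpL.toLp p by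
    rw [h]
    exact hpL.coeFn_toLp
  refine ext_inner_left ℂ fun φ => ?_
  rw [ContinuousLinearMap.adjoint_inner_right]
  change inner ℂ (tensorJ₁ I φ) χ = _
  have h0 : tensorJ₁ I φ =ᵐ[volume.restrict (straightStrip I)]
    fun p : ℝ × ℝ => (φ : ℝ → ℂ) p.1 * (J₁ p.2 : ℂ) := (memLp_tensor φ).coeFn_toLp
  have hcongr : (fun x => inner ℂ ((tensorJ₁ I φ) x) (χ x))
      =ᵐ[volume.restrict (straightStrip I)]
      fun x : ℝ × ℝ => starRingEnd ℂ ((φ : ℝ → ℂ) x.1) * ((J₁ x.2 : ℂ) * F x) := by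
    filter_upwards [h0, hχ] with x h1 h2
    rw [h1, h2]
    simp only [RCLike.inner_apply, map_mul, Complex.conj_ofReal]
    ring
  rw [L2.inner_def, L2.inner_def, integral_congr_ae hcongr, integral_strip_eq
    ((L2.integrable_inner (𝕜 := ℂ) (tensorJ₁ I φ) χ).congr hcongr)]
  refine integral_congr_ae ?_
  filter_upwards [hpL.coeFn_toLp] with s hs
  rw [hs, RCLike.inner_apply, intervalIntegral.integral_const_mul, mul_comm]

/-- The transverse average of a function in `W₀^{1,2}(Ω₀)` belongs to `W₀^{1,2}(I)`. -/
theorem adjoint_tensorJ₁_mem_sobolevZero (hI : IsOpen I)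
    {p : L2 (straightStrip I) × (Fin 2 → L2 (straightStrip I))}
    (hp : p ∈ sobolevZero axisPlane (straightStrip I)) :
    (ContinuousLinearMap.adjoint (tensorJ₁ I).toContinuousLinearMap p.1,
      fun _ : Fin 1 => ContinuousLinearMap.adjoint (tensorJ₁ I).toContinuousLinearMap (p.2 0)) ∈
      sobolevZero axisLine I := by
  set A := ContinuousLinearMap.adjoint (tensorJ₁ I).toContinuousLinearMap
  refine sobolevZero_induction (P := fun p => (A p.1, fun _ : Fin 1 => A (p.2 0)) ∈
    sobolevZero axisLine I) ?_ ?_ hp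
  · refine (Submodule.isClosed_topologicalClosure (testGraph axisLine I)).preimage
      (f := fun p : L2 (straightStrip I) × (Fin 2 → L2 (straightStrip I)) =>
        (A p.1, fun _ : Fin 1 => A (p.2 0))) ?_
    fun_prop
  · intro φ hφ p h1 h2
    let q : ℝ → ℂ := fun s => ∫ t in (-1 : ℝ)..1, (J₁ t : ℂ) * φ (s, t)
    let dq : ℝ → ℂ := fun s => ∫ t in (-1 : ℝ)..1, (J₁ t : ℂ) * fderiv ℝ φ (s, t) (1, 0)
    have hdc := testFunctions_fderiv_continuous hφ (1, 0)
    have hcs : HasCompactSupport fun p => fderiv ℝ φ p (1, 0) := hφ.2.1.fderiv_apply (𝕜 := ℝ) (1, 0)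
    have hJ : Continuous fun t => (J₁ t : ℂ) := Complex.continuous_ofReal.comp J₁_continuous
    obtain ⟨M, hM⟩ := hdc.bounded_above_of_compact_support hcs
    -- Averaging in t commutes with ∂ₛ. This is what allows averages of functions on the strip as
    -- test functions for the effective equation.
    have hder : ∀ s, HasDerivAt q (dq s) s := by
      intro s
      refine (intervalIntegral.hasDerivAt_integral_of_dominated_loc_of_deriv_le
        (F := fun s t => (J₁ t : ℂ) * φ (s, t))
        (F' := fun s t => (J₁ t : ℂ) * fderiv ℝ φ (s, t) (1, 0))
        (bound := fun _ => 1 * M) (s := univ) univ_mem ?_ ?_ ?_ ?_ ?_ ?_).2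
      · refine Eventually.of_forall fun s => ?_
        exact (hJ.mul (hφ.1.continuous.comp (by fun_prop))).aestronglyMeasurable
      · exact (hJ.mul (hφ.1.continuous.comp (by fun_prop))).intervalIntegrable _ _
      · exact (hJ.mul (hdc.comp (by fun_prop))).aestronglyMeasurable
      · refine Eventually.of_forall fun t _ s _ => ?_
        rw [norm_mul]
        refine mul_le_mul ?_ (hM _) (norm_nonneg _) zero_le_one
        simpa using abs_J₁_le t
      · exact intervalIntegrable_const
      · refine Eventually.of_forall fun t _ s _ => ?_
        exact (testFunctions_hasDerivAt_fst hφ s t).const_mul _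
    obtain ⟨M', hM'⟩ := (continuous_transverse_integral hdc).bounded_above_of_compact_support
      (hasCompactSupport_transverse_integral hcs).2
    have hlip : LipschitzWith (Real.toNNReal M') q := by
      refine lipschitzWith_of_nnnorm_deriv_le (fun s => (hder s).differentiableAt) fun s => ?_
      rw [(hder s).deriv, ← NNReal.coe_le_coe, coe_nnnorm]
      exact (hM' s).trans (Real.le_coe_toNNReal _)
    have hsub : tsupport q ⊆ I := by
      refine (hasCompactSupport_transverse_integral hφ.2.1).1.trans ?_
      rintro _ ⟨x, hx, rfl⟩
      exact (hφ.2.2 hx).1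
    refine (InSobolevZero.of_lipschitz_tsupport (e := axisLine) hI hlip
      (hasCompactSupport_transverse_integral hφ.2.1).2 hsub).mem ?_ ?_
    · exact adjoint_tensorJ₁_ae hφ.1.continuous hφ.2.1 h1
    · intro i
      filter_upwards [adjoint_tensorJ₁_ae hdc hcs (h2 0)] with s hs
      rw [hs, fderiv_axisLine, (hder s).deriv]

/-- Integration by parts in the transverse variable. -/
theorem inner_transverse_deriv {F dF : ℝ × ℝ → ℝ} {C D : ℝ}
    (hF : EssBdd (straightStrip I) (fun p => (F p : ℂ)) C)
    (hdF : EssBdd (straightStrip I) (fun p => (dF p : ℂ)) D)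
    (hder : ∀ s t, HasDerivAt (fun t => F (s, t)) (dF (s, t)) t)
    (hcont : ∀ s, Continuous fun t => dF (s, t)) (θ : L2 I)
    {p : L2 (straightStrip I) × (Fin 2 → L2 (straightStrip I))}
    (hp : p ∈ sobolevZero axisPlane (straightStrip I)) :
    inner ℂ (p.2 1) (mulL (straightStrip I) (fun p => (F p : ℂ)) (lift I θ)) =
      -inner ℂ p.1 (mulL (straightStrip I) (fun p => (dF p : ℂ)) (lift I θ)) := by
  refine sobolevZero_induction (P := fun p =>
    inner ℂ (p.2 1) (mulL (straightStrip I) (fun p => (F p : ℂ)) (lift I θ)) =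
      -inner ℂ p.1 (mulL (straightStrip I) (fun p => (dF p : ℂ)) (lift I θ))) ?_ ?_ hp
  · exact isClosed_eq (by fun_prop) (by fun_prop)
  · intro φ hφ p h1 h2
    have hdc := testFunctions_fderiv_continuous hφ (0, 1)
    rw [eq_neg_iff_add_eq_zero, L2.inner_def, L2.inner_def,
      ← integral_add (L2.integrable_inner _ _) (L2.integrable_inner _ _)]
    have hcongr : (fun x => inner ℂ ((p.2 1) x)
          ((mulL (straightStrip I) (fun p => (F p : ℂ)) (lift I θ)) x) +
        inner ℂ (p.1 x) ((mulL (straightStrip I) (fun p => (dF p : ℂ)) (lift I θ)) x))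
        =ᵐ[volume.restrict (straightStrip I)] fun x : ℝ × ℝ => (θ : ℝ → ℂ) x.1 *
          (starRingEnd ℂ (fderiv ℝ φ x (0, 1)) * F x + starRingEnd ℂ (φ x) * dF x) := by
      filter_upwards [h1, h2 1, mulL_ae hF (lift I θ), mulL_ae hdF (lift I θ), lift_ae θ]
        with x k1 k2 k3 k4 k5
      rw [k1, k2, k3, k4, k5]
      simp only [RCLike.inner_apply, axisPlane, Matrix.cons_val_one, Matrix.cons_val_fin_one]
      ring
    rw [integral_congr_ae hcongr, integral_strip_eq (((L2.integrable_inner _ _).add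
      (L2.integrable_inner _ _)).congr hcongr)]
    -- On each fibre the integrand is θ(s) times the t-derivative of φ̄ F, and φ vanishes at t = ±1.
    -- Neither boundary values of `F` nor its regularity in s matter.
    refine integral_eq_zero_of_ae (Eventually.of_forall fun s => ?_)
    simp only [Pi.zero_apply]
    rw [intervalIntegral.integral_const_mul]
    refine mul_eq_zero_of_right _ ?_
    have hFc : Continuous fun t => F (s, t) :=
      continuous_iff_continuousAt.2 fun t => (hder s t).continuousAt
    have hdF' : Continuous fun t => dF (s, t) := hcont s
    have hφc : Continuous fun t => φ (s, t) := hφ.1.continuous.comp (by fun_prop)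
    have hφd : Continuous fun t => fderiv ℝ φ (s, t) (0, 1) := hdc.comp (by fun_prop)
    have hd : ∀ t ∈ uIcc (-1 : ℝ) 1, HasDerivAt (fun t => starRingEnd ℂ (φ (s, t)) * (F (s, t) : ℂ))
        (starRingEnd ℂ (fderiv ℝ φ (s, t) (0, 1)) * F (s, t) +
          starRingEnd ℂ (φ (s, t)) * dF (s, t)) t := by
      intro t _
      have k1 : HasDerivAt (fun t => starRingEnd ℂ (φ (s, t)))
          (starRingEnd ℂ (fderiv ℝ φ (s, t) (0, 1))) t :=
        Complex.conjCLE.hasFDerivAt.comp_hasDerivAt t (testFunctions_hasDerivAt_snd hφ s t)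
      exact k1.mul (hder s t).ofReal_comp
    rw [intervalIntegral.integral_eq_sub_of_hasDerivAt hd]
    · rw [testFunctions_eq_zero hφ (x := (s, 1)) (by simp [straightStrip, crossSection]),
        testFunctions_eq_zero hφ (x := (s, -1)) (by simp [straightStrip, crossSection])]
      simp
    · refine Continuous.intervalIntegrable ?_ _ _
      exact ((Complex.continuous_conj.comp hφd).mul (Complex.continuous_ofReal.comp hFc)).add
        ((Complex.continuous_conj.comp hφc).mul (Complex.continuous_ofReal.comp hdF'))

theorem lipschitz_mul_of_bounded {α : Type*} [PseudoMetricSpace α] {f g : α → ℂ} {C D : NNReal}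
    {M N : ℝ} (hf : LipschitzWith C f) (hg : LipschitzWith D g) (hM : ∀ x, ‖f x‖ ≤ M)
    (hN : ∀ x, ‖g x‖ ≤ N) : ∃ K, LipschitzWith K fun x => f x * g x := by
  refine ⟨Real.toNNReal (M * D + C * N), LipschitzWith.of_dist_le_mul fun x y => ?_⟩
  have hM0 : 0 ≤ M := (norm_nonneg _).trans (hM x)
  have hN0 : 0 ≤ N := (norm_nonneg _).trans (hN x)
  rw [Real.coe_toNNReal _ (by positivity), dist_eq_norm]
  have e : f x * g x - f y * g y = f x * (g x - g y) + (f x - f y) * g y := by ring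
  have h1 : ‖g x - g y‖ ≤ D * dist x y := by simpa [dist_eq_norm] using hg.dist_le_mul x y
  have h2 : ‖f x - f y‖ ≤ C * dist x y := by simpa [dist_eq_norm] using hf.dist_le_mul x y
  calc ‖f x * g x - f y * g y‖ ≤ ‖f x‖ * ‖g x - g y‖ + ‖f x - f y‖ * ‖g y‖ := by
        rw [e]
        exact (norm_add_le _ _).trans (by rw [norm_mul, norm_mul])
    _ ≤ M * (D * dist x y) + (C * dist x y) * N := by
        gcongr
        · exact hM x
        · exact hN y
    _ = (M * D + C * N) * dist x y := by ring

/-- Products `θ(s) c(s) G(t)` with `θ ∈ W₀^{1,2}(I)` belong to `W₀^{1,2}(Ω₀)`. -/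
theorem tensor_mem_sobolevZero (hI : IsOpen I) {c dc : ℝ → ℝ} {Lc : NNReal} {M D : ℝ}
    (hc : LipschitzWith Lc c) (hcM : ∀ s, |c s| ≤ M)
    (hdc : EssBdd I (fun s => (dc s : ℂ)) D)
    (hcd : ∀ᵐ s ∂volume.restrict I, HasDerivAt c (dc s) s)
    {G dG : ℝ → ℝ} (hG : ∀ t, HasDerivAt G (dG t) t) (hdG : Continuous dG)
    (h0 : G (-1) = 0) (h1 : G 1 = 0) {B : ℝ} (hGB : ∀ t ∈ crossSection, |G t| ≤ B)
    (hdGB : ∀ t ∈ crossSection, |dG t| ≤ B)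
    {p : L2 I × (Fin 1 → L2 I)} (hp : p ∈ sobolevZero axisLine I) :
    (mulL (straightStrip I) (fun x => ((c x.1 * G x.2 : ℝ) : ℂ)) (lift I p.1),
      ![mulL (straightStrip I) (fun x => ((c x.1 * G x.2 : ℝ) : ℂ)) (lift I (p.2 0)) +
          mulL (straightStrip I) (fun x => ((dc x.1 * G x.2 : ℝ) : ℂ)) (lift I p.1),
        mulL (straightStrip I) (fun x => ((c x.1 * dG x.2 : ℝ) : ℂ)) (lift I p.1)]) ∈
      sobolevZero axisPlane (straightStrip I) := by
  have hB0 : 0 ≤ B := (abs_nonneg _).trans (hGB 0 (by simp [crossSection]))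
  have hGc : Continuous G := continuous_iff_continuousAt.2 fun t => (hG t).continuousAt
  have hM0 : 0 ≤ M := (abs_nonneg _).trans (hcM 0)
  have bc : EssBdd I (fun s => (c s : ℂ)) M :=
    ⟨(Complex.continuous_ofReal.comp hc.continuous).aestronglyMeasurable, hM0,
      Eventually.of_forall fun s => by simpa using hcM s⟩
  have bG : EssBdd (straightStrip I) (fun x => (G x.2 : ℂ)) B :=
    essBdd_snd hGc.measurable hB0 hGB
  have bdG : EssBdd (straightStrip I) (fun x => (dG x.2 : ℂ)) B :=
    essBdd_snd hdG.measurable hB0 hdGB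
  have b1 : EssBdd (straightStrip I) (fun x => ((c x.1 * G x.2 : ℝ) : ℂ)) (M * B) := by
    simpa using bc.fst.mul bG
  have b2 : EssBdd (straightStrip I) (fun x => ((dc x.1 * G x.2 : ℝ) : ℂ)) (D * B) := by
    simpa using hdc.fst.mul bG
  have b3 : EssBdd (straightStrip I) (fun x => ((c x.1 * dG x.2 : ℝ) : ℂ)) (M * B) := by
    simpa using bc.fst.mul bdG
  set A1 := mulL (straightStrip I) (fun x => ((c x.1 * G x.2 : ℝ) : ℂ))
  set A2 := mulL (straightStrip I) (fun x => ((dc x.1 * G x.2 : ℝ) : ℂ))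
  set A3 := mulL (straightStrip I) (fun x => ((c x.1 * dG x.2 : ℝ) : ℂ))
  refine sobolevZero_induction (P := fun p => (A1 (lift I p.1),
    ![A1 (lift I (p.2 0)) + A2 (lift I p.1), A3 (lift I p.1)]) ∈
      sobolevZero axisPlane (straightStrip I)) ?_ ?_ hp
  · refine (Submodule.isClosed_topologicalClosure (testGraph axisPlane (straightStrip I))).preimage
      (f := fun p : L2 I × (Fin 1 → L2 I) => (A1 (lift I p.1),
    ![A1 (lift I (p.2 0)) + A2 (lift I p.1), A3 (lift I p.1)])) ?_
    refine Continuous.prodMk (by fun_prop) (continuous_pi fun i => ?_)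
    fin_cases i
    · change Continuous fun p : L2 I × (Fin 1 → L2 I) => A1 (lift I (p.2 0)) + A2 (lift I p.1)
      fun_prop
    · change Continuous fun p : L2 I × (Fin 1 → L2 I) => A3 (lift I p.1)
      fun_prop
  · intro φ hφ p k1 k2
    obtain ⟨LG, hLG⟩ := clampExt_lipschitz hG hdG
    have hGbd : ∀ t, |clampExt G t| ≤ B := by
      intro t
      by_cases ht : t ∈ crossSection
      · rw [clampExt_of_mem ht]; exact hGB t ht
      · rw [clampExt_of_notMem h0 h1 ht, abs_zero]; exact hB0
    obtain ⟨Lφ, hLφ⟩ := hφ.1.lipschitzWith_of_hasCompactSupport hφ.2.1 (by simp)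
    obtain ⟨N, hN⟩ := hφ.1.continuous.bounded_above_of_compact_support hφ.2.1
    have hcC : LipschitzWith (1 * Lc) fun s => (c s : ℂ) :=
      Complex.isometry_ofReal.lipschitz.comp hc
    have hGC : LipschitzWith (1 * LG) fun s => (clampExt G s : ℂ) :=
      Complex.isometry_ofReal.lipschitz.comp hLG
    obtain ⟨L1, hL1⟩ := lipschitz_mul_of_bounded hLφ hcC hN
      (fun s => by simpa using hcM s)
    obtain ⟨Lf, hLf⟩ := lipschitz_mul_of_bounded
      (hL1.comp (LipschitzWith.prod_fst (α := ℝ) (β := ℝ)))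
      (hGC.comp (LipschitzWith.prod_snd (α := ℝ) (β := ℝ))) (M := N * M) (N := B) (fun x => by
        have := hN x.1
        have := hcM x.1
        simp only [Function.comp, norm_mul, Complex.norm_real, Real.norm_eq_abs]
        gcongr
        exact (norm_nonneg _).trans (hN x.1)) (fun x => by simpa using hGbd x.2)
    -- The support may reach t = ±1, so only vanishing off the strip is available; clamping `G`
    -- makes the product globally Lipschitz and agrees with it inside.
    let f : ℝ × ℝ → ℂ := fun x => φ x.1 * c x.1 * clampExt G x.2
    have hf : LipschitzWith Lf f := hLf
    have hfc : HasCompactSupport f := by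
      refine HasCompactSupport.intro
        (hφ.2.1.isCompact.prod (hasCompactSupport_clampExt h0 h1).isCompact) fun x hx => ?_
      rw [mem_prod, not_and_or] at hx
      rcases hx with hx | hx
      · simp [f, image_eq_zero_of_notMem_tsupport hx]
      · simp [f, image_eq_zero_of_notMem_tsupport hx]
    have hf0 : ∀ x, x ∉ straightStrip I → f x = 0 := by
      intro x hx
      rw [straightStrip, mem_prod, not_and_or] at hx
      rcases hx with hx | hx
      · simp [f, testFunctions_eq_zero hφ hx]
      · simp [f, clampExt_of_notMem h0 h1 hx]
    have hfd : ∀ᵐ x ∂volume.restrict (straightStrip I), DifferentiableAt ℝ f x :=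
      ae_restrict_of_ae hf.ae_differentiableAt
    refine (InSobolevZero.of_lipschitz (e := axisPlane) (straightStrip_isOpen hI) hf hfc hf0).mem
      ?_ ?_
    · filter_upwards [mulL_ae b1 (lift I p.1), lift_ae p.1, ae_strip_of_ae_fst k1,
        ae_strip_snd] with x m1 m2 m3 m4
      simp only [A1]
      rw [m1, m2, m3]
      simp only [f, clampExt_of_mem m4]
      push_cast
      ring
    · intro i
      fin_cases i
      · change (A1 (lift I (p.2 0)) + A2 (lift I p.1) : L2 (straightStrip I)) =ᵐ[_] _
        filter_upwards [mulL_ae b1 (lift I (p.2 0)), mulL_ae b2 (lift I p.1), lift_ae p.1,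
          lift_ae (p.2 0), ae_strip_of_ae_fst k1, ae_strip_of_ae_fst (k2 0),
          ae_strip_snd, Lp.coeFn_add (A1 (lift I (p.2 0))) (A2 (lift I p.1)), hfd,
          ae_strip_of_ae_fst hcd] with x m1 m2 m3 m4 m5 m6 m7 m8 m9 m10
        rw [m8, Pi.add_apply, m1, m2, m3, m4, m5, m6, fderiv_axisLine]
        have d1 : HasDerivAt (fun s => f (s, x.2)) (fderiv ℝ f x (1, 0)) x.1 :=
          hasDerivAt_fst_of_differentiableAt m9
        have d2 : HasDerivAt (fun s => f (s, x.2))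
            ((deriv φ x.1 * c x.1 + φ x.1 * dc x.1) * clampExt G x.2) x.1 :=
          ((testFunctions_hasDerivAt hφ x.1).mul m10.ofReal_comp).mul_const (clampExt G x.2 : ℂ)
        change _ = fderiv ℝ f x (1, 0)
        rw [d1.unique d2, clampExt_of_mem m7]
        push_cast
        ring
      · change (A3 (lift I p.1) : L2 (straightStrip I)) =ᵐ[_] _
        filter_upwards [mulL_ae b3 (lift I p.1), lift_ae p.1, ae_strip_of_ae_fst k1,
          ae_strip_snd, hfd] with x m1 m2 m3 m4 m5
        rw [m1, m2, m3]
        have d1 : HasDerivAt (fun t => f (x.1, t)) (fderiv ℝ f x (0, 1)) x.2 :=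
          hasDerivAt_snd_of_differentiableAt m5
        have d2 : HasDerivAt (fun t => f (x.1, t)) (φ x.1 * c x.1 * dG x.2) x.2 :=
          ((clampExt_hasDerivAt hG m4).ofReal_comp).const_mul (φ x.1 * c x.1)
        change _ = fderiv ℝ f x (0, 1)
        rw [d1.unique d2]
        push_cast
        ring

/-- Pythagoras: φ ↦ φ ⊗ J₁ composed with its adjoint is the orthogonal projection onto its range, so
it gives the nearest tensor. -/
theorem norm_sub_tensor_adjoint_le (χ : L2 (straightStrip I)) (c : L2 I) :
    ‖χ - tensorJ₁ I (ContinuousLinearMap.adjoint (tensorJ₁ I).toContinuousLinearMap χ)‖ ≤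
      ‖χ - tensorJ₁ I c‖ := by
  set A := ContinuousLinearMap.adjoint (tensorJ₁ I).toContinuousLinearMap
  have h1 : χ - tensorJ₁ I c = (χ - tensorJ₁ I (A χ)) + tensorJ₁ I (A χ - c) := by
    rw [map_sub]
    abel
  have h2 : inner ℂ (χ - tensorJ₁ I (A χ)) (tensorJ₁ I (A χ - c)) = 0 := by
    have h3 : ∀ y z, inner ℂ y (tensorJ₁ I z) = inner ℂ (A y) z := fun y z =>
      (ContinuousLinearMap.adjoint_inner_left (tensorJ₁ I).toContinuousLinearMap z y).symm
    rw [inner_sub_left, LinearIsometry.inner_map_map, h3, sub_self]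
  have h4 := norm_add_sq_eq_norm_sq_add_norm_sq_of_inner_eq_zero _ _ h2
  rw [← h1] at h4
  refine abs_le_of_sq_le_sq' ?_ (norm_nonneg _) |>.2
  nlinarith [norm_nonneg (tensorJ₁ I (A χ - c))]

theorem re_inner_mulL_eq {b : ℝ × ℝ → ℝ} {C : ℝ} {f : ℝ × ℝ → ℂ}
    (hb : EssBdd (straightStrip I) (fun p => (b p : ℂ)) C) {ψ : L2 (straightStrip I)}
    (hψ : ψ =ᵐ[volume.restrict (straightStrip I)] f) :
    (fun x => inner ℂ (ψ x) ((mulL (straightStrip I) (fun p => (b p : ℂ)) ψ) x))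
      =ᵐ[volume.restrict (straightStrip I)] fun x => ((b x * ‖f x‖ ^ 2 : ℝ) : ℂ) := by
  filter_upwards [hψ, mulL_ae hb ψ] with x h1 h2
  rw [h2, h1, RCLike.inner_apply, mul_assoc, Complex.mul_conj, Complex.normSq_eq_norm_sq]
  push_cast
  ring

theorem essBdd_jacobian {κ : ℝ → ℝ} {K : ℝ} (hκ : EssBdd I (fun s => (κ s : ℂ)) K) {ε : ℝ}
    (hε : 0 ≤ ε) :
    EssBdd (straightStrip I) (fun p => ((1 - ε * κ p.1 * p.2 : ℝ) : ℂ)) (1 + ε * K) := by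
  have h1 : EssBdd (straightStrip I) (fun p => ((p.2 : ℝ) : ℂ)) 1 :=
    essBdd_snd measurable_id zero_le_one fun t ht => abs_le.2 ⟨ht.1.le, ht.2.le⟩
  have h2 := (EssBdd.const (Ω := straightStrip I) 1).sub
    (((EssBdd.const (ε : ℂ)).mul hκ.fst).mul h1)
  simpa [abs_of_nonneg hε] using h2

/-- The weighted transverse form controls the part of a function orthogonal to the ground state. -/
theorem transverse_form_ge {κ : ℝ → ℝ} {K : ℝ} (hκ : EssBdd I (fun s => (κ s : ℂ)) K) {ε : ℝ}
    (hε : 0 ≤ ε) (hεK : ε * K ≤ 1 / 10)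
    {p : L2 (straightStrip I) × (Fin 2 → L2 (straightStrip I))}
    (hp : p ∈ sobolevZero axisPlane (straightStrip I)) :
    1 / 2 * ‖p.1 - tensorJ₁ I (ContinuousLinearMap.adjoint
        (tensorJ₁ I).toContinuousLinearMap p.1)‖ ^ 2 - 10 * (ε * K) ^ 2 * ‖p.1‖ ^ 2 ≤
      (inner ℂ (p.2 1) (mulL (straightStrip I)
        (fun p => ((1 - ε * κ p.1 * p.2 : ℝ) : ℂ)) (p.2 1))).re -
      E₁ * (inner ℂ p.1 (mulL (straightStrip I)
        (fun p => ((1 - ε * κ p.1 * p.2 : ℝ) : ℂ)) p.1)).re := by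
  have hb := essBdd_jacobian hκ hε
  set A := ContinuousLinearMap.adjoint (tensorJ₁ I).toContinuousLinearMap
  set Mh := mulL (straightStrip I) (fun p => ((1 - ε * κ p.1 * p.2 : ℝ) : ℂ)) with hMh
  refine sobolevZero_induction (P := fun p => 1 / 2 * ‖p.1 - tensorJ₁ I (A p.1)‖ ^ 2 -
    10 * (ε * K) ^ 2 * ‖p.1‖ ^ 2 ≤
      (inner ℂ (p.2 1) (Mh (p.2 1))).re - E₁ * (inner ℂ p.1 (Mh p.1)).re) ?_ ?_ hp
  · refine isClosed_le (by fun_prop) ?_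
    exact (Complex.continuous_re.comp (by fun_prop)).sub
      (continuous_const.mul (Complex.continuous_re.comp (by fun_prop)))
  · intro φ hφ p h1 h2
    have hK0 : 0 ≤ K := hκ.2.1
    have hφc : Continuous φ := hφ.1.continuous
    have hdc := testFunctions_fderiv_continuous hφ (0, 1)
    have h2' : p.2 1 =ᵐ[volume.restrict (straightStrip I)] fun x => fderiv ℝ φ x (0, 1) := h2 1
    -- the restriction to the centre line
    have hcL : MemLp (fun s => φ (s, 0)) 2 (volume.restrict I) := by
      refine (Continuous.memLp_of_hasCompactSupport (by fun_prop) ?_).restrict I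
      refine HasCompactSupport.intro (hφ.2.1.isCompact.image continuous_fst) fun s hs => ?_
      exact image_eq_zero_of_notMem_tsupport fun h => hs ⟨(s, 0), h, rfl⟩
    set c : L2 I := hcL.toLp _
    have hv : (p.1 - tensorJ₁ I c : L2 (straightStrip I)) =ᵐ[volume.restrict (straightStrip I)]
        fun x => φ x - φ (x.1, 0) * J₁ x.2 := by
      have h0 : tensorJ₁ I c =ᵐ[volume.restrict (straightStrip I)]
        fun p : ℝ × ℝ => (c : ℝ → ℂ) p.1 * (J₁ p.2 : ℂ) := (memLp_tensor c).coeFn_toLp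
      filter_upwards [h0, h1, ae_strip_of_ae_fst hcL.coeFn_toLp, Lp.coeFn_sub p.1 (tensorJ₁ I c)]
        with x m1 m2 m3 m4
      rw [m4, Pi.sub_apply, m1, m2, m3]
    -- The fibrewise inequality is about φ(s, t) − φ(s, 0) J₁(t); passing to the orthogonal
    -- projection only lowers the left-hand side.
    have hproj := norm_sub_tensor_adjoint_le p.1 c
    have hproj2 : ‖p.1 - tensorJ₁ I (A p.1)‖ ^ 2 ≤ ‖p.1 - tensorJ₁ I c‖ ^ 2 := by gcongr
    set w := p.1 - tensorJ₁ I c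
    have b1 : EssBdd (straightStrip I) (fun _ => ((1 : ℝ) : ℂ)) ‖((1 : ℝ) : ℂ)‖ := EssBdd.const _
    have q1 := re_inner_mulL_eq hb h2'
    have q2 := re_inner_mulL_eq hb h1
    have q3 := re_inner_mulL_eq b1 hv
    have q4 := re_inner_mulL_eq b1 h1
    have i1 := (L2.integrable_inner (𝕜 := ℂ) (p.2 1) (Mh (p.2 1))).congr q1
    have i2 := (L2.integrable_inner (𝕜 := ℂ) p.1 (Mh p.1)).congr q2
    have i3 := (L2.integrable_inner (𝕜 := ℂ) w
      (mulL (straightStrip I) (fun _ => ((1 : ℝ) : ℂ)) w)).congr q3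
    have i4 := (L2.integrable_inner (𝕜 := ℂ) p.1
      (mulL (straightStrip I) (fun _ => ((1 : ℝ) : ℂ)) p.1)).congr q4
    have e1 : inner ℂ (p.2 1) (Mh (p.2 1)) = _ := (L2.inner_def _ _).trans (integral_congr_ae q1)
    have e2 : inner ℂ p.1 (Mh p.1) = _ := (L2.inner_def _ _).trans (integral_congr_ae q2)
    have toR : ∀ f : ℝ × ℝ → ℝ, ∫ x in straightStrip I, (f x : ℂ) =
      ((∫ x in straightStrip I, f x : ℝ) : ℂ) := fun f => integral_ofReal
    rw [toR] at e1 e2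
    have ir : ∀ {f : ℝ × ℝ → ℝ}, Integrable (fun x => (f x : ℂ)) (volume.restrict (straightStrip I)) →
      Integrable f (volume.restrict (straightStrip I)) := fun h => by
        simpa using h.re
    simp only [one_mul] at i3 i4
    have r1 := ir i1
    have r2 := ir i2
    have r3 := ir i3
    have r4 := ir i4
    rw [e1, e2, Complex.ofReal_re, Complex.ofReal_re]
    refine (sub_le_sub_right (mul_le_mul_of_nonneg_left hproj2 (by norm_num)) _).trans ?_
    rw [norm_sq_eq_integral hv, norm_sq_eq_integral h1]
    have s1 := r1.sub' (r2.const_mul E₁)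
    have s2 := (r3.const_mul (1 / 2)).sub' (r4.const_mul (10 * (ε * K) ^ 2))
    have key : 0 ≤ ∫ x in straightStrip I, (((1 - ε * κ x.1 * x.2) * ‖fderiv ℝ φ x (0, 1)‖ ^ 2 -
        E₁ * ((1 - ε * κ x.1 * x.2) * ‖φ x‖ ^ 2)) -
        (1 / 2 * ‖φ x - φ (x.1, 0) * J₁ x.2‖ ^ 2 - 10 * (ε * K) ^ 2 * ‖φ x‖ ^ 2)) := by
      have h_int := s1.sub' s2
      rw [restrict_straightStrip] at h_int ⊢
      rw [integral_prod _ h_int]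
      refine integral_nonneg_of_ae ?_
      filter_upwards [hκ.2.2] with s hs
      rw [integral_crossSection]
      have hs' : |κ s| ≤ K := by simpa using hs
      have hρ : |ε * κ s| ≤ ε * K := by
        rw [abs_mul, abs_of_nonneg hε]
        gcongr
      have c1 : Continuous fun t => φ (s, t) := by fun_prop
      have c2 : Continuous fun t => fderiv ℝ φ (s, t) (0, 1) := hdc.comp (by fun_prop)
      have hJc := J₁_continuous
      -- On the fibre over s the weight is linear with ρ = ε κ(s), and |ρ| ≤ εK ≤ 1/10 for almost
      -- every s.
      have := weighted_form_ge (u := fun t => φ (s, t)) (testFunctions_hasDerivAt_snd hφ s)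
        c2 (testFunctions_eq_zero hφ (by simp [straightStrip, crossSection]))
        (testFunctions_eq_zero hφ (by simp [straightStrip, crossSection])) (hρ.trans hεK)
      have hint2 : ∀ {f : ℝ → ℝ}, Continuous f → IntervalIntegrable f volume (-1) 1 :=
        fun hf => hf.intervalIntegrable _ _
      have hsplit : ∫ t in (-1 : ℝ)..1, (((1 - ε * κ s * t) * ‖fderiv ℝ φ (s, t) (0, 1)‖ ^ 2 -
          E₁ * ((1 - ε * κ s * t) * ‖φ (s, t)‖ ^ 2)) -
          (1 / 2 * ‖φ (s, t) - φ (s, 0) * J₁ t‖ ^ 2 - 10 * (ε * K) ^ 2 * ‖φ (s, t)‖ ^ 2)) =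
          (∫ t in (-1 : ℝ)..1, (1 - ε * κ s * t) *
            (‖fderiv ℝ φ (s, t) (0, 1)‖ ^ 2 - E₁ * ‖φ (s, t)‖ ^ 2)) -
          (1 / 2 * (∫ t in (-1 : ℝ)..1, ‖φ (s, t) - φ (s, 0) * J₁ t‖ ^ 2) -
            10 * (ε * K) ^ 2 * ∫ t in (-1 : ℝ)..1, ‖φ (s, t)‖ ^ 2) := by
        rw [← intervalIntegral.integral_const_mul, ← intervalIntegral.integral_const_mul,
          ← intervalIntegral.integral_sub (hint2 (by fun_prop)) (hint2 (by fun_prop)),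
          ← intervalIntegral.integral_sub (hint2 (by fun_prop)) (hint2 (by fun_prop))]
        refine intervalIntegral.integral_congr fun t _ => ?_
        ring
      have hpos : 0 ≤ ∫ t in (-1 : ℝ)..1, ‖φ (s, t)‖ ^ 2 :=
        intervalIntegral.integral_nonneg (by norm_num) fun t _ => by positivity
      have hsq : (ε * κ s) ^ 2 ≤ (ε * K) ^ 2 := by
        rw [← sq_abs]
        gcongr
      have hmul := mul_le_mul_of_nonneg_right hsq hpos
      simp only [Pi.zero_apply]
      rw [hsplit]
      linarith
    rw [integral_sub s1 s2, integral_sub r1 (r2.const_mul E₁),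
        integral_sub (r3.const_mul (1 / 2)) (r4.const_mul (10 * (ε * K) ^ 2)),
        integral_const_mul, integral_const_mul, integral_const_mul] at key
    linarith

end Strip

/-! ### Steklov approximation -/

section Steklov

variable {f : ℝ → ℝ} {K d : ℝ}

theorem intervalIntegrable_of_bdd {f : ℝ → ℝ} {K : ℝ} (hf : Measurable f) (hK : ∀ s, |f s| ≤ K)
    (a b : ℝ) : IntervalIntegrable f volume a b := by
  rw [intervalIntegrable_iff]
  exact Measure.integrableOn_of_bounded (M := K) (by simp) hf.aestronglyMeasurable
    (Eventually.of_forall hK)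

theorem abs_steklov_le (hK : ∀ s, |f s| ≤ K) (hd : 0 < d) (s : ℝ) : |steklov f d s| ≤ K := by
  have h := intervalIntegral.norm_integral_le_of_norm_le_const (a := s - d / 2) (b := s + d / 2)
    (f := f) (C := K) fun x _ => hK x
  have e : s + d / 2 - (s - d / 2) = d := by ring
  rw [e, abs_of_pos hd, Real.norm_eq_abs] at h
  rw [steklov, abs_mul, abs_of_pos (by positivity), one_div, inv_mul_le_iff₀ hd]
  linarith

/-- Two windows of equal length differ by two end pieces of length |x − y|. The mean is Lipschitz
although `f` is merely bounded. -/
theorem steklov_lipschitz (hf : Measurable f) (hK : ∀ s, |f s| ≤ K) (hd : 0 < d) :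
    LipschitzWith (Real.toNNReal (2 * K / d)) (steklov f d) := by
  have hK0 : 0 ≤ K := (abs_nonneg _).trans (hK 0)
  refine LipschitzWith.of_dist_le_mul fun x y => ?_
  rw [Real.coe_toNNReal _ (by positivity), Real.dist_eq, Real.dist_eq]
  have hi := intervalIntegrable_of_bdd hf hK
  have e : steklov f d x - steklov f d y =
      1 / d * ((∫ ξ in (y + d / 2)..(x + d / 2), f ξ) - ∫ ξ in (y - d / 2)..(x - d / 2), f ξ) := by
    rw [steklov, steklov, ← mul_sub]
    congr 1
    rw [← intervalIntegral.integral_interval_sub_left (hi 0 (x + d / 2)) (hi 0 (x - d / 2)),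
      ← intervalIntegral.integral_interval_sub_left (hi 0 (y + d / 2)) (hi 0 (y - d / 2)),
      ← intervalIntegral.integral_interval_sub_left (hi 0 (x + d / 2)) (hi 0 (y + d / 2)),
      ← intervalIntegral.integral_interval_sub_left (hi 0 (x - d / 2)) (hi 0 (y - d / 2))]
    ring
  have h1 := intervalIntegral.norm_integral_le_of_norm_le_const (a := y + d / 2) (b := x + d / 2)
    (f := f) (C := K) fun x _ => hK x
  have h2 := intervalIntegral.norm_integral_le_of_norm_le_const (a := y - d / 2) (b := x - d / 2)
    (f := f) (C := K) fun x _ => hK x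
  rw [show x + d / 2 - (y + d / 2) = x - y by ring, Real.norm_eq_abs] at h1
  rw [show x - d / 2 - (y - d / 2) = x - y by ring, Real.norm_eq_abs] at h2
  rw [e, abs_mul, abs_of_pos (by positivity : 0 < 1 / d)]
  calc 1 / d * |_ - _| ≤ 1 / d * (K * |x - y| + K * |x - y|) := by
        gcongr
        exact (abs_sub _ _).trans (add_le_add h1 h2)
    _ = 2 * K / d * |x - y| := by ring

/-- The Lipschitz bound makes the essential supremum finite; otherwise `toReal` in `supNorm` would
return 0 and the bound would be false. -/
theorem essBdd_deriv_steklov (hf : Measurable f) (hK : ∀ s, |f s| ≤ K) (hd : 0 < d) (I : Set ℝ) :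
    EssBdd I (fun s => ((deriv (steklov f d) s : ℝ) : ℂ)) (supNorm I (deriv (steklov f d))) := by
  have hL := steklov_lipschitz hf hK hd
  have hm : Measurable (deriv (steklov f d)) := measurable_deriv _
  refine ⟨(Complex.measurable_ofReal.comp hm).aestronglyMeasurable, ENNReal.toReal_nonneg, ?_⟩
  have hfin : eLpNorm (deriv (steklov f d)) ∞ (volume.restrict I) ≠ ⊤ := by
    have : MemLp (deriv (steklov f d)) ∞ (volume.restrict I) :=
      memLp_top_of_bound hm.aestronglyMeasurable _
        (Eventually.of_forall fun s => norm_deriv_le_of_lipschitz hL)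
    exact this.2.ne
  have := ae_le_eLpNormEssSup (f := deriv (steklov f d)) (μ := volume.restrict I)
  filter_upwards [this] with s hs
  rw [supNorm, Complex.norm_real, ← toReal_enorm]
  rw [← eLpNorm_exponent_top] at hs
  exact ENNReal.toReal_mono hfin hs

/-- The variance of `g` on the interval is non-negative. -/
theorem sq_integral_le (hd : 0 < d) {g : ℝ → ℝ} {a b : ℝ} (hab : b - a = d)
    (hg : IntervalIntegrable g volume a b)
    (hg2 : IntervalIntegrable (fun x => g x ^ 2) volume a b) :
    (1 / d * ∫ x in a..b, g x) ^ 2 ≤ 1 / d * ∫ x in a..b, g x ^ 2 := by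
  set m := 1 / d * ∫ x in a..b, g x with hm
  have h0 : 0 ≤ ∫ x in a..b, (g x ^ 2 - 2 * m * g x + m ^ 2) := by
    refine intervalIntegral.integral_nonneg (by linarith) fun x _ => ?_
    nlinarith [sq_nonneg (g x - m)]
  rw [intervalIntegral.integral_add (hg2.sub (hg.const_mul _)) intervalIntegrable_const,
    intervalIntegral.integral_sub hg2 (hg.const_mul _), intervalIntegral.integral_const_mul,
    intervalIntegral.integral_const, hab, smul_eq_mul] at h0
  have h1 : ∫ x in a..b, g x = d * m := by rw [hm]; field_simp
  rw [h1] at h0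
  rw [one_div, le_inv_mul_iff₀ hd]
  nlinarith

/-- Real suprema bound their families only when these are bounded above; the bound on `f` supplies
(2K)² for the inner family and 2K for the outer one. -/
theorem integral_shift_sq_le_modulus (hK : ∀ s, |f s| ≤ K) (n : ℤ)
    {η : ℝ} (hη : η ∈ Icc (-(d / 2)) (d / 2)) :
    ∫ s in (n : ℝ)..(n + 1), |f s - f (s + η)| ^ 2 ≤ modulus f d ^ 2 := by
  have hb : ∀ (n : ℤ) (η : ℝ), ∫ s in (n : ℝ)..(n + 1), |f s - f (s + η)| ^ 2 ≤ (2 * K) ^ 2 := by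
    intro n η
    have h : ∀ s ∈ uIoc (n : ℝ) (n + 1), ‖|f s - f (s + η)| ^ 2‖ ≤ (2 * K) ^ 2 := by
      intro s _
      rw [Real.norm_eq_abs, abs_of_nonneg (by positivity)]
      gcongr
      exact (abs_sub _ _).trans (by linarith [hK s, hK (s + η)])
    have := (le_abs_self _).trans (intervalIntegral.norm_integral_le_of_norm_le_const h)
    simpa using this
  have hK0 : 0 ≤ K := (abs_nonneg _).trans (hK 0)
  have : Nonempty (Icc (-(d / 2)) (d / 2)) := ⟨⟨η, hη⟩⟩
  have bdd1 : ∀ n : ℤ, BddAbove (range fun η : Icc (-(d / 2)) (d / 2) =>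
      ∫ s in (n : ℝ)..(n + 1), |f s - f (s + η)| ^ 2) := by
    rintro n
    refine ⟨(2 * K) ^ 2, ?_⟩
    rintro _ ⟨η, rfl⟩
    exact hb n η
  have bdd2 : BddAbove (range fun n : ℤ => √(⨆ η : Icc (-(d / 2)) (d / 2),
      ∫ s in (n : ℝ)..(n + 1), |f s - f (s + η)| ^ 2)) := by
    refine ⟨2 * K, ?_⟩
    rintro _ ⟨n, rfl⟩
    rw [Real.sqrt_le_left (by positivity)]
    exact ciSup_le fun η => hb n η
  have h1 := le_ciSup (bdd1 n) ⟨η, hη⟩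
  have h2 := le_ciSup bdd2 n
  have h3 : 0 ≤ ∫ s in (n : ℝ)..(n + 1), |f s - f (s + η)| ^ 2 :=
    intervalIntegral.integral_nonneg (by linarith) fun _ _ => by positivity
  refine h1.trans ?_
  rw [← Real.sq_sqrt (h3.trans h1)]
  gcongr
  exact h2

/-- The approximation error is the average of f(s + η) − f(s) over |η| ≤ d/2. Jensen moves the
square inside, and Fubini reduces to single shifts. -/
theorem integral_steklov_sub_sq_le (hf : Measurable f) (hK : ∀ s, |f s| ≤ K) (hd : 0 < d) (n : ℤ) :
    ∫ s in (n : ℝ)..(n + 1), (steklov f d s - f s) ^ 2 ≤ modulus f d ^ 2 := by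
  have hK0 : 0 ≤ K := (abs_nonneg _).trans (hK 0)
  have hΦm : Measurable fun p : ℝ × ℝ => |f p.1 - f (p.1 + p.2)| ^ 2 := by
    have h1 : Measurable fun p : ℝ × ℝ => f (p.1 + p.2) := hf.comp (by fun_prop)
    have h2 : Measurable fun p : ℝ × ℝ => f p.1 := hf.comp measurable_fst
    exact (continuous_abs.measurable.comp (h2.sub h1)).pow_const 2
  have hΦb : ∀ s η, |(|f s - f (s + η)| ^ 2)| ≤ (2 * K) ^ 2 := by
    intro s η
    rw [abs_of_nonneg (by positivity)]
    gcongr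
    exact (abs_sub _ _).trans (by linarith [hK s, hK (s + η)])
  have hslice1 : ∀ s, Measurable fun η => |f s - f (s + η)| ^ 2 := fun s =>
    hΦm.comp measurable_prodMk_left
  have hle : -(d / 2) ≤ d / 2 := by linarith
  have hpt : ∀ s, (steklov f d s - f s) ^ 2 ≤
      1 / d * ∫ η in (-(d / 2))..(d / 2), |f s - f (s + η)| ^ 2 := by
    intro s
    have e : steklov f d s - f s = 1 / d * ∫ η in (-(d / 2))..(d / 2), (f (s + η) - f s) := by
      have hm : Measurable fun η => f (s + η) := hf.comp (by fun_prop)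
      rw [intervalIntegral.integral_sub (intervalIntegrable_of_bdd hm (fun η => hK _) _ _)
        intervalIntegrable_const, intervalIntegral.integral_const,
        intervalIntegral.integral_comp_add_left f s, steklov, smul_eq_mul, ← sub_eq_add_neg]
      field_simp
      ring
    have hm : Measurable fun η => f (s + η) - f s := (hf.comp (by fun_prop)).sub_const _
    have hb : ∀ η, |f (s + η) - f s| ≤ 2 * K := fun η =>
      (abs_sub _ _).trans (by linarith [hK s, hK (s + η)])
    rw [e]
    refine (sq_integral_le hd (by ring) (intervalIntegrable_of_bdd hm hb _ _)
      (intervalIntegrable_of_bdd (K := (2 * K) ^ 2) (hm.pow_const 2) (fun η => ?_) _ _)).trans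
        (le_of_eq ?_)
    · rw [abs_pow]
      gcongr
      exact hb η
    · congr 1
      refine intervalIntegral.integral_congr fun η _ => ?_
      simp only [sq_abs]
      ring
  have h_int : Integrable (Function.uncurry fun s η => |f s - f (s + η)| ^ 2)
      ((volume.restrict (Ioc (n : ℝ) (n + 1))).prod (volume.restrict (Ioc (-(d / 2)) (d / 2)))) := by
    refine Integrable.of_bound (C := (2 * K) ^ 2) hΦm.aestronglyMeasurable ?_
    exact Eventually.of_forall fun p => hΦb p.1 p.2
  have hswap : ∫ s in (n : ℝ)..(n + 1), ∫ η in (-(d / 2))..(d / 2), |f s - f (s + η)| ^ 2 =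
      ∫ η in (-(d / 2))..(d / 2), ∫ s in (n : ℝ)..(n + 1), |f s - f (s + η)| ^ 2 := by
    simp only [intervalIntegral.integral_of_le hle,
      intervalIntegral.integral_of_le (show (n : ℝ) ≤ n + 1 by linarith)]
    exact integral_integral_swap h_int
  have hi1 : IntervalIntegrable (fun s => ∫ η in (-(d / 2))..(d / 2), |f s - f (s + η)| ^ 2)
      volume n (n + 1) := by
    rw [intervalIntegrable_iff, uIoc_of_le (by linarith)]
    simp only [intervalIntegral.integral_of_le hle]
    exact h_int.integral_prod_left
  have hi2 : IntervalIntegrable (fun η => ∫ s in (n : ℝ)..(n + 1), |f s - f (s + η)| ^ 2)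
      volume (-(d / 2)) (d / 2) := by
    rw [intervalIntegrable_iff, uIoc_of_le hle]
    simp only [intervalIntegral.integral_of_le (show (n : ℝ) ≤ n + 1 by linarith)]
    exact h_int.integral_prod_right
  have hsm : Measurable fun s => (steklov f d s - f s) ^ 2 :=
    ((steklov_lipschitz hf hK hd).continuous.measurable.sub hf).pow_const 2
  calc ∫ s in (n : ℝ)..(n + 1), (steklov f d s - f s) ^ 2
      ≤ ∫ s in (n : ℝ)..(n + 1), 1 / d * ∫ η in (-(d / 2))..(d / 2), |f s - f (s + η)| ^ 2 := by
        refine intervalIntegral.integral_mono_on (by linarith) ?_ (hi1.const_mul _)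
          fun s _ => hpt s
        refine intervalIntegrable_of_bdd (K := (2 * K) ^ 2) hsm (fun s => ?_) _ _
        rw [abs_pow]
        gcongr
        exact (abs_sub _ _).trans (by linarith [hK s, abs_steklov_le hK hd s])
    _ = 1 / d * ∫ η in (-(d / 2))..(d / 2), ∫ s in (n : ℝ)..(n + 1), |f s - f (s + η)| ^ 2 := by
        rw [intervalIntegral.integral_const_mul, hswap]
    _ ≤ 1 / d * ∫ η in (-(d / 2))..(d / 2), modulus f d ^ 2 := by
        gcongr
        refine intervalIntegral.integral_mono_on hle hi2 intervalIntegrable_const fun η hη => ?_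
        exact integral_shift_sq_le_modulus hK n hη
    _ = modulus f d ^ 2 := by
        rw [intervalIntegral.integral_const, smul_eq_mul]
        field_simp
        ring

/-- The one-dimensional Sobolev embedding: |θ(x)|² ≤ 2 |θ(y)|² + 2 (∫ |θ′|)², averaged over y in the
unit interval. -/
theorem norm_sq_le_unit_interval {θ dθ : ℝ → ℂ} (hθ : ∀ s, HasDerivAt θ (dθ s) s)
    (hdθ : Continuous dθ) {a x : ℝ} (hx : x ∈ Icc a (a + 1)) :
    ‖θ x‖ ^ 2 ≤ 2 * ∫ s in a..(a + 1), (‖θ s‖ ^ 2 + ‖dθ s‖ ^ 2) := by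
  have hθc : Continuous θ := continuous_iff_continuousAt.2 fun s => (hθ s).continuousAt
  have hle : a ≤ a + 1 := by linarith
  have c1 : Continuous fun s => ‖θ s‖ ^ 2 := by fun_prop
  have c2 : Continuous fun s => ‖dθ s‖ ^ 2 := by fun_prop
  set D := ∫ s in a..(a + 1), ‖dθ s‖ with hD
  have hD2 : D ^ 2 ≤ ∫ s in a..(a + 1), ‖dθ s‖ ^ 2 := by
    have := sq_integral_le (d := 1) one_pos (g := fun s => ‖dθ s‖) (a := a) (b := a + 1) (by ring)
      (hdθ.norm.intervalIntegrable _ _) (c2.intervalIntegrable _ _)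
    simpa using this
  have hpt : ∀ y ∈ Icc a (a + 1), ‖θ x‖ ^ 2 ≤ 2 * ‖θ y‖ ^ 2 + 2 * D ^ 2 := by
    intro y hy
    have h1 : ∫ s in y..x, dθ s = θ x - θ y :=
      intervalIntegral.integral_eq_sub_of_hasDerivAt (fun s _ => hθ s)
        (hdθ.intervalIntegrable _ _)
    have h2 : ‖θ x - θ y‖ ≤ D := by
      rw [← h1]
      refine intervalIntegral.norm_integral_le_abs_integral_norm.trans ?_
      rw [intervalIntegral.abs_integral_eq_abs_integral_uIoc, hD,
        intervalIntegral.integral_of_le hle]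
      rw [abs_of_nonneg (setIntegral_nonneg measurableSet_uIoc fun s _ => norm_nonneg _)]
      refine setIntegral_mono_set ?_ (Eventually.of_forall fun s => norm_nonneg _) ?_
      · exact (hdθ.norm.intervalIntegrable a (a + 1)).1
      · refine LE.le.eventuallyLE ?_
        rw [← uIoc_of_le hle]
        exact uIoc_subset_uIoc_of_uIcc_subset_uIcc (uIcc_subset_uIcc
          (by rwa [uIcc_of_le hle]) (by rwa [uIcc_of_le hle]))
    have h3 : ‖θ x‖ ≤ ‖θ y‖ + D := by
      have : θ x = θ y + (θ x - θ y) := by ring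
      rw [this]
      exact (norm_add_le _ _).trans (by linarith)
    have h4 : ‖θ x‖ ^ 2 ≤ (‖θ y‖ + D) ^ 2 := by gcongr
    nlinarith [sq_nonneg (‖θ y‖ - D)]
  have h5 : ∫ _ in a..(a + 1), ‖θ x‖ ^ 2 ≤ ∫ y in a..(a + 1), (2 * ‖θ y‖ ^ 2 + 2 * D ^ 2) :=
    intervalIntegral.integral_mono_on hle intervalIntegrable_const
      (((c1.const_mul 2).add continuous_const).intervalIntegrable _ _) hpt
  rw [intervalIntegral.integral_add ((c1.const_mul 2).intervalIntegrable _ _)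
    intervalIntegrable_const, intervalIntegral.integral_const_mul, intervalIntegral.integral_const,
    intervalIntegral.integral_const, add_sub_cancel_left, one_smul, one_smul] at h5
  rw [intervalIntegral.integral_add (c1.intervalIntegrable _ _) (c2.intervalIntegrable _ _)]
  linarith

/-- The embedding is applied on each cell [n, n + 1] and summed. Uniform smallness of `g` in L² of
unit cells is enough for a multiplier on W^{1,2}; this explains the supremum over n in `modulus`. -/
theorem integral_mul_norm_sq_le {g : ℝ → ℝ} {K σ : ℝ} (hg : Measurable g) (hK : ∀ s, |g s| ≤ K)
    (hσ : ∀ n : ℤ, ∫ s in (n : ℝ)..(n + 1), g s ^ 2 ≤ σ ^ 2) {θ dθ : ℝ → ℂ}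
    (hθ : ∀ s, HasDerivAt θ (dθ s) s) (hdθ : Continuous dθ) (hc : HasCompactSupport θ)
    (hdc : HasCompactSupport dθ) :
    ∫ s, g s ^ 2 * ‖θ s‖ ^ 2 ≤ 2 * σ ^ 2 * ∫ s, (‖θ s‖ ^ 2 + ‖dθ s‖ ^ 2) := by
  have hθc : Continuous θ := continuous_iff_continuousAt.2 fun s => (hθ s).continuousAt
  have i1 : Integrable fun s => ‖θ s‖ ^ 2 :=
    Continuous.integrable_of_hasCompactSupport (by fun_prop) (hc.norm.comp_left (g := (· ^ 2)) (by simp))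
  have i2 : Integrable fun s => ‖dθ s‖ ^ 2 :=
    Continuous.integrable_of_hasCompactSupport (by fun_prop) (hdc.norm.comp_left (g := (· ^ 2)) (by simp))
  have g2 : ∀ s, |g s ^ 2| ≤ K ^ 2 := fun s => by
    rw [abs_pow]
    have := hK s
    gcongr
  have i3 : Integrable fun s => g s ^ 2 * ‖θ s‖ ^ 2 :=
    i1.bdd_mul (c := K ^ 2) (hg.pow_const 2).aestronglyMeasurable (Eventually.of_forall g2)
  have s1 := i3.hasSum_intervalIntegral 0
  have i4 : Integrable fun s => ‖θ s‖ ^ 2 + ‖dθ s‖ ^ 2 := i1.add i2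
  have s2 := (i4.hasSum_intervalIntegral 0).mul_left (2 * σ ^ 2)
  refine hasSum_le (fun n => ?_) s1 s2
  simp only [zero_add]
  have hle : (n : ℝ) ≤ n + 1 := by linarith
  set S := ∫ s in (n : ℝ)..(n + 1), (‖θ s‖ ^ 2 + ‖dθ s‖ ^ 2)
  have hS : 0 ≤ S := intervalIntegral.integral_nonneg hle fun s _ => by positivity
  calc ∫ s in (n : ℝ)..(n + 1), g s ^ 2 * ‖θ s‖ ^ 2
      ≤ ∫ s in (n : ℝ)..(n + 1), g s ^ 2 * (2 * S) := by
        refine intervalIntegral.integral_mono_on hle i3.intervalIntegrable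
          ((intervalIntegrable_of_bdd (hg.pow_const 2) g2 _ _).mul_const _) fun s hs => ?_
        gcongr
        exact norm_sq_le_unit_interval hθ hdθ hs
    _ = (∫ s in (n : ℝ)..(n + 1), g s ^ 2) * (2 * S) := by
        rw [intervalIntegral.integral_mul_const]
    _ ≤ σ ^ 2 * (2 * S) := by
        gcongr
        exact hσ n
    _ = 2 * σ ^ 2 * S := by ring

theorem modulus_nonneg (f : ℝ → ℝ) (d : ℝ) : 0 ≤ modulus f d :=
  Real.iSup_nonneg fun _ => Real.sqrt_nonneg _

/-- Multiplication by the error of the Steklov approximation is small on `W₀^{1,2}(I)`. -/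
theorem norm_mulL_steklov_sub_sq_le {I : Set ℝ} (hf : Measurable f) (hK : ∀ s, |f s| ≤ K)
    (hd : 0 < d) {p : L2 I × (Fin 1 → L2 I)} (hp : p ∈ sobolevZero axisLine I) :
    ‖mulL I (fun s => ((steklov f d s - f s : ℝ) : ℂ)) p.1‖ ^ 2 ≤
      2 * modulus f d ^ 2 * (‖p.1‖ ^ 2 + ‖p.2 0‖ ^ 2) := by
  have hgm : Measurable fun s => steklov f d s - f s :=
    (steklov_lipschitz hf hK hd).continuous.measurable.sub hf
  have hgb : ∀ s, |steklov f d s - f s| ≤ 2 * K := fun s =>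
    (abs_sub _ _).trans (by linarith [hK s, abs_steklov_le hK hd s])
  have hb : EssBdd I (fun s => ((steklov f d s - f s : ℝ) : ℂ)) (2 * K) :=
    ⟨(Complex.measurable_ofReal.comp hgm).aestronglyMeasurable, (abs_nonneg _).trans (hgb 0),
      Eventually.of_forall fun s => by rw [Complex.norm_real]; exact hgb s⟩
  refine sobolevZero_induction (P := fun p =>
    ‖mulL I (fun s => ((steklov f d s - f s : ℝ) : ℂ)) p.1‖ ^ 2 ≤
      2 * modulus f d ^ 2 * (‖p.1‖ ^ 2 + ‖p.2 0‖ ^ 2)) ?_ ?_ hp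
  · exact isClosed_le (by fun_prop) (by fun_prop)
  · intro φ hφ p h1 h2
    have h3 := integral_mul_norm_sq_le hgm hgb (integral_steklov_sub_sq_le hf hK hd)
      (testFunctions_hasDerivAt hφ) (testFunctions_deriv_continuous hφ) hφ.2.1 hφ.2.1.deriv
    have hm : mulL I (fun s => ((steklov f d s - f s : ℝ) : ℂ)) p.1 =ᵐ[volume.restrict I]
        fun s => ((steklov f d s - f s : ℝ) : ℂ) * φ s := by
      filter_upwards [mulL_ae hb p.1, h1] with s k1 k2
      rw [k1, k2]
    have z1 : ∀ s, s ∉ I → φ s = 0 := fun s hs => testFunctions_eq_zero hφ hs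
    have z2 : ∀ s, s ∉ I → deriv φ s = 0 := fun s hs =>
      image_eq_zero_of_notMem_tsupport fun h => hs (hφ.2.2 (tsupport_deriv_subset h))
    rw [norm_sq_eq_integral hm, norm_sq_eq_integral h1, norm_sq_eq_integral (h2 0)]
    simp only [fderiv_axisLine]
    rw [setIntegral_eq_integral_of_forall_compl_eq_zero (fun s hs => by simp [z1 s hs]),
      setIntegral_eq_integral_of_forall_compl_eq_zero (fun s hs => by simp [z1 s hs]),
      setIntegral_eq_integral_of_forall_compl_eq_zero (fun s hs => by simp [z2 s hs])]
    have hθc : Continuous φ := hφ.1.continuous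
    have hdc := testFunctions_deriv_continuous hφ
    have i1 : Integrable fun s => ‖φ s‖ ^ 2 :=
      Continuous.integrable_of_hasCompactSupport (by fun_prop)
        (hφ.2.1.norm.comp_left (g := (· ^ 2)) (by simp))
    have i2 : Integrable fun s => ‖deriv φ s‖ ^ 2 :=
      Continuous.integrable_of_hasCompactSupport (by fun_prop)
        (hφ.2.1.deriv.norm.comp_left (g := (· ^ 2)) (by simp))
    rw [integral_add i1 i2] at h3
    refine le_trans (le_of_eq ?_) h3
    refine integral_congr_ae (Eventually.of_forall fun s => ?_)
    simp only [norm_mul, Complex.norm_real, mul_pow, Real.norm_eq_abs, sq_abs]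

end Steklov

/-! ### Regularity of the curve -/

section Curve

theorem exists_lt_gt_mem_of_isOpen {I : Set ℝ} (hI : IsOpen I) {a : ℝ} (ha : a ∈ I) :
    ∃ b ∈ I, b < a ∧ ∃ c ∈ I, a < c := by
  obtain ⟨r, hr, hrI⟩ := Metric.isOpen_iff.1 hI a ha
  refine ⟨a - r / 2, hrI ?_, by linarith, a + r / 2, hrI ?_, by linarith⟩ <;>
  · rw [Metric.mem_ball, Real.dist_eq]
    have h : |r / 2| < r := by rw [abs_of_pos (by positivity)]; linarith
    simpa using h

open Convolution in
/-- A continuous function with a bounded weak derivative is Lipschitz. -/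
theorem lipschitz_of_hasWeakDeriv {I : Set ℝ} {f g : ℝ → ℝ} {a b M : ℝ} (hab : Icc a b ⊆ I)
    (hf : ContinuousOn f (Icc a b)) (hw : HasWeakDeriv I f g)
    (hM0 : 0 ≤ M)
    (hg : ∀ᵐ s ∂volume.restrict (Icc a b), |g s| ≤ M) {x y : ℝ} (hx : x ∈ Ioo a b)
    (hy : y ∈ Ioo a b) : |f x - f y| ≤ M * |x - y| := by
  set F : ℝ → ℝ := (Icc a b).indicator f with hF
  have hFi : Integrable F := by
    rw [hF, integrable_indicator_iff measurableSet_Icc]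
    exact hf.integrableOn_Icc
  -- Mollifier radii are at most r, so a kernel centred anywhere between x and y stays supported in
  -- [a, b].
  set r : ℝ := min (min x y - a) (b - max x y) with hr
  have hrpos : 0 < r := by
    refine lt_min (sub_pos.2 (lt_min hx.1 hy.1)) (sub_pos.2 (max_lt hx.2 hy.2))
  let φ : ℕ → ContDiffBump (0 : ℝ) := fun n =>
    ⟨r / (2 * (n + 1)), r / (n + 1), by positivity, by
      apply div_lt_div_of_pos_left hrpos (by positivity); linarith [Nat.cast_nonneg (α := ℝ) n]⟩
  have hrout : ∀ n, (φ n).rOut = r / (n + 1) := fun n => rfl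
  have hroutle : ∀ n, (φ n).rOut ≤ r := fun n => by
    rw [hrout]; exact div_le_self hrpos.le (by linarith [Nat.cast_nonneg (α := ℝ) n])
  have hrlim : Tendsto (fun n => (φ n).rOut) atTop (𝓝 0) := by
    simp only [hrout]
    exact tendsto_const_div_atTop_nhds_zero_nat r |>.comp (tendsto_add_atTop_nat 1) |>.congr
      fun n => by simp
  let Fn : ℕ → ℝ → ℝ := fun n => (φ n).normed volume ⋆[ContinuousLinearMap.lsmul ℝ ℝ, volume] F
  have hlim : ∀ z ∈ Ioo a b, Tendsto (fun n => Fn n z) atTop (𝓝 (f z)) := by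
    intro z hz
    have hc : ContinuousAt F z := by
      refine (hf.continuousAt (Icc_mem_nhds hz.1 hz.2)).congr ?_
      filter_upwards [Icc_mem_nhds hz.1 hz.2] with w hw
      rw [hF, indicator_of_mem hw]
    have hFz : F z = f z := indicator_of_mem (Ioo_subset_Icc_self hz) f
    rw [← hFz]
    exact ContDiffBump.convolution_tendsto_right (g := fun _ => F) hrlim
      (Eventually.of_forall fun _ => hFi.aestronglyMeasurable)
      (hc.tendsto.comp tendsto_snd) tendsto_const_nhds
  have hderiv : ∀ n z, HasDerivAt (Fn n)
      ((deriv ((φ n).normed volume) ⋆[ContinuousLinearMap.lsmul ℝ ℝ, volume] F) z) z := fun n z =>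
    (φ n).hasCompactSupport_normed.hasDerivAt_convolution_left _
      ((φ n).contDiff_normed) hFi.locallyIntegrable z
  have hbound : ∀ n, ∀ z ∈ Icc (min x y) (max x y),
      ‖(deriv ((φ n).normed volume) ⋆[ContinuousLinearMap.lsmul ℝ ℝ, volume] F) z‖ ≤ M := by
    intro n z hz
    -- The reflected kernel is a test function of mass one, and the derivative of the mollification
    -- at z is its pairing with `g`, hence at most `M`.
    let ψ : ℝ → ℝ := fun u => (φ n).normed volume (z - u)
    have hψd : ContDiff ℝ ∞ ψ := (φ n).contDiff_normed.comp (by fun_prop)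
    have hψs : Function.support ψ ⊆ Icc a b := by
      intro u hu
      have h1 : z - u ∈ Function.support ((φ n).normed volume) := hu
      rw [(φ n).support_normed_eq, Metric.mem_ball, dist_zero_right, Real.norm_eq_abs,
        abs_lt] at h1
      have h2 := hroutle n
      have h3 : r ≤ min x y - a := min_le_left _ _
      have h4 : r ≤ b - max x y := min_le_right _ _
      constructor <;> linarith [hz.1, hz.2]
    have hψt : tsupport ψ ⊆ Icc a b := closure_minimal hψs isClosed_Icc
    have hψc : HasCompactSupport ψ :=
      isCompact_Icc.of_isClosed_subset (isClosed_tsupport _) hψt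
    have hψ' : ∀ u, deriv ψ u = -deriv ((φ n).normed volume) (z - u) := fun u => by
      simp only [ψ, deriv_comp_const_sub]
    have h1 := hw ψ hψd hψc (hψt.trans hab)
    have e1 : (deriv ((φ n).normed volume) ⋆[ContinuousLinearMap.lsmul ℝ ℝ, volume] F) z =
        -∫ s in I, f s * deriv ψ s := by
      rw [convolution_eq_swap, ← integral_neg]
      simp only [ContinuousLinearMap.lsmul_apply, smul_eq_mul]
      rw [setIntegral_eq_integral_of_forall_compl_eq_zero]
      · refine integral_congr_ae (Eventually.of_forall fun u => ?_)
        simp only [hψ']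
        by_cases hu : u ∈ Icc a b
        · rw [hF, indicator_of_mem hu]
          ring
        · have : deriv ψ u = 0 := image_eq_zero_of_notMem_tsupport fun h =>
            hu (hψt (tsupport_deriv_subset h))
          rw [hψ'] at this
          rw [hF, indicator_of_notMem hu, this]
          ring
      · intro u hu
        have : deriv ψ u = 0 := image_eq_zero_of_notMem_tsupport fun h =>
            hu (hab (hψt (tsupport_deriv_subset h)))
        rw [this]
        simp
    rw [e1, h1, neg_neg]
    have hψi : Integrable ψ := hψd.continuous.integrable_of_hasCompactSupport hψc
    have hψ0 : ∀ u, 0 ≤ ψ u := fun u => (φ n).nonneg_normed _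
    have hψint : ∫ u, ψ u = 1 := by
      rw [← (φ n).integral_normed (μ := volume)]
      exact integral_sub_left_eq_self (fun u => (φ n).normed volume u) volume z
    have hle : ‖∫ s in I, g s * ψ s‖ ≤ ∫ s in I, M * ψ s := by
      refine norm_integral_le_of_norm_le (hψi.const_mul M).restrict ?_
      have hg' := (ae_restrict_iff' measurableSet_Icc).1 hg
      refine ae_restrict_of_ae ?_
      filter_upwards [hg'] with u hu
      by_cases hm : u ∈ Icc a b
      · rw [norm_mul, Real.norm_eq_abs, Real.norm_eq_abs, abs_of_nonneg (hψ0 u)]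
        exact mul_le_mul_of_nonneg_right (hu hm) (hψ0 u)
      · rw [Function.notMem_support.1 fun h => hm (hψs h)]
        simp
    rw [integral_const_mul] at hle
    have : ∫ u in I, ψ u ≤ 1 := by
      rw [← hψint]
      exact setIntegral_le_integral hψi (Eventually.of_forall hψ0)
    nlinarith
  have hn : ∀ n, |Fn n x - Fn n y| ≤ M * |x - y| := by
    intro n
    have := (convex_Icc (min x y) (max x y)).norm_image_sub_le_of_norm_hasDerivWithin_le
      (f := Fn n) (fun z _ => (hderiv n z).hasDerivWithinAt) (hbound n)
      (x := y) (y := x) ⟨min_le_right _ _, le_max_right _ _⟩ ⟨min_le_left _ _, le_max_left _ _⟩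
    simpa using this
  exact le_of_tendsto ((hlim x hx).sub (hlim y hy)).abs (Eventually.of_forall hn)

theorem MemLinftyLoc.locallyIntegrableOn {I : Set ℝ} (hI : IsOpen I) {f : ℝ → ℝ}
    (hf : MemLinftyLoc I f) : LocallyIntegrableOn f I := by
  rw [locallyIntegrableOn_iff hI.isLocallyClosed]
  intro k hk hkc
  have : IsFiniteMeasure (volume.restrict k) := ⟨by simpa using hkc.measure_lt_top⟩
  exact (hf k hk hkc).integrable le_top

theorem integrableOn_mul_testFunction {I : Set ℝ} {w φ : ℝ → ℝ}
    (hw : LocallyIntegrableOn w I) (hφ : Continuous φ) (hc : HasCompactSupport φ)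
    (hs : tsupport φ ⊆ I) : Integrable fun s => w s * φ s := by
  have h1 : IntegrableOn w (tsupport φ) := hw.integrableOn_compact_subset hs hc.isCompact
  obtain ⟨C, hC⟩ := hφ.bounded_above_of_compact_support hc
  have h2 : IntegrableOn (fun s => w s * φ s) (tsupport φ) :=
    h1.mul_bdd (c := C) hφ.aestronglyMeasurable (Eventually.of_forall hC)
  refine (integrableOn_iff_integrable_of_support_subset ?_).1 h2
  intro s hs
  by_contra h
  exact hs (by simp [image_eq_zero_of_notMem_tsupport h])

/-- The classical derivative of a `C¹` function in `W^{2,∞}_loc` has a weak derivative in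
`L^∞_loc`. -/
theorem exists_weakDeriv_deriv {I : Set ℝ} (hI : IsOpen I) {γ : ℝ → ℝ}
    (hγ : ∀ s ∈ I, HasDerivAt γ (deriv γ s) s) (hγ' : ContinuousOn (deriv γ) I)
    (hW : MemW2InftyLoc I γ) : ∃ g, HasWeakDeriv I (deriv γ) g ∧ MemLinftyLoc I g := by
  obtain ⟨f', f'', h1, h2, -, h4, h5⟩ := hW
  have hl1 : LocallyIntegrableOn f' I := h4.locallyIntegrableOn hI
  have hl2 : LocallyIntegrableOn (deriv γ) I := hγ'.locallyIntegrableOn hI.measurableSet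
  have hγc : ContinuousOn γ I := fun s hs => (hγ s hs).continuousAt.continuousWithinAt
  have hl3 : LocallyIntegrableOn γ I := hγc.locallyIntegrableOn hI.measurableSet
  -- The weak and the classical derivative have the same pairings with test functions, so the former
  -- may be replaced by the latter.
  have hae : ∀ᵐ s ∂(volume : Measure ℝ), s ∈ I → f' s - deriv γ s = 0 := by
    refine hI.ae_eq_zero_of_integral_contDiff_smul_eq_zero (hl1.sub hl2) fun φ hφ hc hs => ?_
    have i1 := integrableOn_mul_testFunction hl1 hφ.continuous hc hs
    have i2 := integrableOn_mul_testFunction hl2 hφ.continuous hc hs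
    have i3 := integrableOn_mul_testFunction hl3 (hφ.continuous_deriv (by simp)) hc.deriv
      (tsupport_deriv_subset.trans hs)
    have i4 := integrableOn_mul_testFunction hl3 hφ.continuous hc hs
    have hd : ∀ s, HasDerivAt (fun s => γ s * φ s) (deriv γ s * φ s + γ s * deriv φ s) s := by
      intro s
      have hφs : HasDerivAt φ (deriv φ s) s := (hφ.differentiable (by simp) s).hasDerivAt
      by_cases hsI : s ∈ I
      · exact (hγ s hsI).mul hφs
      · have hst : s ∉ tsupport φ := fun h => hsI (hs h)
        have e0 : φ =ᶠ[𝓝 s] 0 := notMem_tsupport_iff_eventuallyEq.1 hst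
        have e1 : (fun s => γ s * φ s) =ᶠ[𝓝 s] fun _ => 0 := by
          filter_upwards [e0] with u hu
          simp [hu]
        have e2 : deriv φ s = 0 := by rw [e0.deriv_eq]; simp
        rw [e2, e0.eq_of_nhds]
        simpa using (hasDerivAt_const s (0 : ℝ)).congr_of_eventuallyEq e1
    have h0 := integral_eq_zero_of_hasDerivAt_of_integrable hd (i2.add i3) i4
    rw [integral_add i2 i3] at h0
    have hw := h1 φ hφ hc hs
    rw [setIntegral_eq_integral_of_forall_compl_eq_zero, setIntegral_eq_integral_of_forall_compl_eq_zero]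
      at hw
    · have : ∫ s, φ s • (f' s - deriv γ s) = (∫ s, f' s * φ s) - ∫ s, deriv γ s * φ s := by
        rw [← integral_sub i1 i2]
        refine integral_congr_ae (Eventually.of_forall fun s => ?_)
        simp only [smul_eq_mul]
        ring
      rw [this]
      linarith
    · intro s hsI
      rw [image_eq_zero_of_notMem_tsupport fun h => hsI (hs h), mul_zero]
    · intro s hsI
      rw [image_eq_zero_of_notMem_tsupport (f := deriv φ)
        fun h => hsI (hs (tsupport_deriv_subset h)), mul_zero]
  refine ⟨f'', fun φ hφ hc hs => ?_, h5⟩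
  rw [← h2 φ hφ hc hs]
  refine integral_congr_ae ?_
  filter_upwards [(ae_restrict_iff' hI.measurableSet).2 hae] with s hs
  rw [sub_eq_zero.1 hs]

/-- The interval is enlarged inside I, because `lipschitz_of_hasWeakDeriv` reaches interior points
only. -/
theorem exists_lipschitzOnWith_Icc {I : Set ℝ} (hI : IsOpen I) (hI' : I.OrdConnected) {f g : ℝ → ℝ}
    (hf : ContinuousOn f I) (hw : HasWeakDeriv I f g) (hg : MemLinftyLoc I g) {a b : ℝ}
    (ha : a ∈ I) (hb : b ∈ I) : ∃ C, LipschitzOnWith C f (Icc a b) := by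
  obtain ⟨a', ha', haa', -⟩ := exists_lt_gt_mem_of_isOpen hI ha
  obtain ⟨-, -, -, b', hb', hbb'⟩ := exists_lt_gt_mem_of_isOpen hI hb
  have hsub : Icc a' b' ⊆ I := hI'.out ha' hb'
  set M := (eLpNorm g ⊤ (volume.restrict (Icc a' b'))).toReal
  have hM : ∀ᵐ s ∂volume.restrict (Icc a' b'), |g s| ≤ M := by
    have hm := hg _ hsub isCompact_Icc
    filter_upwards [ae_le_eLpNormEssSup (f := g) (μ := volume.restrict (Icc a' b'))] with s hs
    rw [← Real.norm_eq_abs, ← toReal_enorm]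
    rw [← eLpNorm_exponent_top] at hs
    exact ENNReal.toReal_mono hm.2.ne hs
  refine ⟨Real.toNNReal M, LipschitzOnWith.of_dist_le_mul fun x hx y hy => ?_⟩
  rw [Real.coe_toNNReal _ ENNReal.toReal_nonneg, Real.dist_eq, Real.dist_eq]
  exact lipschitz_of_hasWeakDeriv hsub (hf.mono hsub) hw ENNReal.toReal_nonneg hM
    ⟨haa'.trans_le hx.1, hx.2.trans_lt hbb'⟩ ⟨haa'.trans_le hy.1, hy.2.trans_lt hbb'⟩

/-- The analytic properties of a unit-speed curve with bounded curvature. -/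
structure IsRegularCurve (I : Set ℝ) (Γ : ℝ → ℝ × ℝ) (K : ℝ) : Prop where
  isOpen : IsOpen I
  ordConnected : I.OrdConnected
  nonneg : 0 ≤ K
  hasDerivAt_fst : ∀ s ∈ I, HasDerivAt (fun r => (Γ r).1) (tangent Γ s).1 s
  hasDerivAt_snd : ∀ s ∈ I, HasDerivAt (fun r => (Γ r).2) (tangent Γ s).2 s
  unit : ∀ s ∈ I, (tangent Γ s).1 ^ 2 + (tangent Γ s).2 ^ 2 = 1
  lipschitz_fst : ∀ s ∈ I, ∀ r ∈ I, |(tangent Γ s).1 - (tangent Γ r).1| ≤ K * |s - r|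
  lipschitz_snd : ∀ s ∈ I, ∀ r ∈ I, |(tangent Γ s).2 - (tangent Γ r).2| ≤ K * |s - r|
  frenet : ∀ᵐ s ∂volume.restrict I,
    HasDerivAt (fun r => (tangent Γ r).1) (-(curvature I Γ s * (tangent Γ s).2)) s ∧
    HasDerivAt (fun r => (tangent Γ r).2) (curvature I Γ s * (tangent Γ s).1) s
  measurable_curvature : Measurable (curvature I Γ)
  curvature_le : ∀ s, |curvature I Γ s| ≤ K

theorem measurable_curvature' {I : Set ℝ} (hI : IsOpen I) (Γ : ℝ → ℝ × ℝ) :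
    Measurable (curvature I Γ) := by
  have m1 : Measurable fun s => (tangent Γ s).1 := measurable_deriv _
  have m2 : Measurable fun s => (tangent Γ s).2 := measurable_deriv _
  have m3 : Measurable fun s => deriv (fun r => (tangent Γ r).1) s := measurable_deriv _
  have m4 : Measurable fun s => deriv (fun r => (tangent Γ r).2) s := measurable_deriv _
  exact ((m3.mul m2.neg).add (m4.mul m1)).indicator hI.measurableSet

theorem ae_differentiableAt_of_lipschitzOn_Icc {I : Set ℝ} (hI : IsOpen I) {f : ℝ → ℝ}
    (h : ∀ a ∈ I, ∀ b ∈ I, ∃ C, LipschitzOnWith C f (Icc a b)) :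
    ∀ᵐ s ∂volume.restrict I, DifferentiableAt ℝ f s := by
  rw [ae_restrict_iff' hI.measurableSet]
  refine ae_of_mem_of_ae_of_mem_inter_Ioo fun a b ha hb _ => ?_
  obtain ⟨C, hC⟩ := h a ha b hb
  filter_upwards [hC.ae_differentiableWithinAt_of_mem (μ := volume)] with s hs hsI
  exact (hs (Ioo_subset_Icc_self hsI.2)).differentiableAt (Icc_mem_nhds hsI.2.1 hsI.2.2)

/-- Lipschitz functions on compact intervals are absolutely continuous, so an almost everywhere
bound on the derivative replaces the local constants by one global constant. -/
theorem abs_sub_le_of_deriv_le {I : Set ℝ} (hI' : I.OrdConnected) {f : ℝ → ℝ}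
    (h : ∀ a ∈ I, ∀ b ∈ I, ∃ C, LipschitzOnWith C f (Icc a b)) {K : ℝ}
    (hK : ∀ᵐ s ∂volume.restrict I, |deriv f s| ≤ K) {s r : ℝ} (hs : s ∈ I) (hr : r ∈ I) :
    |f s - f r| ≤ K * |s - r| := by
  wlog hle : r ≤ s generalizing s r with H
  · rw [abs_sub_comm, abs_sub_comm s]
    exact H hr hs (le_of_not_ge hle)
  obtain ⟨C, hC⟩ := h r hr s hs
  rw [← uIcc_of_le hle] at hC
  rw [← hC.absolutelyContinuousOnInterval.integral_deriv_eq_sub, ← Real.norm_eq_abs]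
  refine intervalIntegral.norm_integral_le_of_norm_le_const_ae ?_
  have : ∀ᵐ x ∂volume.restrict (uIoc r s), |deriv f x| ≤ K := by
    refine ae_restrict_of_ae_restrict_of_subset ?_ hK
    rw [uIoc_of_le hle]
    exact Ioc_subset_Icc_self.trans (hI'.out hr hs)
  exact (ae_restrict_iff' measurableSet_uIoc).1 this

/-- The tangent is locally Lipschitz, and differentiating |T|² = 1 shows that Ṫ is normal to T,
which gives Ṫ = κN almost everywhere. The essential bound on κ then makes T globally Lipschitz. -/
theorem exists_isRegularCurve {I : Set ℝ} (hI : IsOpen I) (hI' : I.OrdConnected) {Γ : ℝ → ℝ × ℝ}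
    (hΓ : ContDiffOn ℝ 1 Γ I)
    (hu : ∀ s ∈ I, (tangent Γ s).1 ^ 2 + (tangent Γ s).2 ^ 2 = 1)
    (hW : MemW2InftyLoc I (fun s => (Γ s).1) ∧ MemW2InftyLoc I (fun s => (Γ s).2))
    (hκ : MemLp (curvature I Γ) ⊤ (volume.restrict I)) : ∃ K, IsRegularCurve I Γ K := by
  have c1 : ContDiffOn ℝ 1 (fun s => (Γ s).1) I := hΓ.fst
  have c2 : ContDiffOn ℝ 1 (fun s => (Γ s).2) I := hΓ.snd
  have d1 : ∀ s ∈ I, HasDerivAt (fun r => (Γ r).1) (deriv (fun r => (Γ r).1) s) s := fun s hs =>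
    ((c1.contDiffAt (hI.mem_nhds hs)).differentiableAt (by simp)).hasDerivAt
  have d2 : ∀ s ∈ I, HasDerivAt (fun r => (Γ r).2) (deriv (fun r => (Γ r).2) s) s := fun s hs =>
    ((c2.contDiffAt (hI.mem_nhds hs)).differentiableAt (by simp)).hasDerivAt
  have e1 : ContinuousOn (deriv fun r => (Γ r).1) I := c1.continuousOn_deriv_of_isOpen hI le_rfl
  have e2 : ContinuousOn (deriv fun r => (Γ r).2) I := c2.continuousOn_deriv_of_isOpen hI le_rfl
  obtain ⟨g1, w1, b1⟩ := exists_weakDeriv_deriv hI d1 e1 hW.1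
  obtain ⟨g2, w2, b2⟩ := exists_weakDeriv_deriv hI d2 e2 hW.2
  have l1 : ∀ a ∈ I, ∀ b ∈ I, ∃ C, LipschitzOnWith C (fun r => (tangent Γ r).1) (Icc a b) :=
    fun a ha b hb => exists_lipschitzOnWith_Icc hI hI' e1 w1 b1 ha hb
  have l2 : ∀ a ∈ I, ∀ b ∈ I, ∃ C, LipschitzOnWith C (fun r => (tangent Γ r).2) (Icc a b) :=
    fun a ha b hb => exists_lipschitzOnWith_Icc hI hI' e2 w2 b2 ha hb
  have hfrenet : ∀ᵐ s ∂volume.restrict I,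
      HasDerivAt (fun r => (tangent Γ r).1) (-(curvature I Γ s * (tangent Γ s).2)) s ∧
      HasDerivAt (fun r => (tangent Γ r).2) (curvature I Γ s * (tangent Γ s).1) s := by
    filter_upwards [ae_differentiableAt_of_lipschitzOn_Icc hI l1,
      ae_differentiableAt_of_lipschitzOn_Icc hI l2, ae_restrict_mem hI.measurableSet]
      with s h1 h2 hs
    have h3 : HasDerivAt (fun r => (tangent Γ r).1 ^ 2 + (tangent Γ r).2 ^ 2)
        (2 * (tangent Γ s).1 * deriv (fun r => (tangent Γ r).1) s +
          2 * (tangent Γ s).2 * deriv (fun r => (tangent Γ r).2) s) s := by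
      refine ((h1.hasDerivAt.pow 2).add (h2.hasDerivAt.pow 2)).congr_deriv ?_
      simp
    have h4 : HasDerivAt (fun r => (tangent Γ r).1 ^ 2 + (tangent Γ r).2 ^ 2) 0 s := by
      refine (hasDerivAt_const s (1 : ℝ)).congr_of_eventuallyEq ?_
      filter_upwards [hI.mem_nhds hs] with r hr using hu r hr
    have h5 := h3.unique h4
    have h6 := hu s hs
    have hcurv : curvature I Γ s = deriv (fun r => (tangent Γ r).1) s * -(tangent Γ s).2 +
        deriv (fun r => (tangent Γ r).2) s * (tangent Γ s).1 := by
      rw [curvature, indicator_of_mem hs]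
      rfl
    set T1 := (tangent Γ s).1
    set T2 := (tangent Γ s).2
    set D1 := deriv (fun r => (tangent Γ r).1) s
    set D2 := deriv (fun r => (tangent Γ r).2) s
    constructor
    · refine h1.hasDerivAt.congr_deriv ?_
      rw [hcurv]
      linear_combination -D1 * h6 + T1 / 2 * h5
    · refine h2.hasDerivAt.congr_deriv ?_
      rw [hcurv]
      linear_combination -D2 * h6 + T2 / 2 * h5
  set K := (eLpNorm (curvature I Γ) ⊤ (volume.restrict I)).toReal
  have hKae : ∀ᵐ s ∂volume.restrict I, |curvature I Γ s| ≤ K := by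
    filter_upwards [ae_le_eLpNormEssSup (f := curvature I Γ) (μ := volume.restrict I)] with s hs
    rw [← Real.norm_eq_abs, ← toReal_enorm]
    rw [← eLpNorm_exponent_top] at hs
    exact ENNReal.toReal_mono hκ.2.ne hs
  have hK0 : 0 ≤ K := ENNReal.toReal_nonneg
  have hT1 : ∀ s ∈ I, |(tangent Γ s).1| ≤ 1 := fun s hs =>
    abs_le_of_sq_le_sq (by nlinarith [hu s hs, sq_nonneg (tangent Γ s).2]) zero_le_one
  have hT2 : ∀ s ∈ I, |(tangent Γ s).2| ≤ 1 := fun s hs =>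
    abs_le_of_sq_le_sq (by nlinarith [hu s hs, sq_nonneg (tangent Γ s).1]) zero_le_one
  have k1 : ∀ᵐ s ∂volume.restrict I, |deriv (fun r => (tangent Γ r).1) s| ≤ K := by
    filter_upwards [hfrenet, hKae, ae_restrict_mem hI.measurableSet] with s h1 h2 hs
    rw [h1.1.deriv, abs_neg, abs_mul]
    exact (mul_le_of_le_one_right (abs_nonneg _) (hT2 s hs)).trans h2
  have k2 : ∀ᵐ s ∂volume.restrict I, |deriv (fun r => (tangent Γ r).2) s| ≤ K := by
    filter_upwards [hfrenet, hKae, ae_restrict_mem hI.measurableSet] with s h1 h2 hs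
    rw [h1.2.deriv, abs_mul]
    exact (mul_le_of_le_one_right (abs_nonneg _) (hT1 s hs)).trans h2
  have m1 : ∀ s ∈ I, ∀ r ∈ I, |(tangent Γ s).1 - (tangent Γ r).1| ≤ K * |s - r| :=
    fun s hs r hr => abs_sub_le_of_deriv_le hI' l1 k1 hs hr
  have m2 : ∀ s ∈ I, ∀ r ∈ I, |(tangent Γ s).2 - (tangent Γ r).2| ≤ K * |s - r| :=
    fun s hs r hr => abs_sub_le_of_deriv_le hI' l2 k2 hs hr
  have dle : ∀ {f : ℝ → ℝ}, (∀ s ∈ I, ∀ r ∈ I, |f s - f r| ≤ K * |s - r|) → ∀ s ∈ I,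
      |deriv f s| ≤ K := by
    intro f hf s hs
    refine norm_deriv_le_of_lip' (𝕜 := ℝ) (f := f) (x₀ := s) hK0 ?_
    filter_upwards [hI.mem_nhds hs] with r hr using hf r hr s hs
  -- The curvature bound is wanted at every point, not almost everywhere. `deriv` of either
  -- component of T is bounded by K throughout I, and the formula for κ adds two such terms.
  have hKK : K ≤ 2 * K := by linarith
  refine ⟨2 * K, hI, hI', by positivity, d1, d2, hu,
    fun s hs r hr => (m1 s hs r hr).trans (by gcongr),
    fun s hs r hr => (m2 s hs r hr).trans (by gcongr), hfrenet, measurable_curvature' hI Γ,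
    fun s => ?_⟩
  by_cases hs : s ∈ I
  · rw [curvature, indicator_of_mem hs]
    change |deriv (fun r => (tangent Γ r).1) s * -(tangent Γ s).2 +
        deriv (fun r => (tangent Γ r).2) s * (tangent Γ s).1| ≤ 2 * K
    refine (abs_add_le _ _).trans ?_
    rw [abs_mul, abs_mul, abs_neg]
    have q1 := mul_le_mul (dle m1 s hs) (hT2 s hs) (abs_nonneg _) hK0
    have q2 := mul_le_mul (dle m2 s hs) (hT1 s hs) (abs_nonneg _) hK0
    linarith
  · rw [curvature, indicator_of_notMem hs, abs_zero]
    positivity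

end Curve

/-! ### Geometry of the strip map -/

section Frame

/-- The linear map `(a, b) ↦ a α T + b β N`, where `N` is the vector `T` rotated by a right angle. -/
def frameMap (T : ℝ × ℝ) (α β : ℝ) : ℝ × ℝ →L[ℝ] ℝ × ℝ :=
  LinearMap.toContinuousLinearMap (Matrix.toLin (Module.Basis.finTwoProd ℝ)
    (Module.Basis.finTwoProd ℝ) !![α * T.1, -(β * T.2); α * T.2, β * T.1])

theorem frameMap_apply (T : ℝ × ℝ) (α β : ℝ) (x : ℝ × ℝ) :
    frameMap T α β x =
      (α * T.1 * x.1 + -(β * T.2) * x.2, α * T.2 * x.1 + β * T.1 * x.2) :=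
  Matrix.toLin_finTwoProd_apply _ _ _ _ x

theorem frameMap_det {T : ℝ × ℝ} (hT : T.1 ^ 2 + T.2 ^ 2 = 1) (α β : ℝ) :
    (frameMap T α β).det = α * β := by
  rw [frameMap, LinearMap.det_toContinuousLinearMap, LinearMap.det_toLin, Matrix.det_fin_two_of]
  linear_combination α * β * hT

/-- The inverse of `frameMap`. -/
def frameInv (T : ℝ × ℝ) (α β : ℝ) : ℝ × ℝ →L[ℝ] ℝ × ℝ :=
  LinearMap.toContinuousLinearMap (Matrix.toLin (Module.Basis.finTwoProd ℝ)
    (Module.Basis.finTwoProd ℝ) !![α⁻¹ * T.1, α⁻¹ * T.2; -(β⁻¹ * T.2), β⁻¹ * T.1])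

theorem frameInv_apply (T : ℝ × ℝ) (α β : ℝ) (x : ℝ × ℝ) :
    frameInv T α β x =
      (α⁻¹ * T.1 * x.1 + α⁻¹ * T.2 * x.2, -(β⁻¹ * T.2) * x.1 + β⁻¹ * T.1 * x.2) :=
  Matrix.toLin_finTwoProd_apply _ _ _ _ x

/-- `frameMap` as an equivalence. -/
def frameEquiv {T : ℝ × ℝ} (hT : T.1 ^ 2 + T.2 ^ 2 = 1) {α β : ℝ} (hα : α ≠ 0) (hβ : β ≠ 0) :
    (ℝ × ℝ) ≃L[ℝ] (ℝ × ℝ) :=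
  ContinuousLinearEquiv.equivOfInverse (frameMap T α β) (frameInv T α β)
    (fun x => by
      rw [frameInv_apply, frameMap_apply]
      ext
      · simp only
        field_simp
        linear_combination α * x.1 * hT
      · simp only
        field_simp
        linear_combination β * x.2 * hT)
    (fun x => by
      rw [frameInv_apply, frameMap_apply]
      ext
      · simp only
        field_simp
        linear_combination x.1 * hT
      · simp only
        field_simp
        linear_combination x.2 * hT)

theorem abs_fst_le_one {T : ℝ × ℝ} (hT : T.1 ^ 2 + T.2 ^ 2 = 1) : |T.1| ≤ 1 :=
  abs_le_of_sq_le_sq (by nlinarith [sq_nonneg T.2]) zero_le_one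

theorem abs_snd_le_one {T : ℝ × ℝ} (hT : T.1 ^ 2 + T.2 ^ 2 = 1) : |T.2| ≤ 1 :=
  abs_le_of_sq_le_sq (by nlinarith [sq_nonneg T.1]) zero_le_one

theorem norm_frameInv_le {T : ℝ × ℝ} (hT : T.1 ^ 2 + T.2 ^ 2 = 1) : ‖frameInv T 1 1‖ ≤ 2 := by
  refine ContinuousLinearMap.opNorm_le_bound _ (by norm_num) fun x => ?_
  have h1 := abs_fst_le_one hT
  have h2 := abs_snd_le_one hT
  have x1 : |x.1| ≤ ‖x‖ := norm_fst_le x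
  have x2 : |x.2| ≤ ‖x‖ := norm_snd_le x
  have key : ∀ a b : ℝ, |a| ≤ 1 → |b| ≤ 1 → |a * x.1 + b * x.2| ≤ 2 * ‖x‖ := by
    intro a b ha hb
    refine (abs_add_le _ _).trans ?_
    rw [abs_mul, abs_mul]
    have := mul_le_mul ha x1 (abs_nonneg _) zero_le_one
    have := mul_le_mul hb x2 (abs_nonneg _) zero_le_one
    linarith
  rw [frameInv_apply, Prod.norm_def]
  simp only [inv_one, one_mul]
  exact max_le (key _ _ h1 h2) (key _ _ (by rwa [abs_neg]) h1)

end Frame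

/-- Lebesgue measure of the plane is two-dimensional Hausdorff measure, which Lipschitz maps enlarge
by at most a constant. -/
theorem volume_image_eq_zero_of_lipschitzOnWith {f : ℝ × ℝ → ℝ × ℝ} {s : Set (ℝ × ℝ)} {C : NNReal}
    (hf : LipschitzOnWith C f s) (hs : volume s = 0) : volume (f '' s) = 0 := by
  rw [← hausdorffMeasure_prod_real] at hs ⊢
  have := hf.hausdorffMeasure_image_le (d := 2) (by norm_num)
  rw [hs, mul_zero] at this
  exact le_antisymm this zero_le

/-! ### The strip map and its local inverse -/

section StripMap

variable {I : Set ℝ} {Γ : ℝ → ℝ × ℝ} {K ε : ℝ}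

theorem stripMap_fst (Γ : ℝ → ℝ × ℝ) (ε : ℝ) (p : ℝ × ℝ) :
    (stripMap Γ ε p).1 = (Γ p.1).1 - ε * p.2 * (tangent Γ p.1).2 := by
  simp [stripMap, normal, sub_eq_add_neg]

theorem stripMap_snd (Γ : ℝ → ℝ × ℝ) (ε : ℝ) (p : ℝ × ℝ) :
    (stripMap Γ ε p).2 = (Γ p.1).2 + ε * p.2 * (tangent Γ p.1).1 := by
  simp [stripMap, normal]

/-- In the unscaled normal coordinate u = εt the differential on the centre line is a rotation, so
the inversion estimates are uniform in ε. -/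
theorem stripMap_eq_one (Γ : ℝ → ℝ × ℝ) (ε : ℝ) (p : ℝ × ℝ) :
    stripMap Γ ε p = stripMap Γ 1 (p.1, ε * p.2) := by
  simp [stripMap]

/-- The mean value inequality for γ minus its linear part at s₀, whose derivative is at most Kρ near
s₀. -/
theorem abs_sub_sub_deriv_mul_le (hI : I.OrdConnected) {γ γ' : ℝ → ℝ}
    (hγ : ∀ s ∈ I, HasDerivAt γ (γ' s) s) (hl : ∀ s ∈ I, ∀ r ∈ I, |γ' s - γ' r| ≤ K * |s - r|)
    (hK : 0 ≤ K) {s₀ ρ s r : ℝ} (h₀ : s₀ ∈ I) (hs : s ∈ I) (hr : r ∈ I) (hs' : |s - s₀| ≤ ρ)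
    (hr' : |r - s₀| ≤ ρ) : |γ s - γ r - γ' s₀ * (s - r)| ≤ K * ρ * |s - r| := by
  have hconv : Convex ℝ (I ∩ Metric.closedBall s₀ ρ) :=
    hI.convex.inter (convex_closedBall s₀ ρ)
  have hd : ∀ x ∈ I ∩ Metric.closedBall s₀ ρ, HasDerivWithinAt (fun x => γ x - γ' s₀ * x)
      (γ' x - γ' s₀) (I ∩ Metric.closedBall s₀ ρ) x := fun x hx =>
    ((hγ x hx.1).sub ((hasDerivAt_id x).const_mul (γ' s₀))).hasDerivWithinAt.congr_deriv (by simp)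
  have := hconv.norm_image_sub_le_of_norm_hasDerivWithin_le hd (C := K * ρ) (fun x hx => by
    refine (hl x hx.1 s₀ h₀).trans ?_
    have : |x - s₀| ≤ ρ := hx.2
    gcongr) (x := r) (y := s) ⟨hr, hr'⟩ ⟨hs, hs'⟩
  rw [Real.norm_eq_abs, Real.norm_eq_abs] at this
  calc _ = _ := by congr 1; ring
    _ ≤ _ := this

/-- The deviation of the curve from its tangent line and the turning of the normal contribute Kρ ≤
1/20 each, and the factor |u| < ε on the variation of the normal contributes εK ≤ 1/10. -/
theorem IsRegularCurve.approximatesLinearOn (hΓ : IsRegularCurve I Γ K) {s₀ ρ : ℝ} (h₀ : s₀ ∈ I)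
    (hρ : 2 * K * ρ ≤ 1 / 10) (hε : 0 ≤ ε) (hεK : ε * K ≤ 1 / 10) :
    ApproximatesLinearOn (stripMap Γ 1) (frameMap (tangent Γ s₀) 1 1)
      {p | p.1 ∈ I ∧ |p.1 - s₀| < ρ ∧ |p.2| < ε} (1 / 5) := by
  rintro ⟨s, u⟩ ⟨hs, hs', hu⟩ ⟨r, v⟩ ⟨hr, hr', hv⟩
  simp only at hs hs' hu hr hr' hv
  have hK := hΓ.nonneg
  have n1 : |s - r| ≤ ‖((s, u) : ℝ × ℝ) - (r, v)‖ := norm_fst_le (((s, u) : ℝ × ℝ) - (r, v))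
  have n2 : |u - v| ≤ ‖((s, u) : ℝ × ℝ) - (r, v)‖ := norm_snd_le (((s, u) : ℝ × ℝ) - (r, v))
  set n := ‖((s, u) : ℝ × ℝ) - (r, v)‖ with hn
  have hn0 : 0 ≤ n := norm_nonneg _
  have key : ∀ {γ γ' ν : ℝ → ℝ}, (∀ s ∈ I, HasDerivAt γ (γ' s) s) →
      (∀ s ∈ I, ∀ r ∈ I, |γ' s - γ' r| ≤ K * |s - r|) →
      (∀ s ∈ I, ∀ r ∈ I, |ν s - ν r| ≤ K * |s - r|) →
      |(γ s + u * ν s) - (γ r + v * ν r) - (γ' s₀ * (s - r) + ν s₀ * (u - v))| ≤ 1 / 5 * n := by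
    intro γ γ' ν hγ hγ' hν
    have e : (γ s + u * ν s) - (γ r + v * ν r) - (γ' s₀ * (s - r) + ν s₀ * (u - v)) =
        (γ s - γ r - γ' s₀ * (s - r)) + u * (ν s - ν r) + (u - v) * (ν r - ν s₀) := by ring
    rw [e]
    refine (abs_add_le _ _).trans ((add_le_add_left (abs_add_le _ _) _).trans ?_)
    rw [abs_mul, abs_mul]
    have a1 := abs_sub_sub_deriv_mul_le hΓ.ordConnected hγ hγ' hK h₀ hs hr hs'.le hr'.le
    have a2 : |u| * |ν s - ν r| ≤ 1 / 10 * n := by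
      have : |u| * |ν s - ν r| ≤ ε * (K * |s - r|) :=
        mul_le_mul hu.le (hν s hs r hr) (abs_nonneg _) hε
      nlinarith [mul_nonneg hε hK]
    have hρ0 : 0 ≤ ρ := (abs_nonneg _).trans hs'.le
    have a3 : |u - v| * |ν r - ν s₀| ≤ K * ρ * n := by
      have : |u - v| * |ν r - ν s₀| ≤ n * (K * ρ) := by
        refine mul_le_mul n2 ((hν r hr s₀ h₀).trans ?_) (abs_nonneg _) hn0
        gcongr
      linarith
    have a4 : K * ρ * |s - r| ≤ K * ρ * n := by gcongr
    nlinarith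
  have k1 := key hΓ.hasDerivAt_fst hΓ.lipschitz_fst (ν := fun s => -(tangent Γ s).2) fun s hs r hr => by
    have := hΓ.lipschitz_snd s hs r hr
    rwa [← abs_neg, show -(-(tangent Γ s).2 - -(tangent Γ r).2) = (tangent Γ s).2 - (tangent Γ r).2 by
      ring]
  have k2 := key hΓ.hasDerivAt_snd hΓ.lipschitz_snd (ν := fun s => (tangent Γ s).1)
    hΓ.lipschitz_fst
  rw [show ((1 / 5 : NNReal) : ℝ) = 1 / 5 by norm_num]
  rw [Prod.norm_def]
  refine max_le ?_ ?_
  · refine le_trans (le_of_eq ?_) k1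
    rw [Real.norm_eq_abs]
    congr 1
    simp only [Prod.fst_sub, Prod.mk_sub_mk, stripMap_fst, frameMap_apply]
    ring
  · refine le_trans (le_of_eq ?_) k2
    rw [Real.norm_eq_abs]
    congr 1
    simp only [Prod.snd_sub, Prod.mk_sub_mk, stripMap_snd, frameMap_apply]
    ring

theorem IsRegularCurve.lipschitzOnWith_stripMap (hΓ : IsRegularCurve I Γ K) (hε : 0 ≤ ε) :
    LipschitzOnWith (Real.toNNReal (1 + ε * K + ε)) (stripMap Γ ε) (straightStrip I) := by
  have hK := hΓ.nonneg
  refine LipschitzOnWith.of_dist_le_mul ?_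
  rintro ⟨s, t⟩ ⟨hs, ht⟩ ⟨r, v⟩ ⟨hr, hv⟩
  simp only at hs ht hr hv
  have n1 : |s - r| ≤ dist ((s, t) : ℝ × ℝ) (r, v) := le_max_left _ _
  have n2 : |t - v| ≤ dist ((s, t) : ℝ × ℝ) (r, v) := le_max_right _ _
  set n := dist ((s, t) : ℝ × ℝ) (r, v)
  have hn0 : 0 ≤ n := dist_nonneg
  have ht' : |t| ≤ 1 := abs_le.2 ⟨ht.1.le, ht.2.le⟩
  have key : ∀ {γ γ' ν : ℝ → ℝ}, (∀ s ∈ I, HasDerivAt γ (γ' s) s) → (∀ s ∈ I, |γ' s| ≤ 1) →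
      (∀ s ∈ I, ∀ r ∈ I, |ν s - ν r| ≤ K * |s - r|) → (∀ s ∈ I, |ν s| ≤ 1) →
      |(γ s + ε * t * ν s) - (γ r + ε * v * ν r)| ≤ (1 + ε * K + ε) * n := by
    intro γ γ' ν hγ hγ' hν hν'
    have e : (γ s + ε * t * ν s) - (γ r + ε * v * ν r) =
        (γ s - γ r) + ε * (t * (ν s - ν r)) + ε * ((t - v) * ν r) := by ring
    rw [e]
    refine (abs_add_le _ _).trans ((add_le_add_left (abs_add_le _ _) _).trans ?_)
    rw [abs_mul, abs_mul, abs_mul, abs_mul, abs_of_nonneg hε]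
    have a1 : |γ s - γ r| ≤ 1 * |s - r| := hΓ.ordConnected.convex.norm_image_sub_le_of_norm_hasDerivWithin_le
      (fun x hx => (hγ x hx).hasDerivWithinAt) hγ' hr hs
    have a2 : |t| * |ν s - ν r| ≤ 1 * (K * n) :=
      mul_le_mul ht' ((hν s hs r hr).trans (by gcongr)) (abs_nonneg _) zero_le_one
    have a3 : |t - v| * |ν r| ≤ n * 1 := mul_le_mul n2 (hν' r hr) (abs_nonneg _) hn0
    nlinarith
  rw [Real.coe_toNNReal _ (by positivity), Prod.dist_eq]
  refine max_le ?_ ?_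
  · have k := key hΓ.hasDerivAt_fst (fun s hs => abs_fst_le_one (hΓ.unit s hs))
      (ν := fun s => -(tangent Γ s).2) (fun s hs r hr => by
        have := hΓ.lipschitz_snd s hs r hr
        rwa [← abs_neg,
          show -(-(tangent Γ s).2 - -(tangent Γ r).2) = (tangent Γ s).2 - (tangent Γ r).2 by ring])
      (fun s hs => by rw [abs_neg]; exact abs_snd_le_one (hΓ.unit s hs))
    refine le_trans (le_of_eq ?_) k
    rw [Real.dist_eq, stripMap_fst, stripMap_fst]
    congr 1
    ring
  · have k := key hΓ.hasDerivAt_snd (fun s hs => abs_snd_le_one (hΓ.unit s hs))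
      (ν := fun s => (tangent Γ s).1) hΓ.lipschitz_fst (fun s hs => abs_fst_le_one (hΓ.unit s hs))
    refine le_trans (le_of_eq ?_) k
    rw [Real.dist_eq, stripMap_snd, stripMap_snd]

/-- The inverse of the strip map. -/
def stripInv (I : Set ℝ) (Γ : ℝ → ℝ × ℝ) (ε : ℝ) : ℝ × ℝ → ℝ × ℝ :=
  Function.invFunOn (stripMap Γ ε) (straightStrip I)

theorem stripInv_mem {x : ℝ × ℝ} (hx : x ∈ curvedStrip I Γ ε) :
    stripInv I Γ ε x ∈ straightStrip I :=
  Function.invFunOn_mem hx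

theorem stripMap_stripInv {x : ℝ × ℝ} (hx : x ∈ curvedStrip I Γ ε) :
    stripMap Γ ε (stripInv I Γ ε x) = x :=
  Function.invFunOn_eq hx

theorem stripInv_stripMap (hinj : InjOn (stripMap Γ ε) (straightStrip I)) {p : ℝ × ℝ}
    (hp : p ∈ straightStrip I) : stripInv I Γ ε (stripMap Γ ε p) = p :=
  hinj.leftInvOn_invFunOn hp

theorem stripMap_mem {p : ℝ × ℝ} (hp : p ∈ straightStrip I) :
    stripMap Γ ε p ∈ curvedStrip I Γ ε :=
  mem_image_of_mem _ hp

/-- The inverse of the strip map is locally Lipschitz, and the curved strip is open. -/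
theorem IsRegularCurve.exists_lipschitzOnWith_stripInv (hΓ : IsRegularCurve I Γ K) (hε : 0 < ε)
    (hεK : ε * K ≤ 1 / 10) (hinj : InjOn (stripMap Γ ε) (straightStrip I)) {x : ℝ × ℝ}
    (hx : x ∈ curvedStrip I Γ ε) :
    ∃ V, IsOpen V ∧ x ∈ V ∧ V ⊆ curvedStrip I Γ ε ∧
      ∃ C, LipschitzOnWith C (stripInv I Γ ε) V := by
  obtain ⟨⟨s₀, t₀⟩, ⟨hs₀, ht₀⟩, rfl⟩ := hx
  simp only at hs₀ ht₀
  have hK := hΓ.nonneg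
  -- Small enough for 2Kρ ≤ 1/10; K + 1 covers the case K = 0.
  set ρ : ℝ := 1 / (20 * (K + 1)) with hρ
  have hρ0 : 0 < ρ := by positivity
  have hρK : 2 * K * ρ ≤ 1 / 10 := by
    rw [hρ]
    field_simp
    linarith
  set S : Set (ℝ × ℝ) := {p | p.1 ∈ I ∧ |p.1 - s₀| < ρ ∧ |p.2| < ε} with hS
  have hSo : IsOpen S := by
    have o1 : IsOpen {p : ℝ × ℝ | |p.1 - s₀| < ρ} := isOpen_lt (by fun_prop) continuous_const
    have o2 : IsOpen {p : ℝ × ℝ | |p.2| < ε} := isOpen_lt (by fun_prop) continuous_const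
    exact (hΓ.isOpen.preimage continuous_fst).inter (o1.inter o2)
  have hT := hΓ.unit s₀ hs₀
  have happ : ApproximatesLinearOn (stripMap Γ 1)
      (frameEquiv hT one_ne_zero one_ne_zero : ℝ × ℝ →L[ℝ] ℝ × ℝ) S (1 / 5) :=
    hΓ.approximatesLinearOn hs₀ hρK hε.le hεK
  -- The normal is only Lipschitz, so the map need not be C¹ and the quantitative inverse function
  -- theorem is used. The inverse of a rotation has norm at most 2 in the sup norm, and 1/5 < 1/2.
  have hc : Subsingleton (ℝ × ℝ) ∨ (1 / 5 : NNReal) <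
      ‖((frameEquiv hT one_ne_zero one_ne_zero).symm : ℝ × ℝ →L[ℝ] ℝ × ℝ)‖₊⁻¹ := by
    right
    have h2 : ‖((frameEquiv hT one_ne_zero one_ne_zero).symm : ℝ × ℝ →L[ℝ] ℝ × ℝ)‖₊ ≤ 2 :=
      norm_frameInv_le hT
    have hpos : 0 < ‖((frameEquiv hT one_ne_zero one_ne_zero).symm : ℝ × ℝ →L[ℝ] ℝ × ℝ)‖₊ :=
      ContinuousLinearEquiv.nnnorm_symm_pos _
    calc (1 / 5 : NNReal) < 2⁻¹ := by
          rw [one_div]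
          exact inv_strictAnti₀ (by norm_num) (by norm_num)
      _ ≤ _ := inv_anti₀ hpos h2
  have hanti := happ.antilipschitz hc
  have hopen : IsOpen (stripMap Γ 1 '' S) := (happ.toOpenPartialHomeomorph _ _ hc hSo).open_target
  have hinvS : ∀ p ∈ S, (p.1, ε⁻¹ * p.2) ∈ straightStrip I ∧
      stripMap Γ ε (p.1, ε⁻¹ * p.2) = stripMap Γ 1 p := by
    intro p hp
    refine ⟨⟨hp.1, ?_⟩, ?_⟩
    · have : |ε⁻¹ * p.2| < 1 := by
        rw [abs_mul, abs_of_pos (inv_pos.2 hε), inv_mul_lt_iff₀ hε, mul_one]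
        exact hp.2.2
      exact abs_lt.1 this
    · rw [stripMap_eq_one]
      simp [hε.ne']
  -- Global injectivity identifies the local inverse with `stripInv`.
  have hval : ∀ p ∈ S, stripInv I Γ ε (stripMap Γ 1 p) = (p.1, ε⁻¹ * p.2) := by
    intro p hp
    rw [← (hinvS p hp).2, stripInv_stripMap hinj (hinvS p hp).1]
  refine ⟨stripMap Γ 1 '' S, hopen, ?_, ?_, ?_⟩
  · rw [stripMap_eq_one]
    refine mem_image_of_mem _ ⟨hs₀, by simpa using hρ0, ?_⟩
    have : |t₀| < 1 := abs_lt.2 ht₀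
    simp only [abs_mul, abs_of_pos hε]
    nlinarith
  · rintro _ ⟨p, hp, rfl⟩
    rw [← (hinvS p hp).2]
    exact stripMap_mem (hinvS p hp).1
  · set A := (‖((frameEquiv hT one_ne_zero one_ne_zero).symm : ℝ × ℝ →L[ℝ] ℝ × ℝ)‖₊⁻¹ - 1 / 5)⁻¹
    refine ⟨Real.toNNReal ((1 + ε⁻¹) * A), LipschitzOnWith.of_dist_le_mul ?_⟩
    rintro _ ⟨p, hp, rfl⟩ _ ⟨q, hq, rfl⟩
    rw [hval p hp, hval q hq, Real.coe_toNNReal _ (by positivity)]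
    have h1 : dist p q ≤ A * dist (stripMap Γ 1 p) (stripMap Γ 1 q) :=
      hanti.le_mul_dist ⟨p, hp⟩ ⟨q, hq⟩
    have h2 : dist (p.1, ε⁻¹ * p.2) (q.1, ε⁻¹ * q.2) ≤ (1 + ε⁻¹) * dist p q := by
      have d1 : dist p.1 q.1 ≤ dist p q := le_max_left _ _
      have d2 : dist p.2 q.2 ≤ dist p q := le_max_right _ _
      have hi : 0 < ε⁻¹ := inv_pos.2 hε
      have hd : 0 ≤ dist p q := dist_nonneg
      rw [Prod.dist_eq]
      refine max_le (by simp only; nlinarith) ?_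
      have : dist (ε⁻¹ * p.2) (ε⁻¹ * q.2) = ε⁻¹ * dist p.2 q.2 := by
        rw [Real.dist_eq, Real.dist_eq, ← mul_sub, abs_mul, abs_of_pos hi]
      simp only [this]
      nlinarith
    calc _ ≤ _ := h2
      _ ≤ (1 + ε⁻¹) * (A * dist (stripMap Γ 1 p) (stripMap Γ 1 q)) := by gcongr
      _ = _ := by ring

theorem IsRegularCurve.isOpen_curvedStrip (hΓ : IsRegularCurve I Γ K) (hε : 0 < ε)
    (hεK : ε * K ≤ 1 / 10) (hinj : InjOn (stripMap Γ ε) (straightStrip I)) :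
    IsOpen (curvedStrip I Γ ε) := by
  rw [isOpen_iff_mem_nhds]
  intro x hx
  obtain ⟨V, hV, hxV, hVs, -⟩ := hΓ.exists_lipschitzOnWith_stripInv hε hεK hinj hx
  exact mem_of_superset (hV.mem_nhds hxV) hVs

theorem IsRegularCurve.continuousOn_stripInv (hΓ : IsRegularCurve I Γ K) (hε : 0 < ε)
    (hεK : ε * K ≤ 1 / 10) (hinj : InjOn (stripMap Γ ε) (straightStrip I)) :
    ContinuousOn (stripInv I Γ ε) (curvedStrip I Γ ε) := by
  intro x hx
  obtain ⟨V, hV, hxV, -, C, hC⟩ := hΓ.exists_lipschitzOnWith_stripInv hε hεK hinj hx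
  exact (hC.continuousOn.continuousAt (hV.mem_nhds hxV)).continuousWithinAt

theorem IsRegularCurve.jacobian_bounds (hΓ : IsRegularCurve I Γ K) (hε : 0 ≤ ε) {p : ℝ × ℝ} (hp : p.2 ∈ crossSection) :
    |jacobian I Γ ε p - 1| ≤ ε * K := by
  have h1 := hΓ.curvature_le p.1
  have h2 : |p.2| ≤ 1 := abs_le.2 ⟨hp.1.le, hp.2.le⟩
  rw [jacobian, show 1 - ε * curvature I Γ p.1 * p.2 - 1 = -(ε * (curvature I Γ p.1 * p.2)) by ring,
    abs_neg, abs_mul, abs_of_nonneg hε, abs_mul]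
  have := mul_le_mul h1 h2 (abs_nonneg _) hΓ.nonneg
  nlinarith

theorem IsRegularCurve.jacobian_pos (hΓ : IsRegularCurve I Γ K) (hε : 0 ≤ ε)
    (hεK : ε * K ≤ 1 / 10) {p : ℝ × ℝ} (hp : p.2 ∈ crossSection) : 0 < jacobian I Γ ε p := by
  have := (abs_le.1 (hΓ.jacobian_bounds hε hp)).1
  linarith

theorem IsRegularCurve.measurable_jacobian (hΓ : IsRegularCurve I Γ K) (ε : ℝ) :
    Measurable (jacobian I Γ ε) := by
  have := hΓ.measurable_curvature
  unfold jacobian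
  fun_prop

/-- The Frenet equations give ∂ₛℒ = hT and ∂ₜℒ = εN wherever T is differentiable. -/
theorem IsRegularCurve.ae_hasFDerivAt_stripMap (hΓ : IsRegularCurve I Γ K) (ε : ℝ) :
    ∀ᵐ p ∂volume.restrict (straightStrip I),
      HasFDerivAt (stripMap Γ ε) (frameMap (tangent Γ p.1) (jacobian I Γ ε p) ε) p := by
  filter_upwards [ae_strip_of_ae_fst hΓ.frenet, ae_strip_mem hΓ.isOpen.measurableSet] with p hp hpI
  obtain ⟨h1, h2⟩ := hp
  have hpI' : p.1 ∈ I := hpI.1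
  have hf : HasFDerivAt (Prod.fst : ℝ × ℝ → ℝ) (ContinuousLinearMap.fst ℝ ℝ ℝ) p := hasFDerivAt_fst
  have g1 := (hΓ.hasDerivAt_fst p.1 hpI').comp_hasFDerivAt p hf
  have g2 := (hΓ.hasDerivAt_snd p.1 hpI').comp_hasFDerivAt p hf
  have t1 := h1.comp_hasFDerivAt p hf
  have t2 := h2.comp_hasFDerivAt p hf
  have u : HasFDerivAt (fun q : ℝ × ℝ => ε * q.2) (ε • ContinuousLinearMap.snd ℝ ℝ ℝ) p :=
    hasFDerivAt_snd.const_mul ε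
  have key := (g1.sub (u.mul t2)).prodMk (g2.add (u.mul t1))
  refine (key.congr_fderiv ?_).congr_of_eventuallyEq (Eventually.of_forall fun q => ?_)
  · refine ContinuousLinearMap.ext fun x => ?_
    rw [frameMap_apply]
    ext
    · simp [jacobian]
      ring
    · simp [jacobian]
      ring
  · ext
    · rw [stripMap_fst]; rfl
    · rw [stripMap_snd]; rfl

end StripMap

/-! ### The unitary transform onto the straight strip -/

section Transform

variable {I : Set ℝ} {Γ : ℝ → ℝ × ℝ} {K ε : ℝ}

/-- The area formula wants differentiability at every point of the domain. The exceptional null set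
is removed first, and its image is null because the map is Lipschitz. -/
theorem IsRegularCurve.lintegral_curvedStrip (hΓ : IsRegularCurve I Γ K) (hε : 0 < ε)
    (hεK : ε * K ≤ 1 / 10) (hinj : InjOn (stripMap Γ ε) (straightStrip I)) (g : ℝ × ℝ → ℝ≥0∞) :
    ∫⁻ x in curvedStrip I Γ ε, g x =
      ∫⁻ p in straightStrip I, ENNReal.ofReal (ε * jacobian I Γ ε p) * g (stripMap Γ ε p) := by
  have hΩ : MeasurableSet (straightStrip I) := (straightStrip_isOpen hΓ.isOpen).measurableSet
  have hae := (ae_restrict_iff' hΩ).1 (hΓ.ae_hasFDerivAt_stripMap ε)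
  set L' : ℝ × ℝ → ℝ × ℝ →L[ℝ] ℝ × ℝ := fun p => frameMap (tangent Γ p.1) (jacobian I Γ ε p) ε
  set N := toMeasurable volume {p | ¬(p ∈ straightStrip I → HasFDerivAt (stripMap Γ ε) (L' p) p)}
  have hN0 : volume N = 0 := by rw [measure_toMeasurable]; exact hae
  have hNm : MeasurableSet N := measurableSet_toMeasurable _ _
  set D := straightStrip I \ N
  have hDm : MeasurableSet D := hΩ.diff hNm
  have hDs : D ⊆ straightStrip I := sdiff_subset
  have hD : ∀ p ∈ D, HasFDerivWithinAt (stripMap Γ ε) (L' p) D p := by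
    intro p hp
    have : p ∈ straightStrip I → HasFDerivAt (stripMap Γ ε) (L' p) p := by
      by_contra h
      exact hp.2 (subset_toMeasurable _ _ h)
    exact (this hp.1).hasFDerivWithinAt
  have hDae : D =ᵐ[volume] straightStrip I := sdiff_null_ae_eq_self hN0
  have hLae : stripMap Γ ε '' D =ᵐ[volume] curvedStrip I Γ ε := by
    refine (LE.le.eventuallyLE (image_mono hDs)).antisymm ?_
    rw [ae_le_set]
    have hnull : volume (stripMap Γ ε '' (straightStrip I ∩ N)) = 0 :=
      volume_image_eq_zero_of_lipschitzOnWith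
        ((hΓ.lipschitzOnWith_stripMap hε.le).mono inter_subset_left)
        (measure_mono_null inter_subset_right hN0)
    refine measure_mono_null ?_ hnull
    rintro _ ⟨⟨p, hp, rfl⟩, hx⟩
    refine ⟨p, ⟨hp, ?_⟩, rfl⟩
    by_contra hpN
    exact hx ⟨p, ⟨hp, hpN⟩, rfl⟩
  rw [← setLIntegral_congr hLae, ← setLIntegral_congr hDae,
    lintegral_image_eq_lintegral_abs_det_fderiv_mul volume hDm hD (hinj.mono hDs)]
  refine setLIntegral_congr_fun hDm fun p hp => ?_
  have hpos := hΓ.jacobian_pos hε.le hεK (hDs hp).2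
  simp only [L', frameMap_det (hΓ.unit p.1 (hDs hp).1), abs_of_pos (mul_pos hpos hε),
    mul_comm ε]

theorem IsRegularCurve.aemeasurable_stripMap (hΓ : IsRegularCurve I Γ K) (hε : 0 < ε) :
    AEMeasurable (stripMap Γ ε) (volume.restrict (straightStrip I)) :=
  (hΓ.lipschitzOnWith_stripMap hε.le).continuousOn.aemeasurable
    (straightStrip_isOpen hΓ.isOpen).measurableSet

/-- The change of variables, applied to the indicator of a null set, forces its preimage to be null
because the Jacobian is positive. -/
theorem IsRegularCurve.ae_comp_stripMap (hΓ : IsRegularCurve I Γ K) (hε : 0 < ε)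
    (hεK : ε * K ≤ 1 / 10) (hinj : InjOn (stripMap Γ ε) (straightStrip I)) {P : ℝ × ℝ → Prop}
    (hP : ∀ᵐ x ∂volume.restrict (curvedStrip I Γ ε), P x) :
    ∀ᵐ p ∂volume.restrict (straightStrip I), P (stripMap Γ ε p) := by
  set μ := volume.restrict (curvedStrip I Γ ε)
  set S := toMeasurable μ {x | ¬P x}
  have hS : MeasurableSet S := measurableSet_toMeasurable _ _
  have hS0 : μ S = 0 := by rw [measure_toMeasurable]; exact hP
  have h1 := hΓ.lintegral_curvedStrip hε hεK hinj (S.indicator 1)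
  rw [lintegral_indicator_one hS, hS0] at h1
  have hmeas : AEMeasurable (fun p => ENNReal.ofReal (ε * jacobian I Γ ε p) *
      S.indicator (1 : ℝ × ℝ → ℝ≥0∞) (stripMap Γ ε p)) (volume.restrict (straightStrip I)) := by
    refine AEMeasurable.mul ?_ ?_
    · exact ((hΓ.measurable_jacobian ε).const_mul ε).ennreal_ofReal.aemeasurable
    · exact (measurable_one.indicator hS).comp_aemeasurable (hΓ.aemeasurable_stripMap hε)
  have h2 := (lintegral_eq_zero_iff' hmeas).1 h1.symm
  filter_upwards [h2, ae_strip_mem hΓ.isOpen.measurableSet] with p hp hpI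
  by_contra hn
  have hpos : 0 < ε * jacobian I Γ ε p := mul_pos hε (hΓ.jacobian_pos hε.le hεK hpI.2)
  have hmem : stripMap Γ ε p ∈ S := subset_toMeasurable _ _ hn
  simp [indicator_of_mem hmem, hpos.not_ge] at hp

/-- The exceptional set in the curved strip is the Lipschitz image of one in the straight strip. -/
theorem IsRegularCurve.ae_comp_stripInv (hΓ : IsRegularCurve I Γ K) (hε : 0 < ε)
    (hεK : ε * K ≤ 1 / 10) (hinj : InjOn (stripMap Γ ε) (straightStrip I)) {P : ℝ × ℝ → Prop}
    (hP : ∀ᵐ p ∂volume.restrict (straightStrip I), P p) :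
    ∀ᵐ x ∂volume.restrict (curvedStrip I Γ ε), P (stripInv I Γ ε x) := by
  have hΩ : MeasurableSet (straightStrip I) := (straightStrip_isOpen hΓ.isOpen).measurableSet
  rw [ae_restrict_iff' (hΓ.isOpen_curvedStrip hε hεK hinj).measurableSet]
  rw [ae_restrict_iff' hΩ] at hP
  have h0 : volume (straightStrip I ∩ {p | ¬P p}) = 0 := by
    refine measure_mono_null ?_ (ae_iff.1 hP)
    rintro p ⟨h1, h2⟩ h
    exact h2 (h h1)
  refine measure_mono_null ?_ (volume_image_eq_zero_of_lipschitzOnWith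
    ((hΓ.lipschitzOnWith_stripMap hε.le).mono inter_subset_left) h0)
  intro x hx
  have hx' : ¬(x ∈ curvedStrip I Γ ε → P (stripInv I Γ ε x)) := hx
  push Not at hx'
  exact ⟨stripInv I Γ ε x, ⟨stripInv_mem hx'.1, hx'.2⟩, stripMap_stripInv hx'.1⟩

theorem aestronglyMeasurable_comp_of_ae {μ ν : Measure (ℝ × ℝ)} {f : ℝ × ℝ → ℂ}
    {Φ : ℝ × ℝ → ℝ × ℝ} (hf : AEStronglyMeasurable f ν) (hΦ : AEMeasurable Φ μ)
    (h : ∀ P : ℝ × ℝ → Prop, (∀ᵐ x ∂ν, P x) → ∀ᵐ p ∂μ, P (Φ p)) :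
    AEStronglyMeasurable (fun p => f (Φ p)) μ := by
  refine (hf.mono_ac ?_).comp_aemeasurable hΦ
  refine Measure.AbsolutelyContinuous.mk fun s hs h0 => ?_
  rw [Measure.map_apply_of_aemeasurable hΦ hs]
  have := h (fun x => x ∉ s) (by rw [ae_iff]; simpa using h0)
  rw [ae_iff] at this
  simpa only [not_not] using! this

theorem enorm_sqrt_mul_sq {a : ℝ} (ha : 0 ≤ a) (z : ℂ) :
    ‖(√a : ℂ) * z‖ₑ ^ (2 : ℝ) = ENNReal.ofReal a * ‖z‖ₑ ^ (2 : ℝ) := by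
  rw [enorm_mul, ENNReal.mul_rpow_of_nonneg _ _ (by norm_num)]
  congr 1
  rw [← ofReal_norm, ENNReal.ofReal_rpow_of_nonneg (norm_nonneg _) (by norm_num)]
  congr 1
  simp [abs_of_nonneg (Real.sqrt_nonneg a), Real.sq_sqrt ha]

theorem IsRegularCurve.eLpNorm_stripTransform (hΓ : IsRegularCurve I Γ K) (hε : 0 < ε)
    (hεK : ε * K ≤ 1 / 10) (hinj : InjOn (stripMap Γ ε) (straightStrip I)) (ψ : ℝ × ℝ → ℂ) :
    eLpNorm (fun p => (√(ε * jacobian I Γ ε p) : ℂ) * ψ (stripMap Γ ε p)) 2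
      (volume.restrict (straightStrip I)) = eLpNorm ψ 2 (volume.restrict (curvedStrip I Γ ε)) := by
  rw [eLpNorm_eq_lintegral_rpow_enorm_toReal (by norm_num) (by norm_num),
    eLpNorm_eq_lintegral_rpow_enorm_toReal (by norm_num) (by norm_num),
    hΓ.lintegral_curvedStrip hε hεK hinj]
  congr 1
  refine lintegral_congr_ae ?_
  filter_upwards [ae_strip_snd] with p hp
  have hpos : 0 < ε * jacobian I Γ ε p := mul_pos hε (hΓ.jacobian_pos hε.le hεK hp)
  rw [show (2 : ℝ≥0∞).toReal = (2 : ℝ) by norm_num, enorm_sqrt_mul_sq hpos.le]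

theorem IsRegularCurve.measurable_sqrt_jacobian (hΓ : IsRegularCurve I Γ K) (ε : ℝ) :
    Measurable fun p => (√(ε * jacobian I Γ ε p) : ℂ) :=
  Complex.measurable_ofReal.comp ((hΓ.measurable_jacobian ε).const_mul ε).sqrt

theorem IsRegularCurve.memLp_stripTransform (hΓ : IsRegularCurve I Γ K) (hε : 0 < ε)
    (hεK : ε * K ≤ 1 / 10) (hinj : InjOn (stripMap Γ ε) (straightStrip I))
    (ψ : L2 (curvedStrip I Γ ε)) :
    MemLp (fun p => (√(ε * jacobian I Γ ε p) : ℂ) * (ψ : ℝ × ℝ → ℂ) (stripMap Γ ε p)) 2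
      (volume.restrict (straightStrip I)) := by
  refine ⟨?_, ?_⟩
  · refine (hΓ.measurable_sqrt_jacobian ε).aestronglyMeasurable.mul ?_
    exact aestronglyMeasurable_comp_of_ae (Lp.aestronglyMeasurable ψ) (hΓ.aemeasurable_stripMap hε)
      fun P hP => hΓ.ae_comp_stripMap hε hεK hinj hP
  · rw [hΓ.eLpNorm_stripTransform hε hεK hinj]
    exact Lp.eLpNorm_lt_top ψ

/-- The change of variables gives an isometry. A preimage of `f` is obtained by dividing by √(εh)
and composing with the inverse map, and its norm is finite by the same isometry. -/
theorem IsRegularCurve.exists_isStripTransform (hΓ : IsRegularCurve I Γ K) (hε : 0 < ε)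
    (hεK : ε * K ≤ 1 / 10) (hinj : InjOn (stripMap Γ ε) (straightStrip I)) :
    ∃ U, IsStripTransform I Γ ε U := by
  let U₀ : L2 (curvedStrip I Γ ε) →ₗᵢ[ℂ] L2 (straightStrip I) :=
    { toFun := fun ψ => (hΓ.memLp_stripTransform hε hεK hinj ψ).toLp _
      map_add' := fun ψ χ => by
        rw [← MemLp.toLp_add]
        refine MemLp.toLp_congr _ _ ?_
        filter_upwards [hΓ.ae_comp_stripMap hε hεK hinj (Lp.coeFn_add ψ χ)] with p hp
        rw [hp]
        simp [mul_add]
      map_smul' := fun c ψ => by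
        rw [RingHom.id_apply, ← MemLp.toLp_const_smul]
        refine MemLp.toLp_congr _ _ ?_
        filter_upwards [hΓ.ae_comp_stripMap hε hεK hinj (Lp.coeFn_smul c ψ)] with p hp
        rw [hp]
        simp [mul_left_comm]
      norm_map' := fun ψ => by
        change ‖(hΓ.memLp_stripTransform hε hεK hinj ψ).toLp _‖ = _
        rw [Lp.norm_toLp, hΓ.eLpNorm_stripTransform hε hεK hinj]
        rfl }
  have hU₀ : ∀ ψ, U₀ ψ =ᵐ[volume.restrict (straightStrip I)] fun p =>
      (√(ε * jacobian I Γ ε p) : ℂ) * (ψ : ℝ × ℝ → ℂ) (stripMap Γ ε p) := fun ψ =>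
    (hΓ.memLp_stripTransform hε hεK hinj ψ).coeFn_toLp
  have hsurj : Function.Surjective U₀ := by
    intro f
    set f₁ : ℝ × ℝ → ℂ := fun p => (√(ε * jacobian I Γ ε p) : ℂ)⁻¹ * (f : ℝ × ℝ → ℂ) p
    have hcomp : ∀ᵐ p ∂volume.restrict (straightStrip I),
        (√(ε * jacobian I Γ ε p) : ℂ) * f₁ (stripInv I Γ ε (stripMap Γ ε p)) =
          (f : ℝ × ℝ → ℂ) p := by
      filter_upwards [ae_strip_mem hΓ.isOpen.measurableSet] with p hp
      have hpos : 0 < ε * jacobian I Γ ε p := mul_pos hε (hΓ.jacobian_pos hε.le hεK hp.2)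
      have hne : (√(ε * jacobian I Γ ε p) : ℂ) ≠ 0 :=
        Complex.ofReal_ne_zero.2 (Real.sqrt_pos.2 hpos).ne'
      rw [stripInv_stripMap hinj hp, mul_inv_cancel_left₀ hne]
    have hmem : MemLp (fun x => f₁ (stripInv I Γ ε x)) 2 (volume.restrict (curvedStrip I Γ ε)) := by
      refine ⟨?_, ?_⟩
      · refine aestronglyMeasurable_comp_of_ae (ν := volume.restrict (straightStrip I)) ?_
          ((hΓ.continuousOn_stripInv hε hεK hinj).aemeasurable
            (hΓ.isOpen_curvedStrip hε hεK hinj).measurableSet)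
          fun P hP => hΓ.ae_comp_stripInv hε hεK hinj hP
        exact (hΓ.measurable_sqrt_jacobian ε).inv.aestronglyMeasurable.mul
          (Lp.aestronglyMeasurable f)
      · rw [← hΓ.eLpNorm_stripTransform hε hεK hinj, eLpNorm_congr_ae hcomp]
        exact Lp.eLpNorm_lt_top f
    refine ⟨hmem.toLp _, Lp.ext ?_⟩
    filter_upwards [hU₀ (hmem.toLp _), hcomp,
      hΓ.ae_comp_stripMap hε hεK hinj hmem.coeFn_toLp] with p h1 h2 h3
    rw [h1, h3, h2]
  exact ⟨LinearIsometryEquiv.ofSurjective U₀ hsurj, hU₀⟩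

end Transform

/-! ### Transfer of Sobolev spaces -/

section Transfer

/-- The composition of a test function with a locally Lipschitz homeomorphism is in `W₀^{1,2}`. -/
theorem inSobolevZero_comp {e : Fin 2 → ℝ × ℝ} {Ω Ω' : Set (ℝ × ℝ)} (hΩ : IsOpen Ω)
    {Φ Ψ : ℝ × ℝ → ℝ × ℝ} (hΦ : ∀ x ∈ Ω, ∃ V ∈ 𝓝 x, ∃ C, LipschitzOnWith C Φ V)
    (hΨ : ContinuousOn Ψ Ω') (hΨm : MapsTo Ψ Ω' Ω)
    (hinv : ∀ x ∈ Ω, Ψ (Φ x) = x) {f : ℝ × ℝ → ℂ} (hf : f ∈ testFunctions Ω') :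
    InSobolevZero e Ω (fun x => f (Φ x)) fun i x => fderiv ℝ (fun x => f (Φ x)) x (e i) := by
  obtain ⟨hf1, hf2, hf3⟩ := hf
  set F : ℝ × ℝ → ℂ := Ω.indicator fun x => f (Φ x) with hF
  -- Continuity of the inverse makes the transported support compact in Ω. Hence local Lipschitz
  -- bounds on Φ suffice, and extension by zero is Lipschitz on the plane.
  have hK : IsCompact (Ψ '' tsupport f) := hf2.isCompact.image_of_continuousOn (hΨ.mono hf3)
  have hKs : Ψ '' tsupport f ⊆ Ω := (hΨm.mono_left hf3).image_subset
  have hsupp : Function.support F ⊆ Ψ '' tsupport f := by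
    intro x hx
    have hxΩ : x ∈ Ω := by
      by_contra h
      exact hx (indicator_of_notMem h _)
    refine ⟨Φ x, ?_, hinv x hxΩ⟩
    by_contra h
    refine hx ?_
    rw [hF, indicator_of_mem hxΩ, image_eq_zero_of_notMem_tsupport h]
  have htsupp : tsupport F ⊆ Ψ '' tsupport f := closure_minimal hsupp hK.isClosed
  have hFc : HasCompactSupport F := hK.of_isClosed_subset (isClosed_tsupport _) htsupp
  obtain ⟨Cf, hCf⟩ := (hf1.of_le (by simp) : ContDiff ℝ 1 f).lipschitzWith_of_hasCompactSupport hf2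
    one_ne_zero
  have hloc : LocallyLipschitz F := by
    intro x
    by_cases hx : x ∈ Ω
    · obtain ⟨V, hV, C, hC⟩ := hΦ x hx
      refine ⟨Cf * C, V ∩ Ω, inter_mem hV (hΩ.mem_nhds hx), ?_⟩
      have : LipschitzOnWith (Cf * C) (fun x => f (Φ x)) (V ∩ Ω) :=
        hCf.comp_lipschitzOnWith (hC.mono inter_subset_left)
      intro y hy z hz
      rw [hF, indicator_of_mem hy.2, indicator_of_mem hz.2]
      exact this hy hz
    · refine ⟨0, (tsupport F)ᶜ, (isClosed_tsupport F).isOpen_compl.mem_nhds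
        fun h => hx (hKs (htsupp h)), ?_⟩
      intro y hy z hz
      rw [image_eq_zero_of_notMem_tsupport hy, image_eq_zero_of_notMem_tsupport hz]
      simp
  obtain ⟨C, hC⟩ := exists_lipschitzWith_of_locallyLipschitz hloc hFc
  obtain ⟨p, hp, h1, h2⟩ := InSobolevZero.of_lipschitz_tsupport (e := e) hΩ hC hFc
    (htsupp.trans hKs)
  have hmem : ∀ᵐ x ∂volume.restrict Ω, x ∈ Ω := ae_restrict_mem hΩ.measurableSet
  refine ⟨p, hp, ?_, fun i => ?_⟩
  · filter_upwards [h1, hmem] with x hx hxΩ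
    rw [hx, hF, indicator_of_mem hxΩ]
  · filter_upwards [h2 i, hmem] with x hx hxΩ
    rw [hx]
    have : F =ᶠ[𝓝 x] fun x => f (Φ x) := by
      filter_upwards [hΩ.mem_nhds hxΩ] with y hy
      rw [hF, indicator_of_mem hy]
    rw [this.fderiv_eq]

end Transfer

/-! ### Multiplication by functions bounded on the strip -/

section StripMul

variable {I : Set ℝ} {b b' c : ℝ × ℝ → ℝ} {C C' D : ℝ}

/-- Multiplication by a real function in `L²(Ω₀)`. -/
abbrev stripMul (I : Set ℝ) (b : ℝ × ℝ → ℝ) : L2 (straightStrip I) →L[ℂ] L2 (straightStrip I) :=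
  mulL (straightStrip I) fun p => (b p : ℂ)

/-- The function `b` is measurable, and bounded by `C` on the straight strip. -/
def StripBdd (I : Set ℝ) (b : ℝ × ℝ → ℝ) (C : ℝ) : Prop :=
  Measurable b ∧ 0 ≤ C ∧ ∀ p ∈ straightStrip I, |b p| ≤ C

theorem StripBdd.essBdd (hb : StripBdd I b C) (hI : IsOpen I) :
    EssBdd (straightStrip I) (fun p => (b p : ℂ)) C := by
  refine ⟨(Complex.measurable_ofReal.comp hb.1).aestronglyMeasurable, hb.2.1, ?_⟩
  filter_upwards [ae_strip_mem hI.measurableSet] with p hp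
  simpa using hb.2.2 p hp

theorem StripBdd.mul (hb : StripBdd I b C) (hb' : StripBdd I b' C') :
    StripBdd I (fun p => b p * b' p) (C * C') :=
  ⟨hb.1.mul hb'.1, mul_nonneg hb.2.1 hb'.2.1, fun p hp => by
    rw [abs_mul]
    exact mul_le_mul (hb.2.2 p hp) (hb'.2.2 p hp) (abs_nonneg _) hb.2.1⟩

theorem stripMul_ae (hI : IsOpen I) (hb : StripBdd I b C) (ψ : L2 (straightStrip I)) :
    stripMul I b ψ =ᵐ[volume.restrict (straightStrip I)] fun p => (b p : ℂ) * ψ p :=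
  mulL_ae (hb.essBdd hI) ψ

theorem norm_stripMul_le (hI : IsOpen I) (hb : StripBdd I b C) (ψ : L2 (straightStrip I)) :
    ‖stripMul I b ψ‖ ≤ C * ‖ψ‖ :=
  norm_mulL_le (hb.essBdd hI) ψ

theorem inner_stripMul (hI : IsOpen I) (hb : StripBdd I b C) (ψ χ : L2 (straightStrip I)) :
    inner ℂ (stripMul I b ψ) χ = inner ℂ ψ (stripMul I b χ) :=
  inner_mulL_real (hb.essBdd hI) ψ χ

theorem stripMul_stripMul (hI : IsOpen I) (hb : StripBdd I b C) (hb' : StripBdd I b' C')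
    (h : ∀ p ∈ straightStrip I, b p * b' p = c p) (ψ : L2 (straightStrip I)) :
    stripMul I b (stripMul I b' ψ) = stripMul I c ψ := by
  rw [stripMul, stripMul, mulL_mulL (hb.essBdd hI) (hb'.essBdd hI)]
  refine mulL_congr ((hb.essBdd hI).mul (hb'.essBdd hI)) ?_ ψ
  filter_upwards [ae_strip_mem hI.measurableSet] with p hp
  rw [← h p hp]
  push_cast
  rfl

end StripMul

/-! ### Form domain and resolvent equation in straight coordinates -/

section Transfer

variable {I : Set ℝ} {Γ : ℝ → ℝ × ℝ} {K ε : ℝ}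

theorem IsRegularCurve.stripBdd_jacobian (hΓ : IsRegularCurve I Γ K) (hε : 0 ≤ ε)
    (hεK : ε * K ≤ 1 / 10) : StripBdd I (jacobian I Γ ε) 2 := by
  refine ⟨hΓ.measurable_jacobian ε, by norm_num, fun p hp => ?_⟩
  have := abs_le.1 (hΓ.jacobian_bounds hε hp.2)
  exact abs_le.2 ⟨by linarith, by linarith⟩

theorem IsRegularCurve.stripBdd_jacobian_inv (hΓ : IsRegularCurve I Γ K) (hε : 0 ≤ ε)
    (hεK : ε * K ≤ 1 / 10) : StripBdd I (fun p => (jacobian I Γ ε p)⁻¹) 2 := by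
  refine ⟨(hΓ.measurable_jacobian ε).inv, by norm_num, fun p hp => ?_⟩
  have := abs_le.1 (hΓ.jacobian_bounds hε hp.2)
  have hpos := hΓ.jacobian_pos hε hεK hp.2
  rw [abs_of_pos (inv_pos.2 hpos), inv_le_comm₀ hpos (by norm_num)]
  linarith

theorem IsRegularCurve.stripBdd_sqrt (hΓ : IsRegularCurve I Γ K) (hε : 0 ≤ ε)
    (hεK : ε * K ≤ 1 / 10) : StripBdd I (fun p => √(jacobian I Γ ε p)) 2 := by
  refine ⟨(hΓ.measurable_jacobian ε).sqrt, by norm_num, fun p hp => ?_⟩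
  have := abs_le.1 (hΓ.jacobian_bounds hε hp.2)
  rw [abs_of_nonneg (Real.sqrt_nonneg _), Real.sqrt_le_left (by norm_num)]
  linarith

theorem IsRegularCurve.stripBdd_sqrt_inv (hΓ : IsRegularCurve I Γ K) (hε : 0 ≤ ε)
    (hεK : ε * K ≤ 1 / 10) : StripBdd I (fun p => (√(jacobian I Γ ε p))⁻¹) 2 := by
  refine ⟨(hΓ.measurable_jacobian ε).sqrt.inv, by norm_num, fun p hp => ?_⟩
  have := abs_le.1 (hΓ.jacobian_bounds hε hp.2)
  have hpos := hΓ.jacobian_pos hε hεK hp.2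
  rw [abs_of_pos (inv_pos.2 (Real.sqrt_pos.2 hpos)),
    inv_le_comm₀ (Real.sqrt_pos.2 hpos) (by norm_num)]
  refine Real.le_sqrt_of_sq_le ?_
  linarith

theorem IsRegularCurve.stripBdd_tangent_fst (hΓ : IsRegularCurve I Γ K) :
    StripBdd I (fun p => (tangent Γ p.1).1) 1 :=
  ⟨(measurable_deriv fun r => (Γ r).1).comp measurable_fst, zero_le_one,
    fun p hp => abs_fst_le_one (hΓ.unit p.1 hp.1)⟩

theorem IsRegularCurve.stripBdd_tangent_snd (hΓ : IsRegularCurve I Γ K) :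
    StripBdd I (fun p => (tangent Γ p.1).2) 1 :=
  ⟨(measurable_deriv fun r => (Γ r).2).comp measurable_fst, zero_le_one,
    fun p hp => abs_snd_le_one (hΓ.unit p.1 hp.1)⟩

theorem clm_apply_pair (A : ℝ × ℝ →L[ℝ] ℂ) (x : ℝ × ℝ) :
    A x = (x.1 : ℂ) * A (1, 0) + (x.2 : ℂ) * A (0, 1) := by
  have : x = x.1 • (1, 0) + x.2 • (0, 1) := by ext <;> simp
  conv_lhs => rw [this, map_add, map_smul, map_smul]
  simp

/-- The gradient in the coordinates of the straight strip. -/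
def pullGrad (I : Set ℝ) (Γ : ℝ → ℝ × ℝ) (ε : ℝ) (g : Fin 2 → L2 (straightStrip I)) :
    Fin 2 → L2 (straightStrip I) :=
  ![stripMul I (fun p => √(jacobian I Γ ε p) * (tangent Γ p.1).1) (g 0) +
      stripMul I (fun p => √(jacobian I Γ ε p) * (tangent Γ p.1).2) (g 1),
    (ε : ℂ) • (stripMul I (fun p => (√(jacobian I Γ ε p))⁻¹ * (tangent Γ p.1).1) (g 1) -
      stripMul I (fun p => (√(jacobian I Γ ε p))⁻¹ * (tangent Γ p.1).2) (g 0))]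

/-- The inverse of `pullGrad`. -/
def pushGrad (I : Set ℝ) (Γ : ℝ → ℝ × ℝ) (ε : ℝ) (k : Fin 2 → L2 (straightStrip I)) :
    Fin 2 → L2 (straightStrip I) :=
  ![stripMul I (fun p => (√(jacobian I Γ ε p))⁻¹ * (tangent Γ p.1).1) (k 0) -
      (ε : ℂ)⁻¹ • stripMul I (fun p => √(jacobian I Γ ε p) * (tangent Γ p.1).2) (k 1),
    stripMul I (fun p => (√(jacobian I Γ ε p))⁻¹ * (tangent Γ p.1).2) (k 0) +
      (ε : ℂ)⁻¹ • stripMul I (fun p => √(jacobian I Γ ε p) * (tangent Γ p.1).1) (k 1)]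

/-- The function is u = √ε (ψ ∘ ℒ) = h^{-1/2} Uψ. By the chain rule ∂ₛu = √ε h T·∇ψ and ∂ₜu = √ε ε
N·∇ψ along ℒ; writing these with U∇ψ = √(εh) ∇ψ ∘ ℒ produces the factors √h and ε h^{-1/2}. -/
theorem pullGrad_mem_sobolevZero (hΓ : IsRegularCurve I Γ K) (hε : 0 < ε)
    (hεK : ε * K ≤ 1 / 10) (hinj : InjOn (stripMap Γ ε) (straightStrip I))
    {U : L2 (curvedStrip I Γ ε) ≃ₗᵢ[ℂ] L2 (straightStrip I)} (hU : IsStripTransform I Γ ε U)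
    {p : L2 (curvedStrip I Γ ε) × (Fin 2 → L2 (curvedStrip I Γ ε))}
    (hp : p ∈ sobolevZero axisPlane (curvedStrip I Γ ε)) :
    (stripMul I (fun p => (√(jacobian I Γ ε p))⁻¹) (U p.1), pullGrad I Γ ε fun i => U (p.2 i)) ∈
      sobolevZero axisPlane (straightStrip I) := by
  have hI := hΓ.isOpen
  have hs := hΓ.stripBdd_sqrt hε.le hεK
  have hsi := hΓ.stripBdd_sqrt_inv hε.le hεK
  have hT1 := hΓ.stripBdd_tangent_fst
  have hT2 := hΓ.stripBdd_tangent_snd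
  refine sobolevZero_induction (P := fun p => (stripMul I (fun p => (√(jacobian I Γ ε p))⁻¹) (U p.1),
    pullGrad I Γ ε fun i => U (p.2 i)) ∈ sobolevZero axisPlane (straightStrip I)) ?_ ?_ hp
  · refine (Submodule.isClosed_topologicalClosure _).preimage (Continuous.prodMk ?_ ?_)
    · fun_prop
    · refine continuous_pi fun i => ?_
      fin_cases i
      · simp only [pullGrad]
        fun_prop
      · simp only [pullGrad]
        fun_prop
  intro f hf q h1 h2
  have hf' : (√ε : ℂ) • f ∈ testFunctions (curvedStrip I Γ ε) :=
    Submodule.smul_mem _ _ hf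
  have hfd : Differentiable ℝ f := hf.1.differentiable (by simp)
  have hcomp := inSobolevZero_comp (e := axisPlane) (straightStrip_isOpen hI)
    (Φ := stripMap Γ ε) (fun x hx => ⟨straightStrip I, (straightStrip_isOpen hI).mem_nhds hx, _,
      hΓ.lipschitzOnWith_stripMap hε.le⟩) (hΓ.continuousOn_stripInv hε hεK hinj)
    (fun x hx => stripInv_mem hx) (fun x hx => stripInv_stripMap hinj hx) hf'
  have hsq : ∀ p ∈ straightStrip I, (√(ε * jacobian I Γ ε p) : ℂ) =
      (√ε : ℂ) * (√(jacobian I Γ ε p) : ℂ) ∧ (√(jacobian I Γ ε p) : ℂ) ≠ 0 ∧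
      (√(jacobian I Γ ε p) : ℂ) * (√(jacobian I Γ ε p) : ℂ) = (jacobian I Γ ε p : ℂ) := by
    intro p hp
    have hpos := hΓ.jacobian_pos hε.le hεK hp.2
    refine ⟨?_, Complex.ofReal_ne_zero.2 (Real.sqrt_pos.2 hpos).ne', ?_⟩
    · rw [Real.sqrt_mul hε.le]
      push_cast
      rfl
    · rw [← Complex.ofReal_mul, Real.mul_self_sqrt hpos.le]
  have hder : ∀ᵐ p ∂volume.restrict (straightStrip I), ∀ x,
      fderiv ℝ (fun p => ((√ε : ℂ) • f) (stripMap Γ ε p)) p x = (√ε : ℂ) *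
        fderiv ℝ f (stripMap Γ ε p) (frameMap (tangent Γ p.1) (jacobian I Γ ε p) ε x) := by
    filter_upwards [hΓ.ae_hasFDerivAt_stripMap ε] with p hp x
    have := ((hfd (stripMap Γ ε p)).hasFDerivAt.comp p hp).const_smul (√ε : ℂ)
    have e : (fun p => ((√ε : ℂ) • f) (stripMap Γ ε p)) = (√ε : ℂ) • (f ∘ stripMap Γ ε) := rfl
    rw [e, this.fderiv]
    rfl
  have ax0 : axisPlane 0 = (1, 0) := rfl
  have ax1 : axisPlane 1 = (0, 1) := rfl
  have u0 := hΓ.ae_comp_stripMap hε hεK hinj h1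
  have u1 := hΓ.ae_comp_stripMap hε hεK hinj (h2 0)
  have u2 := hΓ.ae_comp_stripMap hε hεK hinj (h2 1)
  refine hcomp.mem ?_ ?_
  · filter_upwards [stripMul_ae hI hsi (U q.1), hU q.1, u0, ae_strip_mem hI.measurableSet]
      with p a1 a2 a3 hp
    obtain ⟨s1, s2, -⟩ := hsq p hp
    rw [a1, a2, a3, s1]
    simp only [Pi.smul_apply, smul_eq_mul]
    push_cast
    field_simp
  · intro i
    fin_cases i
    · change (stripMul I (fun p => √(jacobian I Γ ε p) * (tangent Γ p.1).1) (U (q.2 0)) +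
        stripMul I (fun p => √(jacobian I Γ ε p) * (tangent Γ p.1).2) (U (q.2 1)) :
          L2 (straightStrip I)) =ᵐ[_] _
      filter_upwards [Lp.coeFn_add (stripMul I (fun p => √(jacobian I Γ ε p) * (tangent Γ p.1).1)
        (U (q.2 0))) (stripMul I (fun p => √(jacobian I Γ ε p) * (tangent Γ p.1).2) (U (q.2 1))),
        stripMul_ae hI (hs.mul hT1) (U (q.2 0)), stripMul_ae hI (hs.mul hT2) (U (q.2 1)),
        hU (q.2 0), hU (q.2 1), u1, u2, hder, ae_strip_mem hI.measurableSet]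
        with p a0 a1 a2 a3 a4 a5 a6 a7 hp
      obtain ⟨s1, s2, s3⟩ := hsq p hp
      rw [a0, Pi.add_apply, a1, a2, a3, a4, a5, a6, s1, a7, frameMap_apply]
      simp only [ax0, ax1, Fin.zero_eta, mul_one, mul_zero, add_zero]
      rw [clm_apply_pair _ (_ * _, _)]
      push_cast
      rw [← s3]
      ring
    · change ((ε : ℂ) • (stripMul I (fun p => (√(jacobian I Γ ε p))⁻¹ * (tangent Γ p.1).1) (U (q.2 1)) -
        stripMul I (fun p => (√(jacobian I Γ ε p))⁻¹ * (tangent Γ p.1).2) (U (q.2 0))) :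
          L2 (straightStrip I)) =ᵐ[_] _
      filter_upwards [Lp.coeFn_smul (ε : ℂ)
        (stripMul I (fun p => (√(jacobian I Γ ε p))⁻¹ * (tangent Γ p.1).1) (U (q.2 1)) -
        stripMul I (fun p => (√(jacobian I Γ ε p))⁻¹ * (tangent Γ p.1).2) (U (q.2 0))),
        Lp.coeFn_sub (stripMul I (fun p => (√(jacobian I Γ ε p))⁻¹ * (tangent Γ p.1).1) (U (q.2 1)))
        (stripMul I (fun p => (√(jacobian I Γ ε p))⁻¹ * (tangent Γ p.1).2) (U (q.2 0))),
        stripMul_ae hI (hsi.mul hT2) (U (q.2 0)), stripMul_ae hI (hsi.mul hT1) (U (q.2 1)),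
        hU (q.2 0), hU (q.2 1), u1, u2, hder, ae_strip_mem hI.measurableSet]
        with p b0 a0 a1 a2 a3 a4 a5 a6 a7 hp
      obtain ⟨s1, s2, s3⟩ := hsq p hp
      rw [b0, Pi.smul_apply, a0, Pi.sub_apply, a1, a2, a3, a4, a5, a6, s1, a7, frameMap_apply]
      simp only [ax0, ax1, Fin.mk_one, mul_one, mul_zero, zero_add, smul_eq_mul]
      rw [clm_apply_pair _ (_, _ * _)]
      push_cast
      field_simp
      ring

/-- A function on the curved strip is determined by its composition with ℒ, and √(εh) cancels. -/
theorem symm_ae_of_ae (hΓ : IsRegularCurve I Γ K) (hε : 0 < ε)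
    (hεK : ε * K ≤ 1 / 10) (hinj : InjOn (stripMap Γ ε) (straightStrip I))
    {U : L2 (curvedStrip I Γ ε) ≃ₗᵢ[ℂ] L2 (straightStrip I)} (hU : IsStripTransform I Γ ε U)
    {v : L2 (straightStrip I)} {G : ℝ × ℝ → ℂ}
    (h : ∀ᵐ p ∂volume.restrict (straightStrip I), v p = (√(jacobian I Γ ε p) : ℂ) *
      ((√ε : ℂ) * G (stripMap Γ ε p))) :
    U.symm v =ᵐ[volume.restrict (curvedStrip I Γ ε)] G := by
  have h1 := hU (U.symm v)
  rw [U.apply_symm_apply] at h1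
  have h2 : ∀ᵐ p ∂volume.restrict (straightStrip I),
      (U.symm v : ℝ × ℝ → ℂ) (stripMap Γ ε p) = G (stripMap Γ ε p) := by
    filter_upwards [h, h1, ae_strip_snd] with p a1 a2 hp
    have hpos := hΓ.jacobian_pos hε.le hεK hp
    rw [a1, Real.sqrt_mul hε.le] at a2
    push_cast at a2
    have e1 : (√(jacobian I Γ ε p) : ℂ) ≠ 0 := Complex.ofReal_ne_zero.2 (Real.sqrt_pos.2 hpos).ne'
    have e2 : (√ε : ℂ) ≠ 0 := Complex.ofReal_ne_zero.2 (Real.sqrt_pos.2 hε).ne'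
    have : (√(jacobian I Γ ε p) : ℂ) * ((√ε : ℂ) * (U.symm v : ℝ × ℝ → ℂ) (stripMap Γ ε p)) =
        (√(jacobian I Γ ε p) : ℂ) * ((√ε : ℂ) * G (stripMap Γ ε p)) := by
      rw [a2]
      ring
    exact mul_left_cancel₀ e2 (mul_left_cancel₀ e1 this)
  filter_upwards [hΓ.ae_comp_stripInv hε hεK hinj h2,
    ae_restrict_mem (hΓ.isOpen_curvedStrip hε hεK hinj).measurableSet] with x hx hxm
  rwa [stripMap_stripInv hxm] at hx

/-- The converse transfer: every function of the straight form domain comes from an admissible test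
function on Ω_ε, so that the transformed equation holds for all of them. -/
theorem pushGrad_mem_sobolevZero (hΓ : IsRegularCurve I Γ K) (hε : 0 < ε)
    (hεK : ε * K ≤ 1 / 10) (hinj : InjOn (stripMap Γ ε) (straightStrip I))
    {U : L2 (curvedStrip I Γ ε) ≃ₗᵢ[ℂ] L2 (straightStrip I)} (hU : IsStripTransform I Γ ε U)
    {p : L2 (straightStrip I) × (Fin 2 → L2 (straightStrip I))}
    (hp : p ∈ sobolevZero axisPlane (straightStrip I)) :
    (U.symm (stripMul I (fun p => √(jacobian I Γ ε p)) p.1), fun i => U.symm (pushGrad I Γ ε p.2 i)) ∈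
      sobolevZero axisPlane (curvedStrip I Γ ε) := by
  have hI := hΓ.isOpen
  have hs := hΓ.stripBdd_sqrt hε.le hεK
  have hsi := hΓ.stripBdd_sqrt_inv hε.le hεK
  have hT1 := hΓ.stripBdd_tangent_fst
  have hT2 := hΓ.stripBdd_tangent_snd
  have hΩ := hΓ.isOpen_curvedStrip hε hεK hinj
  refine sobolevZero_induction (P := fun p => (U.symm (stripMul I (fun p => √(jacobian I Γ ε p)) p.1),
    fun i => U.symm (pushGrad I Γ ε p.2 i)) ∈ sobolevZero axisPlane (curvedStrip I Γ ε)) ?_ ?_ hp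
  · refine (Submodule.isClosed_topologicalClosure _).preimage (Continuous.prodMk ?_ ?_)
    · fun_prop
    · refine continuous_pi fun i => U.symm.continuous.comp ?_
      fin_cases i
      · simp only [pushGrad]
        fun_prop
      · simp only [pushGrad]
        fun_prop
  intro f hf q h1 h2
  have hf' : (√ε : ℂ)⁻¹ • f ∈ testFunctions (straightStrip I) :=
    Submodule.smul_mem _ _ hf
  have hfd : Differentiable ℝ f := hf.1.differentiable (by simp)
  have hcomp := inSobolevZero_comp (e := axisPlane) hΩ
    (Φ := stripInv I Γ ε) (Ψ := stripMap Γ ε) (fun x hx => by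
      obtain ⟨V, hV, hxV, -, C, hC⟩ := hΓ.exists_lipschitzOnWith_stripInv hε hεK hinj hx
      exact ⟨V, hV.mem_nhds hxV, C, hC⟩) (hΓ.lipschitzOnWith_stripMap hε.le).continuousOn
    (fun x hx => stripMap_mem hx) (fun x hx => stripMap_stripInv hx) hf'
  have e2 : (√ε : ℂ) ≠ 0 := Complex.ofReal_ne_zero.2 (Real.sqrt_pos.2 hε).ne'
  have hεC : (ε : ℂ) ≠ 0 := Complex.ofReal_ne_zero.2 hε.ne'
  have hsq : ∀ p ∈ straightStrip I, (√(jacobian I Γ ε p) : ℂ) ≠ 0 ∧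
      (jacobian I Γ ε p : ℂ) = (√(jacobian I Γ ε p) : ℂ) * (√(jacobian I Γ ε p) : ℂ) := by
    intro p hp
    have hpos := hΓ.jacobian_pos hε.le hεK hp.2
    refine ⟨Complex.ofReal_ne_zero.2 (Real.sqrt_pos.2 hpos).ne', ?_⟩
    rw [← Complex.ofReal_mul, Real.mul_self_sqrt hpos.le]
  have hder : ∀ᵐ p ∂volume.restrict (straightStrip I), ∀ x,
      fderiv ℝ (fun y => ((√ε : ℂ)⁻¹ • f) (stripInv I Γ ε y)) (stripMap Γ ε p) x = (√ε : ℂ)⁻¹ *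
        fderiv ℝ f p (frameInv (tangent Γ p.1) (jacobian I Γ ε p) ε x) := by
    filter_upwards [hΓ.ae_hasFDerivAt_stripMap ε, ae_strip_mem hI.measurableSet] with p hp hpm x
    have hpos := hΓ.jacobian_pos hε.le hεK hpm.2
    have hm : stripMap Γ ε p ∈ curvedStrip I Γ ε := stripMap_mem hpm
    have hinv : HasFDerivAt (stripInv I Γ ε)
        ((frameEquiv (hΓ.unit p.1 hpm.1) hpos.ne' hε.ne').symm : ℝ × ℝ →L[ℝ] ℝ × ℝ)
        (stripMap Γ ε p) := by
      refine HasFDerivAt.of_local_left_inverse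
        ((hΓ.continuousOn_stripInv hε hεK hinj).continuousAt (hΩ.mem_nhds hm)) ?_ ?_
        (f := stripMap Γ ε)
      · rw [stripInv_stripMap hinj hpm]
        exact hp
      · filter_upwards [hΩ.mem_nhds hm] with y hy using stripMap_stripInv hy
    have hfp : HasFDerivAt f (fderiv ℝ f p) (stripInv I Γ ε (stripMap Γ ε p)) := by
      rw [stripInv_stripMap hinj hpm]
      exact (hfd p).hasFDerivAt
    have := (hfp.comp (stripMap Γ ε p) hinv).const_smul (√ε : ℂ)⁻¹
    have e : (fun y => ((√ε : ℂ)⁻¹ • f) (stripInv I Γ ε y)) =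
        (√ε : ℂ)⁻¹ • (f ∘ stripInv I Γ ε) := rfl
    rw [e, this.fderiv]
    rfl
  have ax0 : axisPlane 0 = (1, 0) := rfl
  have ax1 : axisPlane 1 = (0, 1) := rfl
  refine hcomp.mem ?_ ?_
  · refine symm_ae_of_ae hΓ hε hεK hinj hU ?_
    filter_upwards [stripMul_ae hI hs q.1, h1, ae_strip_mem hI.measurableSet] with p a1 a2 hp
    rw [a1, a2]
    simp only [Pi.smul_apply, smul_eq_mul, stripInv_stripMap hinj hp]
    field_simp
  · intro i
    refine symm_ae_of_ae hΓ hε hεK hinj hU ?_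
    fin_cases i
    · change ∀ᵐ p ∂volume.restrict (straightStrip I),
        (stripMul I (fun p => (√(jacobian I Γ ε p))⁻¹ * (tangent Γ p.1).1) (q.2 0) -
          (ε : ℂ)⁻¹ • stripMul I (fun p => √(jacobian I Γ ε p) * (tangent Γ p.1).2) (q.2 1) :
          L2 (straightStrip I)) p = _
      filter_upwards [Lp.coeFn_sub (stripMul I (fun p => (√(jacobian I Γ ε p))⁻¹ *
          (tangent Γ p.1).1) (q.2 0))
          ((ε : ℂ)⁻¹ • stripMul I (fun p => √(jacobian I Γ ε p) * (tangent Γ p.1).2) (q.2 1)),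
        Lp.coeFn_smul (ε : ℂ)⁻¹
          (stripMul I (fun p => √(jacobian I Γ ε p) * (tangent Γ p.1).2) (q.2 1)),
        stripMul_ae hI (hsi.mul hT1) (q.2 0), stripMul_ae hI (hs.mul hT2) (q.2 1), h2 0, h2 1,
        hder, ae_strip_mem hI.measurableSet] with p a0 b0 a1 a2 a3 a4 a5 hp
      obtain ⟨s1, s2⟩ := hsq p hp
      rw [a0, Pi.sub_apply, b0, Pi.smul_apply, a1, a2, a3, a4]
      simp only [Fin.zero_eta]
      rw [a5, frameInv_apply]
      simp only [ax0, ax1, mul_one, mul_zero, add_zero, smul_eq_mul]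
      rw [clm_apply_pair _ (_ * _, _)]
      push_cast
      rw [s2]
      field_simp
      ring
    · change ∀ᵐ p ∂volume.restrict (straightStrip I),
        (stripMul I (fun p => (√(jacobian I Γ ε p))⁻¹ * (tangent Γ p.1).2) (q.2 0) +
          (ε : ℂ)⁻¹ • stripMul I (fun p => √(jacobian I Γ ε p) * (tangent Γ p.1).1) (q.2 1) :
          L2 (straightStrip I)) p = _
      filter_upwards [Lp.coeFn_add (stripMul I (fun p => (√(jacobian I Γ ε p))⁻¹ *
          (tangent Γ p.1).2) (q.2 0))
          ((ε : ℂ)⁻¹ • stripMul I (fun p => √(jacobian I Γ ε p) * (tangent Γ p.1).1) (q.2 1)),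
        Lp.coeFn_smul (ε : ℂ)⁻¹
          (stripMul I (fun p => √(jacobian I Γ ε p) * (tangent Γ p.1).1) (q.2 1)),
        stripMul_ae hI (hsi.mul hT2) (q.2 0), stripMul_ae hI (hs.mul hT1) (q.2 1), h2 0, h2 1,
        hder, ae_strip_mem hI.measurableSet] with p a0 b0 a1 a2 a3 a4 a5 hp
      obtain ⟨s1, s2⟩ := hsq p hp
      rw [a0, Pi.add_apply, b0, Pi.smul_apply, a1, a2, a3, a4]
      simp only [Fin.mk_one]
      rw [a5, frameInv_apply]
      simp only [ax0, ax1, mul_one, mul_zero, zero_add, smul_eq_mul]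
      rw [clm_apply_pair _ (_ * _, _)]
      push_cast
      rw [s2]
      field_simp

/-- The weak form of the resolvent equation in the coordinates of the straight strip. -/
theorem exists_weak_solution (hΓ : IsRegularCurve I Γ K) (hε : 0 < ε)
    (hεK : ε * K ≤ 1 / 10) (hinj : InjOn (stripMap Γ ε) (straightStrip I))
    {U : L2 (curvedStrip I Γ ε) ≃ₗᵢ[ℂ] L2 (straightStrip I)} (hU : IsStripTransform I Γ ε U)
    {z : ℂ} {f : L2 (straightStrip I)} {ψ : L2 (curvedStrip I Γ ε)}
    {g : Fin 2 → L2 (curvedStrip I Γ ε)}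
    (hg : (ψ, g) ∈ sobolevZero axisPlane (curvedStrip I Γ ε))
    (h : ∀ φ k, (φ, k) ∈ sobolevZero axisPlane (curvedStrip I Γ ε) →
      ∑ i, inner ℂ (k i) (g i) - z * inner ℂ φ ψ = inner ℂ φ (U.symm f)) :
    ∃ p ∈ sobolevZero axisPlane (straightStrip I),
      U ψ = stripMul I (fun p => √(jacobian I Γ ε p)) p.1 ∧
      ∀ χ ∈ sobolevZero axisPlane (straightStrip I),
        inner ℂ (χ.2 0) (stripMul I (fun p => (jacobian I Γ ε p)⁻¹) (p.2 0)) +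
          ((ε : ℂ) ^ 2)⁻¹ * inner ℂ (χ.2 1) (stripMul I (jacobian I Γ ε) (p.2 1)) -
          z * inner ℂ χ.1 (stripMul I (jacobian I Γ ε) p.1) =
        inner ℂ χ.1 (stripMul I (fun p => √(jacobian I Γ ε p)) f) := by
  have hI := hΓ.isOpen
  have hs := hΓ.stripBdd_sqrt hε.le hεK
  have hsi := hΓ.stripBdd_sqrt_inv hε.le hεK
  have hh := hΓ.stripBdd_jacobian hε.le hεK
  have hhi := hΓ.stripBdd_jacobian_inv hε.le hεK
  have hT1 := hΓ.stripBdd_tangent_fst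
  have hT2 := hΓ.stripBdd_tangent_snd
  have hsq : ∀ p ∈ straightStrip I, √(jacobian I Γ ε p) ≠ 0 ∧
      jacobian I Γ ε p = √(jacobian I Γ ε p) * √(jacobian I Γ ε p) := by
    intro p hp
    have hpos := hΓ.jacobian_pos hε.le hεK hp.2
    exact ⟨(Real.sqrt_pos.2 hpos).ne', (Real.mul_self_sqrt hpos.le).symm⟩
  have hεC : (ε : ℂ) ≠ 0 := Complex.ofReal_ne_zero.2 hε.ne'
  refine ⟨_, pullGrad_mem_sobolevZero hΓ hε hεK hinj hU hg, ?_, fun χ hχ => ?_⟩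
  · have : stripMul I (fun p => √(jacobian I Γ ε p)) (stripMul I (fun p => (√(jacobian I Γ ε p))⁻¹)
        (U ψ)) = stripMul I (fun _ => 1) (U ψ) := stripMul_stripMul hI hs hsi
      (fun p hp => mul_inv_cancel₀ (hsq p hp).1) _
    refine Eq.trans ?_ this.symm
    rw [stripMul]
    simp only [Complex.ofReal_one]
    rw [mulL_one]
  have key := h _ _ (pushGrad_mem_sobolevZero hΓ hε hεK hinj hU hχ)
  have flip : ∀ (a : L2 (straightStrip I)) (b : L2 (curvedStrip I Γ ε)),
      inner ℂ (U.symm a) b = inner ℂ a (U b) := fun a b => by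
    rw [← U.inner_map_map, U.apply_symm_apply]
  simp only [Fin.sum_univ_two, flip, U.apply_symm_apply] at key
  rw [inner_stripMul hI hs, inner_stripMul hI hs] at key
  rw [← key]
  -- The adjoint of `pushGrad` is `pullGrad` with its components weighted by h⁻¹ and ε⁻² h. These
  -- product identities verify it termwise, with no cross terms.
  have m1 : ∀ v, stripMul I (fun p => (jacobian I Γ ε p)⁻¹)
      (stripMul I (fun p => √(jacobian I Γ ε p) * (tangent Γ p.1).1) v) =
      stripMul I (fun p => (√(jacobian I Γ ε p))⁻¹ * (tangent Γ p.1).1) v :=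
    stripMul_stripMul hI hhi (hs.mul hT1) fun p hp => by
      obtain ⟨s1, s2⟩ := hsq p hp
      rw [s2, Real.sqrt_mul_self (Real.sqrt_nonneg _)]
      field_simp
  have m2 : ∀ v, stripMul I (fun p => (jacobian I Γ ε p)⁻¹)
      (stripMul I (fun p => √(jacobian I Γ ε p) * (tangent Γ p.1).2) v) =
      stripMul I (fun p => (√(jacobian I Γ ε p))⁻¹ * (tangent Γ p.1).2) v :=
    stripMul_stripMul hI hhi (hs.mul hT2) fun p hp => by
      obtain ⟨s1, s2⟩ := hsq p hp
      rw [s2, Real.sqrt_mul_self (Real.sqrt_nonneg _)]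
      field_simp
  have m3 : ∀ v, stripMul I (jacobian I Γ ε)
      (stripMul I (fun p => (√(jacobian I Γ ε p))⁻¹ * (tangent Γ p.1).1) v) =
      stripMul I (fun p => √(jacobian I Γ ε p) * (tangent Γ p.1).1) v :=
    stripMul_stripMul hI hh (hsi.mul hT1) fun p hp => by
      obtain ⟨s1, s2⟩ := hsq p hp
      rw [s2, Real.sqrt_mul_self (Real.sqrt_nonneg _)]
      field_simp
  have m4 : ∀ v, stripMul I (jacobian I Γ ε)
      (stripMul I (fun p => (√(jacobian I Γ ε p))⁻¹ * (tangent Γ p.1).2) v) =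
      stripMul I (fun p => √(jacobian I Γ ε p) * (tangent Γ p.1).2) v :=
    stripMul_stripMul hI hh (hsi.mul hT2) fun p hp => by
      obtain ⟨s1, s2⟩ := hsq p hp
      rw [s2, Real.sqrt_mul_self (Real.sqrt_nonneg _)]
      field_simp
  have m5 : ∀ v, stripMul I (jacobian I Γ ε) (stripMul I (fun p => (√(jacobian I Γ ε p))⁻¹) v) =
      stripMul I (fun p => √(jacobian I Γ ε p)) v :=
    stripMul_stripMul hI hh hsi fun p hp => by
      obtain ⟨s1, s2⟩ := hsq p hp
      rw [s2, Real.sqrt_mul_self (Real.sqrt_nonneg _)]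
      field_simp
  have q0 : ∀ k : Fin 2 → L2 (straightStrip I), pushGrad I Γ ε k 0 =
    stripMul I (fun p => (√(jacobian I Γ ε p))⁻¹ * (tangent Γ p.1).1) (k 0) -
      (ε : ℂ)⁻¹ • stripMul I (fun p => √(jacobian I Γ ε p) * (tangent Γ p.1).2) (k 1) := fun _ => rfl
  have q1 : ∀ k : Fin 2 → L2 (straightStrip I), pushGrad I Γ ε k 1 =
    stripMul I (fun p => (√(jacobian I Γ ε p))⁻¹ * (tangent Γ p.1).2) (k 0) +
      (ε : ℂ)⁻¹ • stripMul I (fun p => √(jacobian I Γ ε p) * (tangent Γ p.1).1) (k 1) := fun _ => rfl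
  have r0 : ∀ k : Fin 2 → L2 (straightStrip I), pullGrad I Γ ε k 0 =
    stripMul I (fun p => √(jacobian I Γ ε p) * (tangent Γ p.1).1) (k 0) +
      stripMul I (fun p => √(jacobian I Γ ε p) * (tangent Γ p.1).2) (k 1) := fun _ => rfl
  have r1 : ∀ k : Fin 2 → L2 (straightStrip I), pullGrad I Γ ε k 1 =
    (ε : ℂ) • (stripMul I (fun p => (√(jacobian I Γ ε p))⁻¹ * (tangent Γ p.1).1) (k 1) -
      stripMul I (fun p => (√(jacobian I Γ ε p))⁻¹ * (tangent Γ p.1).2) (k 0)) := fun _ => rfl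
  simp only [q0, q1, r0, r1, map_add, map_sub, map_smul, m1, m2, m3, m4, m5, inner_add_left,
    inner_sub_left, inner_add_right, inner_sub_right, inner_smul_left, inner_smul_right,
    inner_stripMul hI (hsi.mul hT1), inner_stripMul hI (hsi.mul hT2),
    inner_stripMul hI (hs.mul hT1), inner_stripMul hI (hs.mul hT2), map_inv₀, Complex.conj_ofReal]
  field_simp
  ring

end Transfer

/-! ### The trial function -/

section Profile

variable {I : Set ℝ} {k dk : ℝ → ℝ} {K D ε : ℝ}

/-- The transverse profile `(1 + ε k(s) t / 2) J₁(t)` of the trial function. -/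
def profile (k : ℝ → ℝ) (ε : ℝ) (p : ℝ × ℝ) : ℝ := (1 + ε / 2 * k p.1 * p.2) * J₁ p.2

/-- The transverse derivative of `profile`. -/
def dprofile (k : ℝ → ℝ) (ε : ℝ) (p : ℝ × ℝ) : ℝ :=
  (1 + ε / 2 * k p.1 * p.2) * dJ₁ p.2 + ε / 2 * k p.1 * J₁ p.2

theorem abs_snd_le {p : ℝ × ℝ} (hp : p ∈ straightStrip I) : |p.2| ≤ 1 :=
  abs_le.2 ⟨hp.2.1.le, hp.2.2.le⟩

theorem abs_weight_le (hkK : ∀ s, |k s| ≤ K) (hε : 0 ≤ ε) {p : ℝ × ℝ}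
    (hp : p ∈ straightStrip I) : |ε / 2 * k p.1 * p.2| ≤ ε * K / 2 := by
  rw [mul_assoc, abs_mul, abs_mul, abs_of_nonneg (by positivity : 0 ≤ ε / 2)]
  have := mul_le_mul (hkK p.1) (abs_snd_le hp) (abs_nonneg _) ((abs_nonneg _).trans (hkK 0))
  nlinarith

theorem stripBdd_profile (hk : Measurable k) (hkK : ∀ s, |k s| ≤ K) (hε : 0 ≤ ε)
    (hεK : ε * K ≤ 1 / 10) : StripBdd I (profile k ε) 2 := by
  refine ⟨?_, by norm_num, fun p hp => ?_⟩
  · have := J₁_continuous.measurable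
    unfold profile
    fun_prop
  · have h1 := abs_weight_le hkK hε hp
    have h2 : |1 + ε / 2 * k p.1 * p.2| ≤ 2 := by
      refine (abs_add_le _ _).trans ?_
      rw [abs_one]
      linarith
    rw [profile, abs_mul]
    have := mul_le_mul h2 (abs_J₁_le p.2) (abs_nonneg _) (by norm_num)
    linarith

theorem stripBdd_dprofile (hk : Measurable k) (hkK : ∀ s, |k s| ≤ K) (hε : 0 ≤ ε)
    (hεK : ε * K ≤ 1 / 10) : StripBdd I (dprofile k ε) 5 := by
  refine ⟨?_, by norm_num, fun p hp => ?_⟩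
  · have := J₁_continuous.measurable
    have := dJ₁_continuous.measurable
    unfold dprofile
    fun_prop
  · have h1 := abs_weight_le hkK hε hp
    have h2 : |1 + ε / 2 * k p.1 * p.2| ≤ 2 := by
      refine (abs_add_le _ _).trans ?_
      rw [abs_one]
      linarith
    have h3 : |ε / 2 * k p.1| ≤ 1 := by
      rw [abs_mul, abs_of_nonneg (by positivity : 0 ≤ ε / 2)]
      nlinarith [hkK p.1]
    rw [dprofile]
    refine (abs_add_le _ _).trans ?_
    rw [abs_mul, abs_mul]
    have := mul_le_mul h2 (abs_dJ₁_le p.2) (abs_nonneg _) (by norm_num)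
    have := mul_le_mul h3 (abs_J₁_le p.2) (abs_nonneg _) (by norm_num)
    linarith

theorem essBdd_deriv_profile (hdk : EssBdd I (fun s => (dk s : ℂ)) D) (hε : 0 ≤ ε) :
    EssBdd (straightStrip I) (fun p => ((dk p.1 * (ε / 2 * (p.2 * J₁ p.2)) : ℝ) : ℂ))
      (D * (ε / 2)) := by
  have h : EssBdd (straightStrip I) (fun p => ((ε / 2 * (p.2 * J₁ p.2) : ℝ) : ℂ)) (ε / 2) := by
    refine essBdd_snd (G := fun t => ε / 2 * (t * J₁ t)) ?_ (by positivity) fun t ht => ?_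
    · have := J₁_continuous.measurable
      fun_prop
    · rw [abs_mul, abs_mul, abs_of_nonneg (by positivity : 0 ≤ ε / 2)]
      have := mul_le_mul (abs_le.2 ⟨ht.1.le, ht.2.le⟩) (abs_J₁_le t) (abs_nonneg _) zero_le_one
      nlinarith
  simpa only [Complex.ofReal_mul] using hdk.fst.mul h

/-- The gradient of the trial function. -/
def trialGrad (I : Set ℝ) (k dk : ℝ → ℝ) (ε : ℝ) (q : L2 I × (Fin 1 → L2 I)) :
    Fin 2 → L2 (straightStrip I) :=
  ![stripMul I (profile k ε) (lift I (q.2 0)) +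
      stripMul I (fun p => dk p.1 * (ε / 2 * (p.2 * J₁ p.2))) (lift I q.1),
    stripMul I (dprofile k ε) (lift I q.1)]

/-- The trial function is θ ⊗ J₁ plus kθ ⊗ (ε/2) t J₁, and both profiles vanish at ±1. The factor k
in the second summand is where a Lipschitz substitute for κ is needed. -/
theorem trial_mem_sobolevZero (hI : IsOpen I) {Lk : NNReal} (hk : LipschitzWith Lk k)
    (hkK : ∀ s, |k s| ≤ K) (hdk : EssBdd I (fun s => (dk s : ℂ)) D)
    (hkd : ∀ᵐ s ∂volume.restrict I, HasDerivAt k (dk s) s) (hε : 0 ≤ ε) (hεK : ε * K ≤ 1 / 10)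
    {q : L2 I × (Fin 1 → L2 I)} (hq : q ∈ sobolevZero axisLine I) :
    (stripMul I (profile k ε) (lift I q.1), trialGrad I k dk ε q) ∈
      sobolevZero axisPlane (straightStrip I) := by
  have hkm := hk.continuous.measurable
  have t1 := tensor_mem_sobolevZero hI (c := fun _ => 1) (dc := fun _ => 0) (M := 1) (D := 0)
    (LipschitzWith.const 1) (by simp) (by simpa using EssBdd.const (Ω := I) 0)
    (Eventually.of_forall fun s => hasDerivAt_const s 1) hasDerivAt_J₁ dJ₁_continuous J₁_neg_one
    J₁_one (B := 2) (fun t _ => (abs_J₁_le t).trans (by norm_num)) (fun t _ => abs_dJ₁_le t) hq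
  have hG : ∀ t, HasDerivAt (fun t => ε / 2 * (t * J₁ t)) (ε / 2 * (J₁ t + t * dJ₁ t)) t := fun t => by
    refine (((hasDerivAt_id t).mul (hasDerivAt_J₁ t)).const_mul (ε / 2)).congr_deriv ?_
    simp
  have hdG : Continuous fun t => ε / 2 * (J₁ t + t * dJ₁ t) := by
    have := J₁_continuous
    have := dJ₁_continuous
    fun_prop
  have b1 : ∀ t ∈ crossSection, |ε / 2 * (t * J₁ t)| ≤ ε / 2 * 3 := fun t ht => by
    rw [abs_mul, abs_mul, abs_of_nonneg (by positivity : 0 ≤ ε / 2)]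
    have := mul_le_mul (abs_le.2 ⟨ht.1.le, ht.2.le⟩) (abs_J₁_le t) (abs_nonneg _) zero_le_one
    gcongr
    linarith
  have b2 : ∀ t ∈ crossSection, |ε / 2 * (J₁ t + t * dJ₁ t)| ≤ ε / 2 * 3 := fun t ht => by
    rw [abs_mul, abs_of_nonneg (by positivity : 0 ≤ ε / 2)]
    have := mul_le_mul (abs_le.2 ⟨ht.1.le, ht.2.le⟩) (abs_dJ₁_le t) (abs_nonneg _) zero_le_one
    have h3 := abs_add_le (J₁ t) (t * dJ₁ t)
    rw [abs_mul] at h3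
    have := abs_J₁_le t
    gcongr
    linarith
  have t2 := tensor_mem_sobolevZero hI hk hkK hdk hkd hG hdG (by simp [J₁_neg_one])
    (by simp [J₁_one]) b1 b2 hq
  have hJm := J₁_continuous.measurable
  have hdJm := dJ₁_continuous.measurable
  have eJ : EssBdd (straightStrip I) (fun x => ((1 * J₁ x.2 : ℝ) : ℂ)) 1 := by
    simpa using essBdd_J₁ (I := I)
  have edJ : EssBdd (straightStrip I) (fun x => ((1 * dJ₁ x.2 : ℝ) : ℂ)) 2 := by
    simpa using essBdd_snd (I := I) hdJm (by norm_num) fun t _ => abs_dJ₁_le t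
  have ek : EssBdd I (fun s => (k s : ℂ)) K :=
    ⟨(Complex.measurable_ofReal.comp hkm).aestronglyMeasurable, (abs_nonneg _).trans (hkK 0),
      Eventually.of_forall fun s => by simpa using hkK s⟩
  have eG : EssBdd (straightStrip I) (fun x => ((k x.1 * (ε / 2 * (x.2 * J₁ x.2)) : ℝ) : ℂ))
      (K * (ε / 2 * 3)) := by
    simpa only [Complex.ofReal_mul] using! ek.fst.mul (essBdd_snd (G := fun t => ε / 2 * (t * J₁ t))
      (by fun_prop) (by positivity) b1)
  have edG : EssBdd (straightStrip I)
      (fun x => ((k x.1 * (ε / 2 * (J₁ x.2 + x.2 * dJ₁ x.2)) : ℝ) : ℂ)) (K * (ε / 2 * 3)) := by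
    have := ek.fst.mul (essBdd_snd (I := I) (G := fun t => ε / 2 * (J₁ t + t * dJ₁ t))
      hdG.measurable (by positivity) b2)
    simpa only [← Complex.ofReal_mul] using! this
  have hp := stripBdd_profile (I := I) hkm hkK hε hεK
  have hdp := stripBdd_dprofile (I := I) hkm hkK hε hεK
  have e1 : ∀ v, stripMul I (profile k ε) v =
      mulL (straightStrip I) (fun x => ((1 * J₁ x.2 : ℝ) : ℂ)) v +
      mulL (straightStrip I) (fun x => ((k x.1 * (ε / 2 * (x.2 * J₁ x.2)) : ℝ) : ℂ)) v := by
    intro v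
    rw [← mulL_add eJ eG]
    refine mulL_congr (hp.essBdd hI) (Eventually.of_forall fun x => ?_) v
    simp only [profile]
    push_cast
    ring
  have e2 : ∀ v, stripMul I (dprofile k ε) v =
      mulL (straightStrip I) (fun x => ((1 * dJ₁ x.2 : ℝ) : ℂ)) v +
      mulL (straightStrip I) (fun x => ((k x.1 * (ε / 2 * (J₁ x.2 + x.2 * dJ₁ x.2)) : ℝ) : ℂ)) v := by
    intro v
    rw [← mulL_add edJ edG]
    refine mulL_congr (hdp.essBdd hI) (Eventually.of_forall fun x => ?_) v
    simp only [dprofile]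
    push_cast
    ring
  have e3 : ∀ v, mulL (straightStrip I) (fun x => ((0 * J₁ x.2 : ℝ) : ℂ)) v = 0 := by
    intro v
    simp only [zero_mul, Complex.ofReal_zero]
    rw [mulL_const, zero_smul]
  have hsum := add_mem t1 t2
  convert hsum using 1
  refine Prod.ext (e1 _) (funext fun i => ?_)
  fin_cases i
  · simp only [trialGrad]
    change stripMul I (profile k ε) (lift I (q.2 0)) + _ = (_ + _) + (_ + _)
    rw [e1, e3]
    change _ + mulL _ _ _ = _
    abel
  · exact e2 _

end Profile

/-! ### Pairings with tensor products -/

section Residual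

variable {I : Set ℝ}

/-- The transverse projection. -/
abbrev tensorAdj (I : Set ℝ) : L2 (straightStrip I) →L[ℂ] L2 I :=
  ContinuousLinearMap.adjoint (tensorJ₁ I).toContinuousLinearMap

theorem inner_tensorJ₁_right (χ : L2 (straightStrip I)) (θ : L2 I) :
    inner ℂ χ (tensorJ₁ I θ) = inner ℂ (tensorAdj I χ) θ :=
  (ContinuousLinearMap.adjoint_inner_left (tensorJ₁ I).toContinuousLinearMap θ χ).symm

theorem inner_tensorJ₁_left (χ : L2 (straightStrip I)) (θ : L2 I) :
    inner ℂ (tensorJ₁ I θ) χ = inner ℂ θ (tensorAdj I χ) :=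
  (ContinuousLinearMap.adjoint_inner_right (tensorJ₁ I).toContinuousLinearMap θ χ).symm

theorem norm_tensorAdj_le (χ : L2 (straightStrip I)) : ‖tensorAdj I χ‖ ≤ ‖χ‖ := by
  refine ((tensorAdj I).le_opNorm χ).trans ?_
  have : ‖tensorAdj I‖ ≤ 1 := by
    rw [LinearIsometryEquiv.norm_map]
    exact (tensorJ₁ I).norm_toContinuousLinearMap_le
  exact mul_le_of_le_one_left (norm_nonneg _) this

/-- The pairing of `χ` with a tensor product, up to the component of `χ` orthogonal to the ground
state. -/
theorem norm_inner_mulL_snd_lift_sub_le {G : ℝ → ℝ} (hG : Measurable G) {C : ℝ} (hC : 0 ≤ C)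
    (hGC : ∀ t ∈ crossSection, |G t| ≤ C) (χ : L2 (straightStrip I)) (ζ : L2 I) :
    ‖inner ℂ χ (stripMul I (fun p => G p.2) (lift I ζ)) -
      ((∫ t in (-1 : ℝ)..1, J₁ t * G t : ℝ) : ℂ) * inner ℂ (tensorAdj I χ) ζ‖ ≤
      ‖χ - tensorJ₁ I (tensorAdj I χ)‖ * (2 * C * ‖ζ‖) := by
  have h1 : ((∫ t in (-1 : ℝ)..1, J₁ t * G t : ℝ) : ℂ) * inner ℂ (tensorAdj I χ) ζ =
      inner ℂ (tensorJ₁ I (tensorAdj I χ)) (stripMul I (fun p => G p.2) (lift I ζ)) := by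
    rw [tensorJ₁_eq, inner_mulL_snd_lift J₁_continuous.measurable hG zero_le_one hC
      (fun t _ => abs_J₁_le t) hGC]
  rw [h1, ← inner_sub_left]
  refine (norm_inner_le_norm _ _).trans ?_
  gcongr
  refine (norm_mulL_le (essBdd_snd hG hC hGC) _).trans ?_
  have := norm_lift_le ζ
  nlinarith

theorem norm_stripMul_lift_sub_tensor_le (hI : IsOpen I) {b : ℝ × ℝ → ℝ} {C : ℝ}
    (hb : Measurable b) (hC : 0 ≤ C)
    (h : ∀ p ∈ straightStrip I, |b p - J₁ p.2| ≤ C) (θ : L2 I) :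
    ‖stripMul I b (lift I θ) - tensorJ₁ I θ‖ ≤ 2 * C * ‖θ‖ := by
  have hJm := J₁_continuous.measurable
  have hs : StripBdd I (fun p => b p - J₁ p.2) C := ⟨by fun_prop, hC, h⟩
  have hb' : StripBdd I b (C + 1) := ⟨hb, by positivity, fun p hp => by
    have e : b p = (b p - J₁ p.2) + J₁ p.2 := by ring
    rw [e]
    exact (abs_add_le _ _).trans (add_le_add (h p hp) (abs_J₁_le _))⟩
  have e : stripMul I b (lift I θ) - tensorJ₁ I θ = stripMul I (fun p => b p - J₁ p.2) (lift I θ) := by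
    rw [tensorJ₁_eq, stripMul, ← mulL_sub (hb'.essBdd hI) essBdd_J₁, stripMul]
    simp only [Complex.ofReal_sub]
  rw [e]
  refine (norm_stripMul_le hI hs _).trans ?_
  have := norm_lift_le θ
  nlinarith

end Residual

/-! ### Consistency of the trial function -/

/-! ### Algebra of bounded functions on the strip -/

section StripBddAlgebra

variable {I : Set ℝ} {b b' : ℝ × ℝ → ℝ} {C C' : ℝ}

theorem StripBdd.add (hb : StripBdd I b C) (hb' : StripBdd I b' C') :
    StripBdd I (fun p => b p + b' p) (C + C') :=
  ⟨hb.1.add hb'.1, add_nonneg hb.2.1 hb'.2.1, fun p hp =>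
    (abs_add_le _ _).trans (add_le_add (hb.2.2 p hp) (hb'.2.2 p hp))⟩

theorem StripBdd.sub (hb : StripBdd I b C) (hb' : StripBdd I b' C') :
    StripBdd I (fun p => b p - b' p) (C + C') :=
  ⟨hb.1.sub hb'.1, add_nonneg hb.2.1 hb'.2.1, fun p hp =>
    (abs_sub _ _).trans (add_le_add (hb.2.2 p hp) (hb'.2.2 p hp))⟩

theorem StripBdd.const (c : ℝ) : StripBdd I (fun _ => c) |c| :=
  ⟨measurable_const, abs_nonneg _, fun _ _ => le_rfl⟩

theorem stripBdd_fst {k : ℝ → ℝ} (hk : Measurable k) (hkC : ∀ s, |k s| ≤ C) :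
    StripBdd I (fun p => k p.1) C :=
  ⟨hk.comp measurable_fst, (abs_nonneg _).trans (hkC 0), fun p _ => hkC p.1⟩

theorem stripBdd_snd {G : ℝ → ℝ} (hG : Measurable G) (hC : 0 ≤ C)
    (h : ∀ t ∈ crossSection, |G t| ≤ C) : StripBdd I (fun p => G p.2) C :=
  ⟨hG.comp measurable_snd, hC, fun p hp => h p.2 hp.2⟩

theorem essBdd_of_measurable {k : ℝ → ℝ} (hk : Measurable k) (hkC : ∀ s, |k s| ≤ C) :
    EssBdd I (fun s => (k s : ℂ)) C :=
  ⟨(Complex.measurable_ofReal.comp hk).aestronglyMeasurable, (abs_nonneg _).trans (hkC 0),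
    Eventually.of_forall fun s => by simpa using hkC s⟩

end StripBddAlgebra

section Consistency

variable {I : Set ℝ} {Γ : ℝ → ℝ × ℝ} {k dk : ℝ → ℝ} {K D ε : ℝ}

/-- The transverse profile of the remainder of second order. -/
def remainderProfile (t : ℝ) : ℝ := 3 / 2 * (t * dJ₁ t) + 1 / 2 * J₁ t

theorem remainderProfile_continuous : Continuous remainderProfile := by
  have := J₁_continuous
  have := dJ₁_continuous
  unfold remainderProfile
  fun_prop

theorem abs_remainderProfile_le {t : ℝ} (ht : t ∈ crossSection) : |remainderProfile t| ≤ 4 := by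
  have h1 := mul_le_mul (abs_le.2 ⟨ht.1.le, ht.2.le⟩) (abs_dJ₁_le t) (abs_nonneg _) zero_le_one
  rw [← abs_mul] at h1
  have h2 := abs_J₁_le t
  rw [remainderProfile]
  rw [abs_le] at h1 h2 ⊢
  constructor <;> linarith

/-- 3/2 · (−1/2) + 1/2 · 1. This is the coefficient of κ² in the effective Hamiltonian. -/
theorem integral_J₁_mul_remainderProfile :
    ∫ t in (-1 : ℝ)..1, J₁ t * remainderProfile t = -1 / 4 := by
  have hJ := J₁_continuous
  have hdJ := dJ₁_continuous
  have e : ∀ t, J₁ t * remainderProfile t =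
      3 / 2 * (J₁ t * (t * dJ₁ t)) + 1 / 2 * J₁ t ^ 2 := fun t => by
    rw [remainderProfile]
    ring
  simp_rw [e]
  rw [intervalIntegral.integral_add (Continuous.intervalIntegrable (by fun_prop) _ _)
    (Continuous.intervalIntegrable (by fun_prop) _ _), intervalIntegral.integral_const_mul,
    intervalIntegral.integral_const_mul, integral_mul_J₁_mul_dJ₁, integral_J₁_sq]
  norm_num

/-- Integrate by parts in t with F = h ∂ₜ(profile), for which ∂ₜF = −E₁ h profile + ε (k − κ) J₁′ −
ε² k κ (3/2 t J₁′ + 1/2 J₁). The E₁ terms cancel, and the correction ε k t / 2 in the profile is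
designed so that order ε contains only the difference k − κ. -/
theorem transverse_form_trial (hΓ : IsRegularCurve I Γ K) (hk : Measurable k)
    (hkK : ∀ s, |k s| ≤ K) (hε : 0 < ε) (hεK : ε * K ≤ 1 / 10) (θ : L2 I)
    {χ : L2 (straightStrip I) × (Fin 2 → L2 (straightStrip I))}
    (hχ : χ ∈ sobolevZero axisPlane (straightStrip I)) :
    ((ε : ℂ) ^ 2)⁻¹ * inner ℂ (χ.2 1)
        (stripMul I (jacobian I Γ ε) (stripMul I (dprofile k ε) (lift I θ))) -
      ((ε : ℂ) ^ 2)⁻¹ * E₁ * inner ℂ χ.1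
        (stripMul I (jacobian I Γ ε) (stripMul I (profile k ε) (lift I θ))) =
    -(ε : ℂ)⁻¹ * inner ℂ χ.1 (stripMul I (fun p => dJ₁ p.2)
        (lift I (mulL I (fun s => ((k s - curvature I Γ s : ℝ) : ℂ)) θ))) +
      inner ℂ χ.1 (stripMul I (fun p => remainderProfile p.2)
        (lift I (mulL I (fun s => ((k s * curvature I Γ s : ℝ) : ℂ)) θ))) := by
  have hI := hΓ.isOpen
  have hεC : (ε : ℂ) ≠ 0 := Complex.ofReal_ne_zero.2 hε.ne'
  have hκm := hΓ.measurable_curvature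
  have hκ := hΓ.curvature_le
  have hh := hΓ.stripBdd_jacobian hε.le hεK
  have hp := stripBdd_profile (I := I) hk hkK hε.le hεK
  have hdp := stripBdd_dprofile (I := I) hk hkK hε.le hεK
  have sdJ : StripBdd I (fun p => dJ₁ p.2) 2 :=
    stripBdd_snd dJ₁_continuous.measurable (by norm_num) fun t _ => abs_dJ₁_le t
  have sG : StripBdd I (fun p => remainderProfile p.2) 4 :=
    stripBdd_snd remainderProfile_continuous.measurable (by norm_num)
      fun t ht => abs_remainderProfile_le ht
  have sk : StripBdd I (fun p => k p.1) K := stripBdd_fst hk hkK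
  have sκ : StripBdd I (fun p => curvature I Γ p.1) K := stripBdd_fst hκm hκ
  have ek : EssBdd I (fun s => (k s : ℂ)) K := essBdd_of_measurable hk hkK
  have eκ : EssBdd I (fun s => (curvature I Γ s : ℂ)) K := essBdd_of_measurable hκm hκ
  have ekκ : EssBdd I (fun s => ((k s - curvature I Γ s : ℝ) : ℂ)) (K + K) := by
    simpa only [Complex.ofReal_sub] using ek.sub eκ
  have ekκ' : EssBdd I (fun s => ((k s * curvature I Γ s : ℝ) : ℂ)) (K * K) := by
    simpa only [Complex.ofReal_mul] using ek.mul eκ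
  let dF : ℝ × ℝ → ℝ := fun p => (-E₁) * (jacobian I Γ ε p * profile k ε p) +
    (ε * ((k p.1 - curvature I Γ p.1) * dJ₁ p.2) -
      ε ^ 2 * (k p.1 * curvature I Γ p.1 * remainderProfile p.2))
  have sF : StripBdd I (fun p => jacobian I Γ ε p * dprofile k ε p) (2 * 5) := hh.mul hdp
  have sdF : StripBdd I dF _ := ((StripBdd.const (-E₁)).mul (hh.mul hp)).add
    (((StripBdd.const ε).mul ((sk.sub sκ).mul sdJ)).sub
      ((StripBdd.const (ε ^ 2)).mul ((sk.mul sκ).mul sG)))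
  have hder : ∀ s t, HasDerivAt (fun t => jacobian I Γ ε (s, t) * dprofile k ε (s, t))
      (dF (s, t)) t := by
    intro s t
    have h1 : HasDerivAt (fun t => jacobian I Γ ε (s, t)) (-(ε * curvature I Γ s)) t := by
      simpa [jacobian] using ((hasDerivAt_id t).const_mul (ε * curvature I Γ s)).const_sub 1
    have h2 : HasDerivAt (fun t => 1 + ε / 2 * k s * t) (ε / 2 * k s) t := by
      simpa using ((hasDerivAt_id t).const_mul (ε / 2 * k s)).const_add 1
    have h3 := (h2.mul (hasDerivAt_dJ₁ t)).add ((hasDerivAt_J₁ t).const_mul (ε / 2 * k s))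
    refine (h1.mul h3).congr_deriv ?_
    simp only [dF, jacobian, profile, remainderProfile, Pi.add_apply, Pi.mul_apply]
    ring
  have hcont : ∀ s, Continuous fun t => dF (s, t) := by
    intro s
    have := J₁_continuous
    have := dJ₁_continuous
    simp only [dF, jacobian, profile, remainderProfile]
    fun_prop
  have hparts := inner_transverse_deriv (sF.essBdd hI) (sdF.essBdd hI) hder hcont θ hχ
  have m1 : stripMul I (jacobian I Γ ε) (stripMul I (dprofile k ε) (lift I θ)) =
      stripMul I (fun p => jacobian I Γ ε p * dprofile k ε p) (lift I θ) :=
    stripMul_stripMul hI hh hdp (fun _ _ => rfl) _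
  have m2 : stripMul I (jacobian I Γ ε) (stripMul I (profile k ε) (lift I θ)) =
      stripMul I (fun p => jacobian I Γ ε p * profile k ε p) (lift I θ) :=
    stripMul_stripMul hI hh hp (fun _ _ => rfl) _
  set ζ := mulL I (fun s => ((k s - curvature I Γ s : ℝ) : ℂ)) θ with hζ
  set υ := mulL I (fun s => ((k s * curvature I Γ s : ℝ) : ℂ)) θ with hυ
  have hvec : stripMul I dF (lift I θ) =
      (-E₁ : ℂ) • stripMul I (fun p => jacobian I Γ ε p * profile k ε p) (lift I θ) +
      ((ε : ℂ) • stripMul I (fun p => dJ₁ p.2) (lift I ζ) -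
        ((ε : ℂ) ^ 2) • stripMul I (fun p => remainderProfile p.2) (lift I υ)) := by
    refine Lp.ext ?_
    set X1 := stripMul I (fun p => jacobian I Γ ε p * profile k ε p) (lift I θ)
    set X2 := stripMul I (fun p => dJ₁ p.2) (lift I ζ)
    set X3 := stripMul I (fun p => remainderProfile p.2) (lift I υ)
    filter_upwards [stripMul_ae hI sdF (lift I θ), stripMul_ae hI (hh.mul hp) (lift I θ),
      stripMul_ae hI sdJ (lift I ζ), stripMul_ae hI sG (lift I υ), lift_ae θ, lift_ae ζ, lift_ae υ,
      ae_strip_of_ae_fst (mulL_ae ekκ θ), ae_strip_of_ae_fst (mulL_ae ekκ' θ),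
      Lp.coeFn_add ((-E₁ : ℂ) • X1) ((ε : ℂ) • X2 - ((ε : ℂ) ^ 2) • X3),
      Lp.coeFn_sub ((ε : ℂ) • X2) (((ε : ℂ) ^ 2) • X3), Lp.coeFn_smul (-E₁ : ℂ) X1,
      Lp.coeFn_smul (ε : ℂ) X2, Lp.coeFn_smul ((ε : ℂ) ^ 2) X3]
      with p a1 a2 a3 a4 a5 a6 a7 a8 a9 c1 c2 c3 c4 c5
    rw [c1, Pi.add_apply, c2, Pi.sub_apply, c3, c4, c5]
    simp only [Pi.smul_apply, smul_eq_mul]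
    rw [a1, a2, a3, a4, a5, a6, a7, a8, a9]
    simp only [dF]
    push_cast
    ring
  rw [m1, m2, hparts]
  change ((ε : ℂ) ^ 2)⁻¹ * -inner ℂ χ.1 (stripMul I dF (lift I θ)) - _ = _
  rw [hvec, inner_add_right, inner_sub_right, inner_smul_right, inner_smul_right, inner_smul_right]
  field_simp
  ring

theorem abs_sqrt_sub_one_le {x : ℝ} (hx : 0 ≤ x) : |√x - 1| ≤ |x - 1| := by
  have h : x - 1 = (√x - 1) * (√x + 1) := by
    nlinarith [Real.sq_sqrt hx]
  rw [h, abs_mul, abs_of_nonneg (by positivity : 0 ≤ √x + 1)]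
  have := Real.sqrt_nonneg x
  exact le_mul_of_one_le_right (abs_nonneg _) (by linarith)

theorem abs_mul_profile_sub_le (hkK : ∀ s, |k s| ≤ K) (hε : 0 ≤ ε) {p : ℝ × ℝ}
    (hp : p ∈ straightStrip I) {b B : ℝ} (hb : |b| ≤ 2) (hB : |b - 1| ≤ B) :
    |b * profile k ε p - J₁ p.2| ≤ ε * K + B := by
  have h1 := abs_weight_le hkK hε hp
  have e : b * profile k ε p - J₁ p.2 = (b * (ε / 2 * k p.1 * p.2) + (b - 1)) * J₁ p.2 := by
    rw [profile]
    ring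
  rw [e, abs_mul]
  have h2 : |b * (ε / 2 * k p.1 * p.2) + (b - 1)| ≤ ε * K + B := by
    refine (abs_add_le _ _).trans (add_le_add ?_ hB)
    rw [abs_mul]
    have := mul_le_mul hb h1 (abs_nonneg _) (by norm_num)
    linarith
  exact (mul_le_of_le_one_right (abs_nonneg _) (abs_J₁_le _)).trans h2

/-- Collecting the terms of the residual. -/
theorem residual_bound {K ε D σ Θ X Y v N₁ N₂ N₃ N₄ N₅ N₆ : ℝ} (hK : 0 ≤ K) (hε : 0 < ε)
    (hD : 0 ≤ D) (hσ : 0 ≤ σ) (hΘ : 0 ≤ Θ) (hX : 0 ≤ X) (hY : 0 ≤ Y) (hv : 0 ≤ v)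
    (n1 : N₁ ≤ Y * ((4 * ε * K + 2 * ε * D) * Θ)) (n2 : N₂ ≤ v * (8 * σ * Θ))
    (n3 : N₃ ≤ v * (8 * K ^ 2 * Θ)) (n4 : N₄ ≤ X * (4 * (ε * K) * Θ))
    (n5 : N₅ ≤ X * (ε * K * Θ) + v * Θ) (n6 : N₆ ≤ X * (K * (2 * σ * Θ))) :
    N₅ + N₁ + ε⁻¹ * N₂ + N₃ + 1 / 4 * N₆ + N₄ ≤
      10 * (K + 1) ^ 2 * (ε + ε * D + σ) * Θ * (X + Y + ε⁻¹ * v) := by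
  have hi : 0 < ε⁻¹ := inv_pos.2 hε
  -- The weight ε⁻¹ on the orthogonal part absorbs the ε⁻¹ in front of N₂ and yields a factor ε in
  -- N₃ and N₅.
  obtain ⟨n, hn, hn0⟩ : ∃ n, v = ε * n ∧ 0 ≤ n := ⟨ε⁻¹ * v, by field_simp, by positivity⟩
  have hvn : ε⁻¹ * v = n := by rw [hn]; field_simp
  have n2' : ε⁻¹ * N₂ ≤ n * (8 * σ * Θ) := by
    rw [← hvn, mul_assoc]
    gcongr
  rw [hvn]
  rw [hn] at n3 n5
  have hsum : N₅ + N₁ + ε⁻¹ * N₂ + N₃ + 1 / 4 * N₆ + N₄ ≤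
      Θ * (X * (5 * (ε * K) + K * σ / 2) + Y * (4 * ε * K + 2 * ε * D) +
        n * (ε + 8 * σ + 8 * K ^ 2 * ε)) := by
    linarith
  refine hsum.trans ?_
  obtain ⟨η, hη⟩ : ∃ η, η = ε + ε * D + σ := ⟨_, rfl⟩
  have hεD : 0 ≤ ε * D := by positivity
  have hη0 : 0 ≤ η := by rw [hη]; positivity
  have hεη : ε ≤ η := by linarith
  have hDη : ε * D ≤ η := by linarith
  have hση : σ ≤ η := by linarith
  have hKη : 0 ≤ K * η := by positivity
  have hKKη : 0 ≤ K ^ 2 * η := by positivity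
  have k1 : ε * K ≤ K * η := by rw [mul_comm]; gcongr
  have k2 : K * σ ≤ K * η := by gcongr
  have k3 : K ^ 2 * ε ≤ K ^ 2 * η := by gcongr
  have e : 10 * (K + 1) ^ 2 * η = 10 * (K ^ 2 * η) + 20 * (K * η) + 10 * η := by ring
  have d1 : 5 * (ε * K) + K * σ / 2 ≤ 10 * (K + 1) ^ 2 * η := by linarith
  have d2 : 4 * ε * K + 2 * ε * D ≤ 10 * (K + 1) ^ 2 * η := by linarith
  have d3 : ε + 8 * σ + 8 * K ^ 2 * ε ≤ 10 * (K + 1) ^ 2 * η := by linarith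
  rw [← hη]
  calc _ ≤ Θ * (X * (10 * (K + 1) ^ 2 * η) + Y * (10 * (K + 1) ^ 2 * η) +
        n * (10 * (K + 1) ^ 2 * η)) := by gcongr
    _ = _ := by ring

set_option maxHeartbeats 1000000 in
/-- The trial function solves the equation of the resolvent up to a small error. -/
theorem norm_residual_le (hΓ : IsRegularCurve I Γ K) (hk : Measurable k) (hkK : ∀ s, |k s| ≤ K)
    (hdk : EssBdd I (fun s => (dk s : ℂ)) D) (hε : 0 < ε) (hεK : ε * K ≤ 1 / 10)
    {q : L2 I × (Fin 1 → L2 I)} {f : L2 (straightStrip I)} {Θ σ : ℝ}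
    (hq : ∀ ξ ∈ sobolevZero axisLine I, inner ℂ (ξ.2 0) (q.2 0) +
      inner ℂ ξ.1 (mulL I (fun s => ((-(curvature I Γ s ^ 2 / 4) : ℝ) : ℂ)) q.1) -
        Complex.I * inner ℂ ξ.1 q.1 = inner ℂ ξ.1 (tensorAdj I f))
    (hfΘ : ‖f‖ ≤ Θ) (hq1 : ‖q.1‖ ≤ Θ) (hq2 : ‖q.2 0‖ ≤ Θ) (hσ : 0 ≤ σ)
    (hqσ : ‖mulL I (fun s => ((k s - curvature I Γ s : ℝ) : ℂ)) q.1‖ ≤ 2 * σ * Θ)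
    {χ : L2 (straightStrip I) × (Fin 2 → L2 (straightStrip I))}
    (hχ : χ ∈ sobolevZero axisPlane (straightStrip I)) :
    ‖inner ℂ χ.1 (stripMul I (fun p => √(jacobian I Γ ε p)) f) -
      (inner ℂ (χ.2 0) (stripMul I (fun p => (jacobian I Γ ε p)⁻¹) (trialGrad I k dk ε q 0)) +
        ((ε : ℂ) ^ 2)⁻¹ * inner ℂ (χ.2 1) (stripMul I (jacobian I Γ ε) (trialGrad I k dk ε q 1)) -
        (((ε : ℂ) ^ 2)⁻¹ * E₁ + Complex.I) * inner ℂ χ.1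
          (stripMul I (jacobian I Γ ε) (stripMul I (profile k ε) (lift I q.1))))‖ ≤
      10 * (K + 1) ^ 2 * (ε + ε * D + σ) * Θ *
        (‖χ.1‖ + ‖χ.2 0‖ + ε⁻¹ * ‖χ.1 - tensorJ₁ I (tensorAdj I χ.1)‖) := by
  have hI := hΓ.isOpen
  have hK := hΓ.nonneg
  have hΘ : 0 ≤ Θ := (norm_nonneg _).trans hfΘ
  have hD : 0 ≤ D := hdk.2.1
  have hκm := hΓ.measurable_curvature
  have hκ := hΓ.curvature_le
  have hh := hΓ.stripBdd_jacobian hε.le hεK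
  have hhi := hΓ.stripBdd_jacobian_inv hε.le hεK
  have hs := hΓ.stripBdd_sqrt hε.le hεK
  have hp := stripBdd_profile (I := I) hk hkK hε.le hεK
  have ek : EssBdd I (fun s => (k s : ℂ)) K := essBdd_of_measurable hk hkK
  have eκ : EssBdd I (fun s => (curvature I Γ s : ℂ)) K := essBdd_of_measurable hκm hκ
  have ekκ : EssBdd I (fun s => ((k s - curvature I Γ s : ℝ) : ℂ)) (K + K) := by
    simpa only [Complex.ofReal_sub] using ek.sub eκ
  have ekκ' : EssBdd I (fun s => ((k s * curvature I Γ s : ℝ) : ℂ)) (K * K) := by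
    simpa only [Complex.ofReal_mul] using ek.mul eκ
  have eV : EssBdd I (fun s => ((-(curvature I Γ s ^ 2 / 4) : ℝ) : ℂ)) (K ^ 2 / 4) := by
    refine essBdd_of_measurable (by fun_prop) fun s => ?_
    rw [abs_neg, abs_of_nonneg (by positivity)]
    have := sq_le_sq' (abs_le.1 (hκ s)).1 (abs_le.1 (hκ s)).2
    linarith
  have hjac : ∀ p ∈ straightStrip I, |jacobian I Γ ε p - 1| ≤ ε * K := fun p hp =>
    hΓ.jacobian_bounds hε.le hp.2
  have hεK0 : 0 ≤ ε * K := by positivity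
  set θ := q.1 with hθ
  set ζ := mulL I (fun s => ((k s - curvature I Γ s : ℝ) : ℂ)) θ with hζ
  set υ := mulL I (fun s => ((k s * curvature I Γ s : ℝ) : ℂ)) θ with hυ
  set V := mulL I (fun s => ((-(curvature I Γ s ^ 2 / 4) : ℝ) : ℂ)) θ with hV
  set v := χ.1 - tensorJ₁ I (tensorAdj I χ.1) with hv
  set G := trialGrad I k dk ε q with hG
  -- The residual splits into six errors: a1 from the longitudinal form, a2 from k − κ at order ε⁻¹,
  -- a3 from the remainder beyond its J₁-component, a4 from the mass term, a5 from the right-hand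
  -- side, a6 from replacing kκ by κ².
  set a1 := inner ℂ (χ.2 0) (stripMul I (fun p => (jacobian I Γ ε p)⁻¹) (G 0)) -
    inner ℂ (tensorAdj I (χ.2 0)) (q.2 0) with ha1
  set a2 := inner ℂ χ.1 (stripMul I (fun p => dJ₁ p.2) (lift I ζ)) with ha2
  set a3 := inner ℂ χ.1 (stripMul I (fun p => remainderProfile p.2) (lift I υ)) -
    ((-1 / 4 : ℝ) : ℂ) * inner ℂ (tensorAdj I χ.1) υ with ha3
  set a4 := inner ℂ χ.1 (stripMul I (jacobian I Γ ε) (stripMul I (profile k ε) (lift I θ))) -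
    inner ℂ (tensorAdj I χ.1) θ with ha4
  set a5 := inner ℂ χ.1 (stripMul I (fun p => √(jacobian I Γ ε p)) f) -
    inner ℂ (tensorAdj I χ.1) (tensorAdj I f) with ha5
  set a6 := inner ℂ (tensorAdj I χ.1) (mulL I (fun s => (curvature I Γ s : ℂ)) ζ) with ha6
  have htr : ((ε : ℂ) ^ 2)⁻¹ * inner ℂ (χ.2 1) (stripMul I (jacobian I Γ ε) (G 1)) -
      ((ε : ℂ) ^ 2)⁻¹ * E₁ * inner ℂ χ.1
        (stripMul I (jacobian I Γ ε) (stripMul I (profile k ε) (lift I θ))) = _ :=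
    transverse_form_trial hΓ hk hkK hε hεK θ hχ
  -- The transverse average of χ is a legitimate test function for the effective equation.
  have hweak : inner ℂ (tensorAdj I (χ.2 0)) (q.2 0) + inner ℂ (tensorAdj I χ.1) V -
      Complex.I * inner ℂ (tensorAdj I χ.1) θ = inner ℂ (tensorAdj I χ.1) (tensorAdj I f) :=
    hq _ (adjoint_tensorJ₁_mem_sobolevZero hI hχ)
  -- kκ = κ(k − κ) + κ², and κ²θ = −4V; the coefficient −1/4 of the remainder turns this into
  -- exactly V.
  have hυV : υ = mulL I (fun s => (curvature I Γ s : ℂ)) ζ - (4 : ℂ) • V := by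
    refine Lp.ext ?_
    filter_upwards [mulL_ae ekκ' θ, mulL_ae eκ ζ, mulL_ae ekκ θ, mulL_ae eV θ,
      Lp.coeFn_sub (mulL I (fun s => (curvature I Γ s : ℂ)) ζ) ((4 : ℂ) • V),
      Lp.coeFn_smul (4 : ℂ) V] with s c1 c2 c3 c4 c5 c6
    rw [c1, c5, Pi.sub_apply, c6, Pi.smul_apply, c2, c3, c4, smul_eq_mul]
    push_cast
    ring
  have hυi : inner ℂ (tensorAdj I χ.1) υ = a6 - 4 * inner ℂ (tensorAdj I χ.1) V := by
    rw [hυV, inner_sub_right, inner_smul_right]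
  have key : inner ℂ χ.1 (stripMul I (fun p => √(jacobian I Γ ε p)) f) -
      (inner ℂ (χ.2 0) (stripMul I (fun p => (jacobian I Γ ε p)⁻¹) (G 0)) +
        ((ε : ℂ) ^ 2)⁻¹ * inner ℂ (χ.2 1) (stripMul I (jacobian I Γ ε) (G 1)) -
        (((ε : ℂ) ^ 2)⁻¹ * E₁ + Complex.I) * inner ℂ χ.1
          (stripMul I (jacobian I Γ ε) (stripMul I (profile k ε) (lift I θ)))) =
      a5 - a1 + (ε : ℂ)⁻¹ * a2 - a3 + (1 / 4 : ℂ) * a6 + Complex.I * a4 := by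
    rw [ha1, ha3, ha4, ha5, hυi]
    push_cast
    linear_combination -htr - hweak
  rw [key]
  have n1 : ‖a1‖ ≤ ‖χ.2 0‖ * ((4 * ε * K + 2 * ε * D) * Θ) := by
    rw [ha1, ← inner_tensorJ₁_right, ← inner_sub_right]
    refine (norm_inner_le_norm _ _).trans ?_
    gcongr
    set X := stripMul I (fun p => dk p.1 * (ε / 2 * (p.2 * J₁ p.2))) (lift I θ)
    have e0 : G 0 = stripMul I (profile k ε) (lift I (q.2 0)) + X := rfl
    have e1 : stripMul I (fun p => (jacobian I Γ ε p)⁻¹) (stripMul I (profile k ε) (lift I (q.2 0))) =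
        stripMul I (fun p => (jacobian I Γ ε p)⁻¹ * profile k ε p) (lift I (q.2 0)) :=
      stripMul_stripMul hI hhi hp (fun _ _ => rfl) _
    rw [e0, map_add, e1, add_sub_right_comm]
    refine (norm_add_le _ _).trans ?_
    have b1 := norm_stripMul_lift_sub_tensor_le hI (hhi.mul hp).1
      (C := 2 * (ε * K)) (by positivity) (fun p hpI => by
        have hj := hjac p hpI
        have hpos := hΓ.jacobian_pos hε.le hεK hpI.2
        have hj9 : 9 / 10 ≤ jacobian I Γ ε p := by linarith [(abs_le.1 hj).1]
        have h1 := abs_weight_le hkK hε.le hpI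
        have e : (jacobian I Γ ε p)⁻¹ * profile k ε p - J₁ p.2 =
            (jacobian I Γ ε p)⁻¹ * (ε / 2 * k p.1 * p.2 - (jacobian I Γ ε p - 1)) * J₁ p.2 := by
          rw [profile]
          field_simp
          ring
        rw [e, abs_mul]
        refine (mul_le_of_le_one_right (abs_nonneg _) (abs_J₁_le _)).trans ?_
        rw [abs_mul, abs_of_pos (inv_pos.2 hpos), inv_mul_le_iff₀ hpos]
        have h2 := abs_sub (ε / 2 * k p.1 * p.2) (jacobian I Γ ε p - 1)
        nlinarith) (q.2 0)
    have b2 : ‖stripMul I (fun p => (jacobian I Γ ε p)⁻¹) X‖ ≤ 2 * (D * (ε / 2) * (2 * ‖θ‖)) := by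
      refine (norm_stripMul_le hI hhi X).trans ?_
      gcongr
      refine (norm_mulL_le (essBdd_deriv_profile hdk hε.le) (lift I θ)).trans ?_
      gcongr
      exact norm_lift_le θ
    have b3 : 2 * (2 * (ε * K)) * ‖q.2 0‖ ≤ 2 * (2 * (ε * K)) * Θ := by gcongr
    have b4 : 2 * (D * (ε / 2) * (2 * ‖θ‖)) ≤ 2 * (D * (ε / 2) * (2 * Θ)) := by gcongr
    linarith
  -- Since J₁′ is orthogonal to J₁, only the orthogonal part of χ enters; its weight ε⁻¹ pays for
  -- the prefactor ε⁻¹ of a2.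
  have n2 : ‖a2‖ ≤ ‖v‖ * (8 * σ * Θ) := by
    have := norm_inner_mulL_snd_lift_sub_le dJ₁_continuous.measurable (C := 2) (by norm_num)
      (fun t _ => abs_dJ₁_le t) χ.1 ζ
    rw [integral_J₁_mul_dJ₁, Complex.ofReal_zero, zero_mul, sub_zero] at this
    refine this.trans (mul_le_mul_of_nonneg_left ?_ (norm_nonneg _))
    linarith
  have n3 : ‖a3‖ ≤ ‖v‖ * (8 * K ^ 2 * Θ) := by
    have := norm_inner_mulL_snd_lift_sub_le remainderProfile_continuous.measurable (C := 4)
      (by norm_num) (fun t ht => abs_remainderProfile_le ht) χ.1 υ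
    rw [integral_J₁_mul_remainderProfile] at this
    refine this.trans (mul_le_mul_of_nonneg_left ?_ (norm_nonneg _))
    have h1 : ‖υ‖ ≤ K * K * Θ := (norm_mulL_le ekκ' θ).trans (by gcongr)
    linarith
  have n4 : ‖a4‖ ≤ ‖χ.1‖ * (4 * (ε * K) * Θ) := by
    have e1 : stripMul I (jacobian I Γ ε) (stripMul I (profile k ε) (lift I θ)) =
        stripMul I (fun p => jacobian I Γ ε p * profile k ε p) (lift I θ) :=
      stripMul_stripMul hI hh hp (fun _ _ => rfl) _
    rw [ha4, e1, ← inner_tensorJ₁_right, ← inner_sub_right]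
    refine (norm_inner_le_norm _ _).trans ?_
    gcongr
    have b1 := norm_stripMul_lift_sub_tensor_le hI (hh.mul hp).1 (C := ε * K + ε * K)
      (by positivity) (fun p hpI => abs_mul_profile_sub_le hkK hε.le hpI (hh.2.2 p hpI)
        (hjac p hpI)) θ
    refine b1.trans ?_
    have : 2 * (ε * K + ε * K) * ‖θ‖ ≤ 2 * (ε * K + ε * K) * Θ := by gcongr
    linarith
  -- The component of `f` orthogonal to the ground state pairs only with v, which is of order ε in
  -- the norm N.
  have n5 : ‖a5‖ ≤ ‖χ.1‖ * (ε * K * Θ) + ‖v‖ * Θ := by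
    have e1 : stripMul I (fun p => √(jacobian I Γ ε p)) f =
        f + stripMul I (fun p => √(jacobian I Γ ε p) - 1) f := by
      have : mulL (straightStrip I) (fun p => (√(jacobian I Γ ε p) : ℂ) - 1) f =
        stripMul I (fun p => √(jacobian I Γ ε p)) f - mulL (straightStrip I) (fun _ => 1) f :=
        mulL_sub (hs.essBdd hI) (EssBdd.const 1) f
      rw [mulL_one] at this
      simp only [stripMul, Complex.ofReal_sub, Complex.ofReal_one]
      rw [this]
      abel
    have e2 : a5 = inner ℂ v f + inner ℂ χ.1 (stripMul I (fun p => √(jacobian I Γ ε p) - 1) f) := by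
      rw [ha5, e1, hv, inner_sub_left, inner_add_right, inner_tensorJ₁_left]
      ring
    have sb : StripBdd I (fun p => √(jacobian I Γ ε p) - 1) (ε * K) :=
      ⟨hs.1.sub_const 1, hεK0, fun p hpI => (abs_sqrt_sub_one_le
        (hΓ.jacobian_pos hε.le hεK hpI.2).le).trans (hjac p hpI)⟩
    rw [e2, add_comm]
    refine (norm_add_le _ _).trans (add_le_add ?_ ?_)
    · refine (norm_inner_le_norm _ _).trans ?_
      gcongr
      exact (norm_stripMul_le hI sb f).trans (by gcongr)
    · refine (norm_inner_le_norm _ _).trans ?_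
      gcongr
  have n6 : ‖a6‖ ≤ ‖χ.1‖ * (K * (2 * σ * Θ)) := by
    refine (norm_inner_le_norm _ _).trans ?_
    gcongr
    · exact norm_tensorAdj_le _
    · exact (norm_mulL_le eκ ζ).trans (by gcongr)
  have htri : ‖a5 - a1 + (ε : ℂ)⁻¹ * a2 - a3 + (1 / 4 : ℂ) * a6 + Complex.I * a4‖ ≤
      ‖a5‖ + ‖a1‖ + ε⁻¹ * ‖a2‖ + ‖a3‖ + 1 / 4 * ‖a6‖ + ‖a4‖ := by
    refine (norm_add_le _ _).trans (add_le_add ((norm_add_le _ _).trans (add_le_add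
      ((norm_sub_le _ _).trans (add_le_add_left ((norm_add_le _ _).trans (add_le_add
        (norm_sub_le _ _) ?_)) _)) ?_)) ?_)
    · rw [norm_mul, norm_inv, Complex.norm_real, Real.norm_eq_abs, abs_of_pos hε]
    · rw [norm_mul]
      norm_num
    · rw [norm_mul, Complex.norm_I, one_mul]
  exact htri.trans (residual_bound hK hε hD hσ hΘ (norm_nonneg _) (norm_nonneg _) (norm_nonneg _)
    n1 n2 n3 n4 n5 n6)

end Consistency

/-! ### Coercivity and the norm-resolvent estimate -/

section Coercivity

variable {I : Set ℝ} {Γ : ℝ → ℝ × ℝ} {K ε : ℝ}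

theorem norm_sq_le_re_inner_stripMul (hI : IsOpen I) {b c c' : ℝ × ℝ → ℝ} {C C' : ℝ}
    (hc : StripBdd I c C) (hc' : StripBdd I c' C') (hb : ∀ p ∈ straightStrip I, c p * c p = b p)
    (hcc' : ∀ p ∈ straightStrip I, c' p * c p = 1) (ψ : L2 (straightStrip I)) :
    ‖ψ‖ ^ 2 ≤ C' ^ 2 * (inner ℂ ψ (stripMul I b ψ)).re := by
  have h1 : (inner ℂ ψ (stripMul I b ψ)).re = ‖stripMul I c ψ‖ ^ 2 := by
    rw [← stripMul_stripMul hI hc hc hb, ← inner_stripMul hI hc]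
    exact (norm_sq_eq_re_inner (𝕜 := ℂ) (stripMul I c ψ)).symm
  have h2 : ψ = stripMul I c' (stripMul I c ψ) := by
    rw [stripMul_stripMul hI hc' hc hcc']
    simp only [stripMul, Complex.ofReal_one]
    rw [mulL_one]
  have h3 : ‖ψ‖ ≤ C' * ‖stripMul I c ψ‖ := by
    conv_lhs => rw [h2]
    exact norm_stripMul_le hI hc' _
  rw [h1, ← mul_pow]
  gcongr

/-- `h4` comes from the imaginary part of the form and `h5` from the real part. After division by ε²
the error (εK)² X² of the gap estimate becomes K² X², which `h4` controls. -/
theorem coercivity_bound {K ε Q X Y v h g a : ℝ} (hε : 0 < ε)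
    (h1 : X ^ 2 ≤ 2 ^ 2 * h) (h2 : Y ^ 2 ≤ 2 ^ 2 * g)
    (h3 : 1 / 2 * v ^ 2 - 10 * (ε * K) ^ 2 * X ^ 2 ≤ a - E₁ * h)
    (h4 : h ≤ Q) (h5 : g + (ε ^ 2)⁻¹ * a - (ε ^ 2)⁻¹ * E₁ * h ≤ Q) :
    (X + Y + ε⁻¹ * v) ^ 2 ≤ (30 + 720 * K ^ 2) * Q := by
  obtain ⟨n, hn⟩ : ∃ n, v = ε * n := ⟨ε⁻¹ * v, by field_simp⟩
  have hvn : ε⁻¹ * v = n := by rw [hn]; field_simp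
  rw [hvn]
  have hi : 0 < (ε ^ 2)⁻¹ := by positivity
  have h6 := mul_le_mul_of_nonneg_left h3 hi.le
  have e : (ε ^ 2)⁻¹ * (1 / 2 * v ^ 2 - 10 * (ε * K) ^ 2 * X ^ 2) =
      1 / 2 * n ^ 2 - 10 * K ^ 2 * X ^ 2 := by
    rw [hn]
    field_simp
  rw [e] at h6
  have h7 : K ^ 2 * X ^ 2 ≤ K ^ 2 * (4 * Q) := mul_le_mul_of_nonneg_left (by linarith) (sq_nonneg _)
  have h8 : 1 / 4 * Y ^ 2 + 1 / 2 * n ^ 2 ≤ Q + 40 * (K ^ 2 * Q) := by linarith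
  have h9 : (X + Y + n) ^ 2 ≤ 3 * (X ^ 2 + Y ^ 2 + n ^ 2) := by
    nlinarith [sq_nonneg (X - Y), sq_nonneg (Y - n), sq_nonneg (X - n)]
  have hQ : 0 ≤ Q := by nlinarith [sq_nonneg X]
  have h10 : 0 ≤ K ^ 2 * Q := by positivity
  nlinarith [sq_nonneg Y, sq_nonneg n]

/-- On the diagonal the three pairings are real, so the imaginary part of the form is −⟨d, h d⟩ and
its real part is the shifted energy. -/
theorem coercivity (hΓ : IsRegularCurve I Γ K) (hε : 0 < ε) (hεK : ε * K ≤ 1 / 10)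
    {d : L2 (straightStrip I) × (Fin 2 → L2 (straightStrip I))}
    (hd : d ∈ sobolevZero axisPlane (straightStrip I)) :
    (‖d.1‖ + ‖d.2 0‖ + ε⁻¹ * ‖d.1 - tensorJ₁ I (tensorAdj I d.1)‖) ^ 2 ≤ (30 + 720 * K ^ 2) *
      ‖inner ℂ (d.2 0) (stripMul I (fun p => (jacobian I Γ ε p)⁻¹) (d.2 0)) +
        ((ε : ℂ) ^ 2)⁻¹ * inner ℂ (d.2 1) (stripMul I (jacobian I Γ ε) (d.2 1)) -
        (((ε : ℂ) ^ 2)⁻¹ * E₁ + Complex.I) * inner ℂ d.1 (stripMul I (jacobian I Γ ε) d.1)‖ := by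
  have hI := hΓ.isOpen
  have hh := hΓ.stripBdd_jacobian hε.le hεK
  have hhi := hΓ.stripBdd_jacobian_inv hε.le hεK
  have hs := hΓ.stripBdd_sqrt hε.le hεK
  have hsi := hΓ.stripBdd_sqrt_inv hε.le hεK
  have hsq : ∀ p ∈ straightStrip I, √(jacobian I Γ ε p) ≠ 0 ∧
      √(jacobian I Γ ε p) * √(jacobian I Γ ε p) = jacobian I Γ ε p := by
    intro p hp
    have hpos := hΓ.jacobian_pos hε.le hεK hp.2
    exact ⟨(Real.sqrt_pos.2 hpos).ne', Real.mul_self_sqrt hpos.le⟩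
  have h1 := norm_sq_le_re_inner_stripMul hI hs hsi (fun p hp => (hsq p hp).2)
    (fun p hp => inv_mul_cancel₀ (hsq p hp).1) d.1
  have h2 := norm_sq_le_re_inner_stripMul hI hsi hs (b := fun p => (jacobian I Γ ε p)⁻¹)
    (fun p hp => by rw [← mul_inv, (hsq p hp).2]) (fun p hp => mul_inv_cancel₀ (hsq p hp).1) (d.2 0)
  have h3 := transverse_form_ge
    (essBdd_of_measurable (I := I) hΓ.measurable_curvature hΓ.curvature_le) hε.le hεK hd
  have i1 := inner_mulL_self_im (hhi.essBdd hI) (d.2 0)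
  have i2 := inner_mulL_self_im (hh.essBdd hI) (d.2 1)
  have i3 := inner_mulL_self_im (hh.essBdd hI) d.1
  change (inner ℂ (d.2 0) (stripMul I (fun p => (jacobian I Γ ε p)⁻¹) (d.2 0))).im = 0 at i1
  change (inner ℂ (d.2 1) (stripMul I (jacobian I Γ ε) (d.2 1))).im = 0 at i2
  change (inner ℂ d.1 (stripMul I (jacobian I Γ ε) d.1)).im = 0 at i3
  change _ ≤ (inner ℂ (d.2 1) (stripMul I (jacobian I Γ ε) (d.2 1))).re -
    E₁ * (inner ℂ d.1 (stripMul I (jacobian I Γ ε) d.1)).re at h3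
  generalize inner ℂ (d.2 0) (stripMul I (fun p => (jacobian I Γ ε p)⁻¹) (d.2 0)) = g at *
  generalize inner ℂ (d.2 1) (stripMul I (jacobian I Γ ε) (d.2 1)) = a at *
  generalize inner ℂ d.1 (stripMul I (jacobian I Γ ε) d.1) = h at *
  have eg : g = (g.re : ℂ) := Complex.ext rfl (by simpa using i1)
  have ea : a = (a.re : ℂ) := Complex.ext rfl (by simpa using i2)
  have eh : h = (h.re : ℂ) := Complex.ext rfl (by simpa using i3)
  have hz : g + ((ε : ℂ) ^ 2)⁻¹ * a - (((ε : ℂ) ^ 2)⁻¹ * E₁ + Complex.I) * h =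
      ((g.re + (ε ^ 2)⁻¹ * a.re - (ε ^ 2)⁻¹ * E₁ * h.re : ℝ) : ℂ) + ((-h.re : ℝ) : ℂ) * Complex.I := by
    conv_lhs => rw [eg, ea, eh]
    push_cast
    ring
  rw [hz]
  refine coercivity_bound hε h1 h2 h3 ?_ ?_
  · have := Complex.abs_im_le_norm (((g.re + (ε ^ 2)⁻¹ * a.re - (ε ^ 2)⁻¹ * E₁ * h.re : ℝ) : ℂ) +
      ((-h.re : ℝ) : ℂ) * Complex.I)
    rw [Complex.add_im, Complex.ofReal_im, Complex.im_ofReal_mul, Complex.I_im, mul_one,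
      zero_add, abs_neg] at this
    exact (le_abs_self _).trans this
  · have := Complex.abs_re_le_norm (((g.re + (ε ^ 2)⁻¹ * a.re - (ε ^ 2)⁻¹ * E₁ * h.re : ℝ) : ℂ) +
      ((-h.re : ℝ) : ℂ) * Complex.I)
    rw [Complex.add_re, Complex.ofReal_re, Complex.re_ofReal_mul, Complex.I_re, mul_zero,
      add_zero] at this
    exact (le_abs_self _).trans this

end Coercivity

/-! ### The norm-resolvent estimate -/

section Main

variable {I : Set ℝ} {Γ : ℝ → ℝ × ℝ} {K ε δ : ℝ}

/-- Test the equation with its solution: the imaginary part bounds the function, and then the real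
part bounds the derivative, the potential costing K²/4. -/
theorem norm_le_of_weak_solution (hΓ : IsRegularCurve I Γ K) {q : L2 I × (Fin 1 → L2 I)} {u : L2 I}
    (h : inner ℂ (q.2 0) (q.2 0) +
      inner ℂ q.1 (mulL I (fun s => ((-(curvature I Γ s ^ 2 / 4) : ℝ) : ℂ)) q.1) -
        Complex.I * inner ℂ q.1 q.1 = inner ℂ q.1 u) :
    ‖q.1‖ ≤ ‖u‖ ∧ ‖q.2 0‖ ≤ (K + 1) * ‖u‖ := by
  have hK := hΓ.nonneg
  have hκm := hΓ.measurable_curvature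
  have eV : EssBdd I (fun s => ((-(curvature I Γ s ^ 2 / 4) : ℝ) : ℂ)) (K ^ 2 / 4) := by
    refine essBdd_of_measurable (by fun_prop) fun s => ?_
    rw [abs_neg, abs_of_nonneg (by positivity)]
    have := sq_le_sq' (abs_le.1 (hΓ.curvature_le s)).1 (abs_le.1 (hΓ.curvature_le s)).2
    linarith
  set V := mulL I (fun s => ((-(curvature I Γ s ^ 2 / 4) : ℝ) : ℂ)) q.1
  have hVim : (inner ℂ q.1 V).im = 0 := inner_mulL_self_im eV q.1
  have hVn : ‖inner ℂ q.1 V‖ ≤ ‖q.1‖ * (K ^ 2 / 4 * ‖q.1‖) :=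
    (norm_inner_le_norm _ _).trans (by gcongr; exact norm_mulL_le eV q.1)
  have hun : ‖inner ℂ q.1 u‖ ≤ ‖q.1‖ * ‖u‖ := norm_inner_le_norm _ _
  have s1 : inner ℂ q.1 q.1 = ((‖q.1‖ ^ 2 : ℝ) : ℂ) := by
    rw [inner_self_eq_norm_sq_to_K]
    push_cast
    rfl
  have s2 : inner ℂ (q.2 0) (q.2 0) = ((‖q.2 0‖ ^ 2 : ℝ) : ℂ) := by
    rw [inner_self_eq_norm_sq_to_K]
    push_cast
    rfl
  rw [s1, s2] at h
  have him := congrArg Complex.im h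
  have hre := congrArg Complex.re h
  rw [Complex.sub_im, Complex.add_im, Complex.ofReal_im, hVim, Complex.im_mul_ofReal, Complex.I_im]
    at him
  rw [Complex.sub_re, Complex.add_re, Complex.ofReal_re, Complex.re_mul_ofReal, Complex.I_re] at hre
  have a1 := (abs_le.1 ((Complex.abs_im_le_norm (inner ℂ q.1 u)).trans hun)).1
  have a2 := (abs_le.1 ((Complex.abs_re_le_norm (inner ℂ q.1 u)).trans hun)).2
  have a3 := (abs_le.1 ((Complex.abs_re_le_norm (inner ℂ q.1 V)).trans hVn)).1
  have hq0 : 0 ≤ ‖q.1‖ := norm_nonneg _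
  have b1 : ‖q.1‖ ≤ ‖u‖ := by
    rcases hq0.eq_or_lt with h0 | h0
    · rw [← h0]
      exact norm_nonneg _
    · nlinarith
  refine ⟨b1, ?_⟩
  have hu0 : 0 ≤ ‖u‖ := norm_nonneg _
  have b2 : ‖q.1‖ * ‖u‖ ≤ ‖u‖ * ‖u‖ := by gcongr
  have b3 : ‖q.1‖ * (K ^ 2 / 4 * ‖q.1‖) ≤ ‖u‖ * (K ^ 2 / 4 * ‖u‖) := by gcongr
  refine abs_le_of_sq_le_sq' ?_ (by positivity) |>.2
  nlinarith [mul_nonneg hK (mul_nonneg hu0 hu0), mul_nonneg (mul_nonneg hK hK) (mul_nonneg hu0 hu0)]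

/-- The constant in the resolvent estimate. -/
def resolventConst (K : ℝ) : ℝ := 2 * ((30 + 720 * K ^ 2) * (10 * (K + 1) ^ 3)) + 4 * K * (K + 1) + 1

/-- The difference d = u − Φ lies in the form domain, and b(d, d) is the residual of Φ tested with
d. Coercivity and the residual bound give N(d)² ≤ C η ‖f‖ N(d), and one factor N(d) is divided out.
-/
theorem norm_resolvent_sub_le (hΓ : IsRegularCurve I Γ K) (hε : 0 < ε) (hεK : ε * K ≤ 1 / 10)
    (hinj : InjOn (stripMap Γ ε) (straightStrip I)) (hδ : 0 < δ)
    {U : L2 (curvedStrip I Γ ε) ≃ₗᵢ[ℂ] L2 (straightStrip I)} (hU : IsStripTransform I Γ ε U)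
    {f : L2 (straightStrip I)} {ψ : L2 (curvedStrip I Γ ε)}
    {g : Fin 2 → L2 (curvedStrip I Γ ε)}
    (hg : (ψ, g) ∈ sobolevZero axisPlane (curvedStrip I Γ ε))
    (hψ : ∀ φ k, (φ, k) ∈ sobolevZero axisPlane (curvedStrip I Γ ε) →
      ∑ i, inner ℂ (k i) (g i) - (((ε : ℂ) ^ 2)⁻¹ * E₁ + Complex.I) * inner ℂ φ ψ =
        inner ℂ φ (U.symm f))
    {q : L2 I × (Fin 1 → L2 I)} (hq : q ∈ sobolevZero axisLine I)
    (hqw : ∀ ξ ∈ sobolevZero axisLine I, inner ℂ (ξ.2 0) (q.2 0) +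
      inner ℂ ξ.1 (mulL I (fun s => ((-(curvature I Γ s ^ 2 / 4) : ℝ) : ℂ)) q.1) -
        Complex.I * inner ℂ ξ.1 q.1 = inner ℂ ξ.1 (tensorAdj I f)) :
    ‖U ψ - tensorJ₁ I q.1‖ ≤ resolventConst K *
      (ε + ε * supNorm I (deriv (steklov (curvature I Γ) δ)) + modulus (curvature I Γ) δ) * ‖f‖ := by
  have hI := hΓ.isOpen
  have hK := hΓ.nonneg
  have hκm := hΓ.measurable_curvature
  have hκ := hΓ.curvature_le
  set k := steklov (curvature I Γ) δ
  set D := supNorm I (deriv k)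
  set σ := modulus (curvature I Γ) δ
  have hσ : 0 ≤ σ := modulus_nonneg _ _
  have hkL := steklov_lipschitz hκm hκ hδ
  have hkm : Measurable k := hkL.continuous.measurable
  have hkK : ∀ s, |k s| ≤ K := abs_steklov_le hκ hδ
  have hdk : EssBdd I (fun s => ((deriv k s : ℝ) : ℂ)) D := essBdd_deriv_steklov hκm hκ hδ I
  have hD : 0 ≤ D := hdk.2.1
  have hkd : ∀ᵐ s ∂volume.restrict I, HasDerivAt k (deriv k s) s := by
    refine ae_restrict_of_ae ?_
    filter_upwards [hkL.ae_differentiableAt] with s hs using hs.hasDerivAt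
  obtain ⟨hq1, hq2⟩ := norm_le_of_weak_solution hΓ (hqw q hq)
  have hAf := norm_tensorAdj_le f
  have hf0 : 0 ≤ ‖f‖ := norm_nonneg _
  have hΘf : ‖f‖ ≤ (K + 1) * ‖f‖ := le_mul_of_one_le_left hf0 (by linarith)
  have hΘ1 : ‖q.1‖ ≤ (K + 1) * ‖f‖ := (hq1.trans hAf).trans hΘf
  have hΘ2 : ‖q.2 0‖ ≤ (K + 1) * ‖f‖ := hq2.trans (by gcongr)
  have hΘ0 : 0 ≤ (K + 1) * ‖f‖ := by positivity
  -- The multiplier estimate needs θ in W₀^{1,2} with function and derivative both at most (K + 1)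
  -- ‖f‖; the two squares under 2σ² give the factor 2σ.
  have hζ : ‖mulL I (fun s => ((k s - curvature I Γ s : ℝ) : ℂ)) q.1‖ ≤ 2 * σ * ((K + 1) * ‖f‖) := by
    have h1 := norm_mulL_steklov_sub_sq_le hκm hκ hδ hq
    refine abs_le_of_sq_le_sq' (h1.trans ?_) (by positivity) |>.2
    have h2 : ‖q.1‖ ^ 2 ≤ ((K + 1) * ‖f‖) ^ 2 := by gcongr
    have h3 : ‖q.2 0‖ ^ 2 ≤ ((K + 1) * ‖f‖) ^ 2 := by gcongr
    calc 2 * σ ^ 2 * (‖q.1‖ ^ 2 + ‖q.2 0‖ ^ 2)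
        ≤ 2 * σ ^ 2 * (((K + 1) * ‖f‖) ^ 2 + ((K + 1) * ‖f‖) ^ 2) := by gcongr
      _ = _ := by ring
  obtain ⟨p, hp, hUψ, hpw⟩ := exists_weak_solution hΓ hε hεK hinj hU hg hψ
  have hΦ := trial_mem_sobolevZero hI hkL hkK hdk hkd hε.le hεK hq
  set Φ := stripMul I (profile k ε) (lift I q.1) with hΦdef
  set G := trialGrad I k (deriv k) ε q with hG
  have hd := sub_mem hp hΦ
  have hres := norm_residual_le hΓ hkm hkK hdk hε hεK hqw hΘf hΘ1 hΘ2 hσ hζ hd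
  have hco := coercivity hΓ hε hεK hd
  rw [← hpw _ hd] at hres
  set d := p - (Φ, G) with hddef
  have d1 : d.1 = p.1 - Φ := rfl
  have d2 : ∀ i, d.2 i = p.2 i - G i := fun i => rfl
  have hBeq : inner ℂ (d.2 0) (stripMul I (fun p => (jacobian I Γ ε p)⁻¹) (d.2 0)) +
        ((ε : ℂ) ^ 2)⁻¹ * inner ℂ (d.2 1) (stripMul I (jacobian I Γ ε) (d.2 1)) -
        (((ε : ℂ) ^ 2)⁻¹ * E₁ + Complex.I) * inner ℂ d.1 (stripMul I (jacobian I Γ ε) d.1) =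
      inner ℂ (d.2 0) (stripMul I (fun p => (jacobian I Γ ε p)⁻¹) (p.2 0)) +
          ((ε : ℂ) ^ 2)⁻¹ * inner ℂ (d.2 1) (stripMul I (jacobian I Γ ε) (p.2 1)) -
          (((ε : ℂ) ^ 2)⁻¹ * E₁ + Complex.I) * inner ℂ d.1 (stripMul I (jacobian I Γ ε) p.1) -
        (inner ℂ (d.2 0) (stripMul I (fun p => (jacobian I Γ ε p)⁻¹) (G 0)) +
          ((ε : ℂ) ^ 2)⁻¹ * inner ℂ (d.2 1) (stripMul I (jacobian I Γ ε) (G 1)) -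
          (((ε : ℂ) ^ 2)⁻¹ * E₁ + Complex.I) * inner ℂ d.1 (stripMul I (jacobian I Γ ε) Φ)) := by
    have e0 : stripMul I (fun p => (jacobian I Γ ε p)⁻¹) (d.2 0) =
        stripMul I (fun p => (jacobian I Γ ε p)⁻¹) (p.2 0) -
          stripMul I (fun p => (jacobian I Γ ε p)⁻¹) (G 0) := by rw [d2, map_sub]
    have e1 : stripMul I (jacobian I Γ ε) (d.2 1) =
        stripMul I (jacobian I Γ ε) (p.2 1) - stripMul I (jacobian I Γ ε) (G 1) := by
      rw [d2, map_sub]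
    have e2 : stripMul I (jacobian I Γ ε) d.1 =
        stripMul I (jacobian I Γ ε) p.1 - stripMul I (jacobian I Γ ε) Φ := by rw [d1, map_sub]
    rw [e0, e1, e2, inner_sub_right, inner_sub_right, inner_sub_right]
    ring
  rw [hBeq] at hco
  have hη0 : 0 ≤ ε + ε * D + σ := by positivity
  have hdn : ‖d.1‖ ≤ (30 + 720 * K ^ 2) * (10 * (K + 1) ^ 2 * (ε + ε * D + σ) * ((K + 1) * ‖f‖)) := by
    have hN : ‖d.1‖ ≤ ‖d.1‖ + ‖d.2 0‖ + ε⁻¹ * ‖d.1 - tensorJ₁ I (tensorAdj I d.1)‖ := by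
      have : 0 ≤ ε⁻¹ * ‖d.1 - tensorJ₁ I (tensorAdj I d.1)‖ := by positivity
      linarith [norm_nonneg (d.2 0)]
    have hN0 := (norm_nonneg d.1).trans hN
    have hA : 0 ≤ 30 + 720 * K ^ 2 := by positivity
    have h1 := hco.trans (mul_le_mul_of_nonneg_left hres hA)
    refine hN.trans ?_
    generalize ‖d.1‖ + ‖d.2 0‖ + ε⁻¹ * ‖d.1 - tensorJ₁ I (tensorAdj I d.1)‖ = N at h1 hN0
    rcases hN0.eq_or_lt with h0 | h0
    · rw [← h0]
      positivity
    · nlinarith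
  have hs := hΓ.stripBdd_sqrt hε.le hεK
  have hpr := stripBdd_profile (I := I) hkm hkK hε.le hεK
  have e1 : stripMul I (fun p => √(jacobian I Γ ε p)) Φ =
      stripMul I (fun p => √(jacobian I Γ ε p) * profile k ε p) (lift I q.1) :=
    stripMul_stripMul hI hs hpr (fun _ _ => rfl) _
  -- Return from u to Uψ = √h u. The last bracket compares √h (1 + ε k t / 2) J₁ with J₁ and costs
  -- only a multiple of ε K.
  have e2 : U ψ - tensorJ₁ I q.1 = stripMul I (fun p => √(jacobian I Γ ε p)) d.1 +
      (stripMul I (fun p => √(jacobian I Γ ε p) * profile k ε p) (lift I q.1) -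
        tensorJ₁ I q.1) := by
    rw [hUψ, ← e1, d1, map_sub]
    abel
  have b1 := norm_stripMul_le hI hs d.1
  have b2 := norm_stripMul_lift_sub_tensor_le hI (hs.mul hpr).1 (C := ε * K + ε * K)
    (by positivity) (fun p hpI => abs_mul_profile_sub_le hkK hε.le hpI (hs.2.2 p hpI)
      ((abs_sqrt_sub_one_le (hΓ.jacobian_pos hε.le hεK hpI.2).le).trans
        (hΓ.jacobian_bounds hε.le hpI.2))) q.1
  rw [e2]
  refine (norm_add_le _ _).trans ?_
  have b3 : 2 * (ε * K + ε * K) * ‖q.1‖ ≤ 4 * K * (ε + ε * D + σ) * ((K + 1) * ‖f‖) := by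
    have : 2 * (ε * K + ε * K) * ‖q.1‖ ≤ 2 * (ε * K + ε * K) * ((K + 1) * ‖f‖) := by gcongr
    refine this.trans (mul_le_mul_of_nonneg_right ?_ hΘ0)
    have hε' : ε ≤ ε + ε * D + σ := by
      have : 0 ≤ ε * D := by positivity
      linarith
    have := mul_le_mul_of_nonneg_left hε' hK
    linarith
  have b4 : 0 ≤ (ε + ε * D + σ) * ‖f‖ := by positivity
  rw [resolventConst]
  linarith

end Main

end Waveguide

end

/-! ### The theorem -/

theorem theorem2 (I : Set ℝ) (hI_open : IsOpen I) (hI_conn : I.OrdConnected) (hI_ne : I.Nonempty)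
    (Γ : ℝ → ℝ × ℝ)
    (hΓ_C1 : ContDiffOn ℝ 1 Γ I)
    (hΓ_unit : ∀ s ∈ I, (tangent Γ s).1 ^ 2 + (tangent Γ s).2 ^ 2 = 1)
    (hΓ_W : MemW2InftyLoc I (fun s => (Γ s).1) ∧ MemW2InftyLoc I (fun s => (Γ s).2))
    (hκ : MemLp (curvature I Γ) ∞ (volume.restrict I))
    (hinj : ∀ᶠ ε in 𝓝[>] (0 : ℝ), InjOn (stripMap Γ ε) (straightStrip I))
    (δ : ℝ → ℝ) (hδ_cont : ContinuousOn δ (Ioi 0)) (hδ_pos : ∀ ε > 0, 0 < δ ε)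
    (hδ_zero : Tendsto δ (𝓝[>] 0) (𝓝 0))
    (hδ_slow : Tendsto (fun ε => ε / δ ε) (𝓝[>] 0) (𝓝 0))
    (hσ : Tendsto (fun ε => modulus (curvature I Γ) (δ ε)) (𝓝[>] 0) (𝓝 0)) :
    IsGroundState E₁ J₁ ∧
    ∃ Reff : L2 I →L[ℂ] L2 I, IsResolvent (effectiveHamiltonian I Γ) Complex.I Reff ∧
    ∃ ε₀ > 0, ∃ C > 0, ∀ ε : ℝ, 0 < ε → ε ≤ ε₀ →
      ∃ (U : L2 (curvedStrip I Γ ε) ≃ₗᵢ[ℂ] L2 (straightStrip I))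
        (R : L2 (curvedStrip I Γ ε) →L[ℂ] L2 (curvedStrip I Γ ε)),
        IsStripTransform I Γ ε U ∧
        IsResolvent (dirichletLaplacian axisPlane (curvedStrip I Γ ε))
          ((ε ^ 2)⁻¹ * E₁ + Complex.I) R ∧
        ‖(U : L2 (curvedStrip I Γ ε) →L[ℂ] L2 (straightStrip I)) ∘L R ∘L
            (U.symm : L2 (straightStrip I) →L[ℂ] L2 (curvedStrip I Γ ε)) - extendByZero Reff‖ ≤
          C * (ε + ε * supNorm I (deriv (steklov (curvature I Γ) (δ ε))) +
            modulus (curvature I Γ) (δ ε)) := by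
  refine ⟨isGroundState_J₁, ?_⟩
  obtain ⟨K, hΓ⟩ := exists_isRegularCurve hI_open hI_conn hΓ_C1 hΓ_unit hΓ_W hκ
  have hK := hΓ.nonneg
  have hκm := hΓ.measurable_curvature
  have eV : EssBdd I (fun s => ((-(curvature I Γ s ^ 2 / 4) : ℝ) : ℂ)) (K ^ 2 / 4) := by
    refine essBdd_of_measurable (by fun_prop) fun s => ?_
    rw [abs_neg, abs_of_nonneg (by positivity)]
    have := sq_le_sq' (abs_le.1 (hΓ.curvature_le s)).1 (abs_le.1 (hΓ.curvature_le s)).2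
    linarith
  obtain ⟨Reff, hReff, hweff⟩ := exists_schroedingerResolvent axisLine hI_open eV
  refine ⟨Reff, hReff, ?_⟩
  obtain ⟨ε₁, hε₁, hsub⟩ := mem_nhdsGT_iff_exists_Ioo_subset.1 hinj
  have hε₁' : (0 : ℝ) < ε₁ := hε₁
  have hC : 0 < resolventConst K := by
    unfold resolventConst
    positivity
  -- ε₁/2 because injectivity is known on the open interval (0, ε₁) while ε₀ itself is allowed. The
  -- second bound gives εK ≤ 1/10, which keeps h within 1/10 of 1.
  refine ⟨min (ε₁ / 2) (1 / (10 * (K + 1))), by positivity, resolventConst K, hC,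
    fun ε hε hεle => ?_⟩
  have hεinj : InjOn (stripMap Γ ε) (straightStrip I) :=
    hsub ⟨hε, by linarith [hεle.trans (min_le_left _ _)]⟩
  have hεK : ε * K ≤ 1 / 10 := by
    have h1 : ε ≤ 1 / (10 * (K + 1)) := hεle.trans (min_le_right _ _)
    rw [le_div_iff₀ (by positivity)] at h1
    linarith
  obtain ⟨U, hU⟩ := hΓ.exists_isStripTransform hε hεK hεinj
  obtain ⟨R, hR, hwR⟩ := exists_dirichletResolvent axisPlane
    (hΓ.isOpen_curvedStrip hε hεK hεinj) ((ε ^ 2)⁻¹ * E₁)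
  push_cast at hR hwR
  refine ⟨U, R, hU, by push_cast; exact hR, ?_⟩
  have hη : 0 ≤ ε + ε * supNorm I (deriv (steklov (curvature I Γ) (δ ε))) +
      modulus (curvature I Γ) (δ ε) := by
    have h1 : 0 ≤ supNorm I (deriv (steklov (curvature I Γ) (δ ε))) := ENNReal.toReal_nonneg
    have h2 := modulus_nonneg (curvature I Γ) (δ ε)
    positivity
  -- For a fixed `f`, `extendByZero Reff` sends it to θ ⊗ J₁, where θ solves the effective equation
  -- with the transverse average of `f` as its right-hand side.
  refine ContinuousLinearMap.opNorm_le_bound _ (by positivity) fun f => ?_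
  obtain ⟨g, hg, hgw⟩ := hwR (U.symm f)
  obtain ⟨g', hg', hgw'⟩ := hweff (tensorAdj I f)
  have hqw : ∀ ξ ∈ sobolevZero axisLine I, inner ℂ (ξ.2 0) (g' 0) +
      inner ℂ ξ.1 (mulL I (fun s => ((-(curvature I Γ s ^ 2 / 4) : ℝ) : ℂ)) (Reff (tensorAdj I f))) -
        Complex.I * inner ℂ ξ.1 (Reff (tensorAdj I f)) = inner ℂ ξ.1 (tensorAdj I f) := by
    intro ξ hξ
    have := hgw' ξ.1 ξ.2 hξ
    rwa [Fin.sum_univ_one] at this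
  have hmain := norm_resolvent_sub_le hΓ hε hεK hεinj (hδ_pos ε hε) hU hg hgw hg' hqw
  change ‖U (R (U.symm f)) - tensorJ₁ I (Reff (tensorAdj I f))‖ ≤ _
  exact hmain
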